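/- **Setting.** Let $\mathfrak a$ be a finite-dimensional real vector space with an inner product and let $\Delta$ be a basis of $\mathfrak a^*$ whose elements satisfy $\langle\alpha,\beta\rangle\le 0$ for $\alpha\ne\beta$. Let $A=\exp\mathfrak a$ be the corresponding vector group, with its invariant Riemannian metric, and write $a^\alpha=e^{\alpha(H)}$ for $a=\exp H$. The case of interest is $A=A_P^G=A_P/A_G$, where $P$ is a parabolic $\mathbb Q$-subgroup of a connected reductive $\mathbb Q$-group $G$, $\Delta=\Delta_P$ is the set of simple roots of $P$, and the metric comes from an invariant bilinear form on the Lie algebra of $G$; the statement depends on $(G,P)$ only through these data. For subsets $K\subseteq J\subseteq\Delta$ let $\mathfrak a_K=\bigcap_{\alpha\in K}\ker\alpha$ and $\mathfrak a^K=(\mathfrak a_K)^\perp$, and put $A_K^J=\exp(\mathfrak a_K\cap\mathfrak a^J)$ and $A^J=A_\emptyset^J$, so that $A^J=A_K^J\times A^K$, with projections $\mathrm{pr}_K$ and $\mathrm{pr}^K$ to the two factors. (If $Q,R\ge P$ are the parabolic subgroups with $\Delta_P^Q=K$ and $\Delta_P^R=J$, then $A_K^J=A_Q^R$ and $A^K=A_P^Q$;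 $P$ corresponds to $\emptyset$ and $G$ to $\Delta$.) Let $\bar A=(0,\infty]^\Delta$ with the product topology, containing $A$ through $a\mapsto(a^\alpha)_\alpha$, and let $o_K\in\bar A$ have coordinates $1$ for $\alpha\in K$ and $\infty$ for $\alpha\notin K$. Then $\bar A=\coprod_{K\subseteq\Delta} A^K\cdot o_K$; the closure of the $J$-stratum $A^J\cdot o_J$ is the partial compactification $\bar A^J$ of $A^J$. Put $o_P=o_\emptyset$. A form with values in a complex vector space $E$ (possibly infinite dimensional) is smooth if locally it takes values in a finite-dimensional subspace and is smooth there. Let $\Omega(A_K^J;E)_\infty$ be the complex of germs at $o_K$ of such forms: smooth $E$-valued forms on $U\cap A_K^J$, for $U$ a neighborhood of $o_K$ in the partial compactification of $A_K^J$, modulo equality on smaller $U$. *Quasi-special forms* on an open subset $U$ of $\bar A^J$ with values in $E$ are defined by induction on $\#J$. They are the smooth $E$-valued forms $\psi$ on $U\cap A^J$ such that for every proper subset $K\subsetneq J$: 1. every point $z\in U\cap A^K o_K$ has a special neighborhood, the product of the closure in the partial compactification of $A_K^J(b)=\{a\in A_K^J: a^\alpha>b^\alpha\ \forall\alpha\in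 J\setminus K\}$ for some $b\in A_K^J$ and of a relatively compact open neighborhood $O$ of $z$ in $A^K$, such that on $A_K^J(b)\times O$ one has a finite sum $\psi=\sum_i \mathrm{pr}_K^*\psi_{K,i}\wedge(\mathrm{pr}^K)^*\psi^K_i$ with $\psi_{K,i}$ a smooth $E$-valued form on $A_K^J(b)$ and $\psi_i^K$ a smooth complex-valued form on $O$; 2. the restriction of $\psi$ to the $K$-stratum, locally given by $\sum_i[\psi_{K,i}]\otimes\psi_i^K$ with $[\psi_{K,i}]\in\Omega(A_K^J;E)_\infty$ the germ at $o_K$, is a quasi-special form on $U\cap\bar A^K$ with values in $\Omega(A_K^J;E)_\infty$. Let $\tilde\Omega_{\rm sp}(\bar A;E)_\infty$ denote the germs at $o_P$ of quasi-special forms on neighborhoods of $o_P$ in $\bar A$. If $E$ is a finite-dimensional complex inner product space with a continuous homomorphism $\sigma:A\to GL(E)$ such that every $\sigma(a)$ is self-adjoint, and $\rho\in\mathfrak a^*$, give $E$-valued forms at $a\in A$ the pointwise norm induced by the metric of $A$ and the fiber metric $|v|_a=\|\sigma(a)^{-1}v\|$, and let $h(a)=a^{-\rho}$. Let $\Omega_{(2)}(\bar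 A;E,h)_\infty$ denote the germs at $o_P$ of smooth forms $\psi$ for which $\int_{U\cap A}|\psi|^2h^2\,dV$ and $\int_{U\cap A}|d\psi|^2h^2\,dV$ are finite for some neighborhood $U$ of $o_P$ in $\bar A$. (For a regular $L_P$-module $E_P$ with an admissible inner product, $A_P^G$ acts by self-adjoint operators; in that case $\rho=\rho_P$, half the sum of the roots of $P$ counted with multiplicity.) **Proposition.** 1. For every complex vector space $E$ (in particular for every locally regular $L_P$-module), $\tilde\Omega_{\rm sp}(\bar A;E)_\infty$ is a subcomplex of $\Omega(A;E)_\infty$ and the inclusion $\tilde\Omega_{\rm sp}(\bar A;E)_\infty\to\Omega(A;E)_\infty$ is a quasi-isomorphism. 2. For all $(E,\sigma,\rho)$ as above (in particular for every regular $L_P$-module with an admissible inner product and $\rho=\rho_P$), $\Omega_{(2)}(\bar A;E,h)_\infty$ and $\tilde\Omega_{(2),\rm sp}(\bar A;E,h)_\infty=\Omega_{(2)}(\bar A;E,h)_\infty\cap\tilde\Omega_{\rm sp}(\bar A;E)_\infty$ are subcomplexes of $\Omega(A;E)_\infty$ and the inclusion $\tilde\Omega_{(2),\rm sp}(\bar A;E,h)_\infty\to\Omega_{(2)}(\bar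 A;E,h)_\infty$ is a quasi-isomorphism. -/

import Mathlib

open Filter Topology MeasureTheory Module
open scoped ContDiff ENNReal InnerProductSpace

/-!
Setting. `V` is the Lie algebra of the split component `A = A_P^G` of a parabolic subgroup `P` of a
reductive group `G`, with the inner product given by the invariant metric; `A` itself is `exp V`
and a point `exp H` of `A` is written as `H`. The simple roots of `P` form a basis of the dual of
`V`; through the inner product they are written as a basis `Δ i` of `V`, so that the root
coordinate of `exp H` at `i` is `exp ⟪Δ i, H⟫`. The parabolic subgroups `Q` between `P` and `G`
correspond to the subsets `K` of the index set, `K` being the set of simple roots that are trivial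
on `A_Q`; `P` is `∅` and `G` is `Finset.univ`.
-/

namespace SplitForms

section Forms
variable {W : Type*} [NormedAddCommGroup W] [NormedSpace ℝ W]
variable {E : Type*} [AddCommGroup E] [Module ℂ E] {k : ℕ}

/-- The `E`-valued alternating form `e ⊗ η`. -/
noncomputable def coeffTensor (e : E) (η : W [⋀^Fin k]→ₗ[ℝ] ℂ) : W [⋀^Fin k]→ₗ[ℝ] E :=
  ((LinearMap.toSpanSingleton ℂ E e).restrictScalars ℝ).compAlternatingMap η

/-- On a neighbourhood of `x` the form `f` is the finite sum of the `e i ⊗ η i`, with `e i` in `E`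
and `η i` complex-valued forms that are smooth at `x`. -/
def IsLocalRep (f : W → W [⋀^Fin k]→ₗ[ℝ] E) (x : W) {n : ℕ} (e : Fin n → E)
    (η : Fin n → W → W [⋀^Fin k]→L[ℝ] ℂ) : Prop :=
  (∀ i, ContDiffAt ℝ ∞ (η i) x) ∧
    ∀ᶠ y in 𝓝 x, f y = ∑ i, coeffTensor (e i) (η i y).toAlternatingMap

/-- Smoothness of a form with values in a complex vector space `E` of any dimension: locally the
form takes its values in a finite-dimensional subspace of `E` and is smooth there. -/
def SmoothFormAt (f : W → W [⋀^Fin k]→ₗ[ℝ] E) (x : W) : Prop :=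
  ∃ (n : ℕ) (e : Fin n → E) (η : Fin n → W → W [⋀^Fin k]→L[ℝ] ℂ), IsLocalRep f x e η

open Classical in
/-- Exterior derivative of an `E`-valued form: `∑ e i ⊗ d (η i)` if the form is `∑ e i ⊗ η i` near
`x`; by `dForm_eq` this does not depend on the chosen representation. -/
noncomputable def dForm (f : W → W [⋀^Fin k]→ₗ[ℝ] E) (x : W) : W [⋀^Fin (k + 1)]→ₗ[ℝ] E :=
  if h : SmoothFormAt f x then
    ∑ i, coeffTensor (h.choose_spec.choose i)
      (extDeriv (h.choose_spec.choose_spec.choose i) x).toAlternatingMap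
  else 0

theorem coeffTensor_apply (e : E) (η : W [⋀^Fin k]→ₗ[ℝ] ℂ) (v : Fin k → W) :
    coeffTensor e η v = η v • e := rfl

theorem altSum_apply {l : ℕ} (T : Fin l → W [⋀^Fin k]→ₗ[ℝ] E) (v : Fin k → W) :
    (∑ i, T i) v = ∑ i, T i v := by
  induction l with
  | zero => simp
  | succ l ih => simp [Fin.sum_univ_succ, ih]

theorem sum_extDeriv_congr {n m : ℕ} {e : Fin n → E} {e' : Fin m → E} {x : W}
    {η : Fin n → W → W [⋀^Fin k]→L[ℝ] ℂ} {η' : Fin m → W → W [⋀^Fin k]→L[ℝ] ℂ}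
    (hη : ∀ i, DifferentiableAt ℝ (η i) x) (hη' : ∀ i, DifferentiableAt ℝ (η' i) x)
    (h : ∀ᶠ y in 𝓝 x, ∑ i, coeffTensor (e i) (η i y).toAlternatingMap =
      ∑ i, coeffTensor (e' i) (η' i y).toAlternatingMap) :
    ∑ i, coeffTensor (e i) (extDeriv (η i) x).toAlternatingMap =
      ∑ i, coeffTensor (e' i) (extDeriv (η' i) x).toAlternatingMap := by
  have key : ∀ (φ : Module.Dual ℂ E) {l : ℕ} (e : Fin l → E) (η : Fin l → W → W [⋀^Fin k]→L[ℝ] ℂ)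
      (_ : ∀ i, DifferentiableAt ℝ (η i) x) (v : Fin (k + 1) → W),
      φ ((∑ i, coeffTensor (e i) (extDeriv (η i) x).toAlternatingMap) v) =
        extDeriv (fun y => ∑ i, φ (e i) • η i y) x v := by
    intro φ l e η hη v
    have h1 : fderiv ℝ (fun y => ∑ i, φ (e i) • η i y) x = ∑ i, φ (e i) • fderiv ℝ (η i) x :=
      (HasFDerivAt.fun_sum fun i _ => ((hη i).hasFDerivAt.const_smul (φ (e i)))).fderiv
    have h2 : ∀ T : Fin l → (W →L[ℝ] W [⋀^Fin k]→L[ℝ] ℂ),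
        (ContinuousAlternatingMap.alternatizeUncurryFin (∑ i, φ (e i) • T i)) v =
          ∑ i, φ (e i) • (ContinuousAlternatingMap.alternatizeUncurryFin (T i)) v := by
      intro T
      simp only [ContinuousAlternatingMap.alternatizeUncurryFin_apply, Finset.smul_sum]
      rw [Finset.sum_comm]
      refine Finset.sum_congr rfl fun i _ => ?_
      simp [Finset.smul_sum]
      try (refine Finset.sum_congr rfl fun j _ => ?_; ring)
    rw [extDeriv, h1, h2, altSum_apply, map_sum]
    refine Finset.sum_congr rfl fun i _ => ?_
    rw [coeffTensor_apply, map_smul]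
    exact mul_comm _ _
  ext v
  rw [← sub_eq_zero, ← Module.forall_dual_apply_eq_zero_iff ℂ]
  intro φ
  rw [map_sub, key φ e η hη v, key φ e' η' hη' v, sub_eq_zero]
  congr 1
  apply Filter.EventuallyEq.extDeriv_eq
  filter_upwards [h] with y hy
  ext w
  have := congrArg (fun a => φ (a w)) hy
  simpa [coeffTensor_apply, altSum_apply, mul_comm] using this

theorem dForm_eq' {f : W → W [⋀^Fin k]→ₗ[ℝ] E} {x : W} (hf : SmoothFormAt f x) {n : ℕ}
    {e : Fin n → E} {η : Fin n → W → W [⋀^Fin k]→L[ℝ] ℂ} (hη : ∀ i, DifferentiableAt ℝ (η i) x)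
    (h : ∀ᶠ y in 𝓝 x, f y = ∑ i, coeffTensor (e i) (η i y).toAlternatingMap) :
    dForm f x = ∑ i, coeffTensor (e i) (extDeriv (η i) x).toAlternatingMap := by
  rw [dForm, dif_pos hf]
  have h0 := hf.choose_spec.choose_spec.choose_spec
  refine sum_extDeriv_congr (fun i => (h0.1 i).differentiableAt (by simp)) hη ?_
  filter_upwards [h, h0.2] with y h1 h2
  rw [← h1, ← h2]

theorem dForm_eq {f : W → W [⋀^Fin k]→ₗ[ℝ] E} {x : W} {n : ℕ} {e : Fin n → E}
    {η : Fin n → W → W [⋀^Fin k]→L[ℝ] ℂ} (h : IsLocalRep f x e η) :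
    dForm f x = ∑ i, coeffTensor (e i) (extDeriv (η i) x).toAlternatingMap :=
  dForm_eq' ⟨n, e, η, h⟩ (fun i => (h.1 i).differentiableAt (by simp)) h.2

theorem dForm_congr {f g : W → W [⋀^Fin k]→ₗ[ℝ] E} {x : W} (h : f =ᶠ[𝓝 x] g) :
    dForm f x = dForm g x := by
  by_cases hf : SmoothFormAt f x
  · obtain ⟨n, e, η, h1, h2⟩ := hf
    rw [dForm_eq ⟨h1, h2⟩, dForm_eq (f := g) (e := e) (η := η)]
    exact ⟨h1, by filter_upwards [h, h2] with y a b; rw [← a, b]⟩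
  · have hg : ¬ SmoothFormAt g x := by
      rintro ⟨n, e, η, h1, h2⟩
      exact hf ⟨n, e, η, h1, by filter_upwards [h, h2] with y a b; rw [a, b]⟩
    rw [dForm, dForm, dif_neg hf, dif_neg hg]

theorem SmoothFormAt.congr {f g : W → W [⋀^Fin k]→ₗ[ℝ] E} {x : W} (hf : SmoothFormAt f x)
    (h : f =ᶠ[𝓝 x] g) : SmoothFormAt g x := by
  obtain ⟨n, e, η, h1, h2⟩ := hf
  exact ⟨n, e, η, h1, by filter_upwards [h, h2] with y a b; rw [← a, b]⟩

theorem IsLocalRep.add {f g : W → W [⋀^Fin k]→ₗ[ℝ] E} {x : W} {n m : ℕ} {e : Fin n → E}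
    {e' : Fin m → E} {η : Fin n → W → W [⋀^Fin k]→L[ℝ] ℂ} {η' : Fin m → W → W [⋀^Fin k]→L[ℝ] ℂ}
    (hf : IsLocalRep f x e η) (hg : IsLocalRep g x e' η') :
    IsLocalRep (fun y => f y + g y) x (Fin.append e e') (Fin.append η η') := by
  refine ⟨fun i => ?_, ?_⟩
  · refine Fin.addCases (fun i => ?_) (fun i => ?_) i
    · simpa using hf.1 i
    · simpa using hg.1 i
  · filter_upwards [hf.2, hg.2] with y a b
    simp [a, b, Fin.sum_univ_add]

theorem IsLocalRep.smul {f : W → W [⋀^Fin k]→ₗ[ℝ] E} {x : W} {n : ℕ} {e : Fin n → E}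
    {η : Fin n → W → W [⋀^Fin k]→L[ℝ] ℂ} (hf : IsLocalRep f x e η) (c : ℂ) :
    IsLocalRep (fun y => c • f y) x (fun i => c • e i) η := by
  refine ⟨hf.1, ?_⟩
  filter_upwards [hf.2] with y a
  rw [a, Finset.smul_sum]
  refine Finset.sum_congr rfl fun i _ => ?_
  ext v
  exact smul_comm c _ _

theorem dForm_add {f g : W → W [⋀^Fin k]→ₗ[ℝ] E} {x : W} (hf : SmoothFormAt f x)
    (hg : SmoothFormAt g x) : dForm (fun y => f y + g y) x = dForm f x + dForm g x := by
  obtain ⟨n, e, η, h⟩ := hf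
  obtain ⟨m, e', η', h'⟩ := hg
  rw [dForm_eq (h.add h'), dForm_eq h, dForm_eq h']
  simp [Fin.sum_univ_add]

theorem dForm_smul {f : W → W [⋀^Fin k]→ₗ[ℝ] E} {x : W} (hf : SmoothFormAt f x) (c : ℂ) :
    dForm (fun y => c • f y) x = c • dForm f x := by
  obtain ⟨n, e, η, h⟩ := hf
  rw [dForm_eq (h.smul c), dForm_eq h, Finset.smul_sum]
  refine Finset.sum_congr rfl fun i _ => ?_
  ext v
  exact smul_comm (extDeriv (η i) x v) c (e i)

theorem SmoothFormAt.zero (x : W) : SmoothFormAt (fun _ => (0 : W [⋀^Fin k]→ₗ[ℝ] E)) x :=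
  ⟨0, Fin.elim0, Fin.elim0, fun i => i.elim0, by simp⟩

theorem SmoothFormAt.add {f g : W → W [⋀^Fin k]→ₗ[ℝ] E} {x : W} (hf : SmoothFormAt f x)
    (hg : SmoothFormAt g x) : SmoothFormAt (fun y => f y + g y) x := by
  obtain ⟨n, e, η, h⟩ := hf
  obtain ⟨m, e', η', h'⟩ := hg
  exact ⟨_, _, _, h.add h'⟩

theorem SmoothFormAt.smul {f : W → W [⋀^Fin k]→ₗ[ℝ] E} {x : W} (hf : SmoothFormAt f x) (c : ℂ) :
    SmoothFormAt (fun y => c • f y) x := by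
  obtain ⟨n, e, η, h⟩ := hf
  exact ⟨_, _, _, h.smul c⟩

theorem contDiffAt_extDeriv {η : W → W [⋀^Fin k]→L[ℝ] ℂ} {x : W} (h : ContDiffAt ℝ ∞ η x) :
    ContDiffAt ℝ ∞ (extDeriv η) x :=
  ContDiffAt.comp (g := ContinuousAlternatingMap.alternatizeUncurryFinCLM (n := k) ℝ W ℂ) x
    (ContinuousLinearMap.contDiff _).contDiffAt (h.fderiv_right (m := ∞) le_rfl)

/-- Where a form is smooth on a neighbourhood, its derivative has the differentiated
representations. -/
theorem dForm_isLocalRep {f : W → W [⋀^Fin k]→ₗ[ℝ] E} {x : W} {n : ℕ} {e : Fin n → E}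
    {η : Fin n → W → W [⋀^Fin k]→L[ℝ] ℂ} (h : IsLocalRep f x e η)
    (hf : ∀ᶠ y in 𝓝 x, SmoothFormAt f y) :
    IsLocalRep (dForm f) x e (fun i => extDeriv (η i)) := by
  refine ⟨fun i => contDiffAt_extDeriv (h.1 i), ?_⟩
  have h1 : ∀ᶠ y in 𝓝 x, ∀ i, DifferentiableAt ℝ (η i) y :=
    eventually_all.2 fun i =>
      (((h.1 i).of_le (m := 1) (by simp)).eventually (by simp)).mono
        fun y hy => hy.differentiableAt (by simp)
  filter_upwards [hf, h1, h.2.eventually_nhds] with y a b c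
  exact dForm_eq' a b c

theorem dForm_dForm {f : W → W [⋀^Fin k]→ₗ[ℝ] E} {x : W}
    (hf : ∀ᶠ y in 𝓝 x, SmoothFormAt f y) : dForm (dForm f) x = 0 := by
  obtain ⟨n, e, η, h⟩ := hf.self_of_nhds
  rw [dForm_eq (dForm_isLocalRep h hf)]
  refine Finset.sum_eq_zero fun i _ => ?_
  rw [extDeriv_extDeriv_apply (h.1 i) (by simpa using WithTop.coe_le_coe.2 (le_top (a := (2 : ℕ∞))))]
  ext v
  simp [coeffTensor_apply]

end Forms

section Wedge
variable {W : Type*} [AddCommGroup W] [Module ℝ W] {E : Type*} [AddCommGroup E] [Module ℂ E]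

noncomputable def coeffMul (E : Type*) [AddCommGroup E] [Module ℂ E] : E →ₗ[ℝ] ℂ →ₗ[ℝ] E :=
  LinearMap.mk₂ ℝ (fun e z => z • e) (fun _ _ _ => smul_add _ _ _) (fun c e z => smul_comm z c e)
    (fun _ _ _ => add_smul _ _ _) (fun c e z => smul_assoc c z e)

/-- Exterior product of an `E`-valued and a complex-valued alternating form (sum over shuffles). -/
noncomputable def wedge {p q : ℕ} (a : W [⋀^Fin p]→ₗ[ℝ] E) (c : W [⋀^Fin q]→ₗ[ℝ] ℂ) :
    W [⋀^Fin (p + q)]→ₗ[ℝ] E :=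
  (TensorProduct.lift (coeffMul E)).compAlternatingMap
    ((a.domCoprod c).domDomCongr finSumFinEquiv)

/-- Component of degree `m` of the exterior product of two forms of mixed degree. -/
noncomputable def wedgeTot (a : ∀ p : ℕ, W [⋀^Fin p]→ₗ[ℝ] E) (c : ∀ q : ℕ, W [⋀^Fin q]→ₗ[ℝ] ℂ)
    (m : ℕ) : W [⋀^Fin m]→ₗ[ℝ] E :=
  ∑ p : Fin (m + 1), (wedge (a p) (c (m - p))).domDomCongr (finCongr (by omega))

end Wedge

/-- Differential forms of mixed degree on `W` with values in `E`; `ψ k` is the component of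
degree `k`. -/
abbrev Form (W E : Type*) [AddCommGroup W] [Module ℝ W] [AddCommGroup E] [Module ℂ E] :=
  ∀ k : ℕ, W → W [⋀^Fin k]→ₗ[ℝ] E

section Corner
universe u
variable {V : Type u} [NormedAddCommGroup V] [InnerProductSpace ℝ V]
  {ι : Type*}

/-- The partial compactification: root coordinates in `(0, ∞]`, with the product topology. -/
abbrev Corner (ι : Type*) := ι → Set.Ioi (0 : ℝ≥0∞)

open Classical in
/-- The point `exp H · o_K` of the partial compactification, where `o_K` has coordinates `1` on
`K` and `∞` off `K`. For `H = 0` it is `o_K`, which is `o_P` for `K = ∅`; for `K = Finset.univ` it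
is the point `exp H` of the open stratum. -/
noncomputable def orbitPt (Δ : Basis ι ℝ V) (K : Finset ι) (H : V) : Corner ι := fun i =>
  if i ∈ K then ⟨ENNReal.ofReal (Real.exp ⟪Δ i, H⟫_ℝ), by simp [Real.exp_pos]⟩
  else ⟨⊤, by simp⟩

/-- For `K ⊆ J` corresponding to `Q ≤ R`, the Lie algebra of `A_Q^R`. For `K = ∅`, `J = Finset.univ`
it is all of `V`; for `K = ∅` it is the orthogonal complement of the common kernel of the roots
in `J`; and for `J = Finset.univ` it is the common kernel of the roots in `K`. One has the
orthogonal decomposition `splitSpace ∅ J = splitSpace K J ⊕ splitSpace ∅ K`. -/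
noncomputable def splitSpace (Δ : Basis ι ℝ V) (K J : Finset ι) : Submodule ℝ V :=
  Submodule.span ℝ (Δ '' (J : Set ι)) ⊓ (Submodule.span ℝ (Δ '' (K : Set ι)))ᗮ

/-- The orthogonal projection of `S` to `T`. For `S = splitSpace ∅ J` and `T` one of the summands
`splitSpace K J`, `splitSpace ∅ K` this is the projection given by the decomposition. -/
noncomputable def proj [FiniteDimensional ℝ V] (S T : Submodule ℝ V) : S →ₗ[ℝ] T :=
  (T.orthogonalProjectionOnto : V →ₗ[ℝ] T).comp S.subtype

/-- The translated cone `A_Q^R(b)`, where all root coordinates exceed those of `b`. -/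
noncomputable def cone (Δ : Basis ι ℝ V) (K J : Finset ι) (b : splitSpace Δ K J) : Set (splitSpace Δ K J) :=
  {x | ∀ i ∈ J, i ∉ K → ⟪Δ i, (b : V)⟫_ℝ < ⟪Δ i, (x : V)⟫_ℝ}

/-- Traces on `A_Q^R` of the neighbourhoods of the point `o_Q` of its partial compactification. -/
noncomputable def germFilter (Δ : Basis ι ℝ V) (K J : Finset ι) : Filter (splitSpace Δ K J) :=
  comap (fun x => orbitPt Δ J (x : V)) (𝓝 (orbitPt Δ K 0))

theorem continuous_orbitPt (Δ : Basis ι ℝ V) (K : Finset ι) : Continuous (orbitPt Δ K) := by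
  classical
  refine continuous_pi fun i => ?_
  by_cases hi : i ∈ K
  · simp only [orbitPt, hi, if_true]
    exact Continuous.subtype_mk (ENNReal.continuous_ofReal.comp
      (Real.continuous_exp.comp (continuous_const.inner continuous_id))) _
  · simp only [orbitPt, hi, if_false]
    exact continuous_const

theorem germFilter_eventually_nhds (Δ : Basis ι ℝ V) {K J : Finset ι}
    {p : splitSpace Δ K J → Prop} (h : ∀ᶠ x in germFilter Δ K J, p x) :
    ∀ᶠ x in germFilter Δ K J, ∀ᶠ y in 𝓝 x, p y := by
  have hc : Continuous fun x : splitSpace Δ K J => orbitPt Δ J (x : V) :=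
    (continuous_orbitPt Δ J).comp continuous_subtype_val
  have h' := eventually_eventually_nhds.2 (eventually_comap.1 h)
  refine eventually_comap.2 (h'.mono ?_)
  rintro c hc' x rfl
  exact (hc.continuousAt.eventually hc').mono fun y hy => hy y rfl

/-- Germs at `o_Q` of smooth `k`-forms on `A_Q^R` with values in `E`: the stalk at `o_Q` of the
direct image of the sheaf of smooth forms. -/
noncomputable def smoothGerm (Δ : Basis ι ℝ V) (K J : Finset ι) (E : Type u) [AddCommGroup E]
    [Module ℂ E] (k : ℕ) :
    Submodule ℂ ((germFilter Δ K J).Germ (splitSpace Δ K J [⋀^Fin k]→ₗ[ℝ] E)) where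
  carrier := {g | ∃ f : splitSpace Δ K J → splitSpace Δ K J [⋀^Fin k]→ₗ[ℝ] E,
    g = (f : (germFilter Δ K J).Germ _) ∧ ∀ᶠ x in germFilter Δ K J, SmoothFormAt f x}
  zero_mem' := ⟨0, rfl, .of_forall SmoothFormAt.zero⟩
  add_mem' := by
    rintro _ _ ⟨f, rfl, hf⟩ ⟨g, rfl, hg⟩
    exact ⟨f + g, rfl, by filter_upwards [hf, hg] with x a b using a.add b⟩
  smul_mem' := by
    rintro c _ ⟨f, rfl, hf⟩
    exact ⟨c • f, rfl, by filter_upwards [hf] with x a using a.smul c⟩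

/-- Exterior derivative on germs, before the restriction to smooth germs. -/
noncomputable def germDAux (Δ : Basis ι ℝ V) (K J : Finset ι) (E : Type u) [AddCommGroup E]
    [Module ℂ E] (k : ℕ) :
    (germFilter Δ K J).Germ (splitSpace Δ K J [⋀^Fin k]→ₗ[ℝ] E) →
      (germFilter Δ K J).Germ (splitSpace Δ K J [⋀^Fin (k + 1)]→ₗ[ℝ] E) :=
  Filter.Germ.map' dForm fun _ _ h =>
    (germFilter_eventually_nhds Δ h).mono fun _ hx => dForm_congr hx

theorem smooth_dForm (Δ : Basis ι ℝ V) {K J : Finset ι} {E : Type u} [AddCommGroup E]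
    [Module ℂ E] {k : ℕ} {f : splitSpace Δ K J → splitSpace Δ K J [⋀^Fin k]→ₗ[ℝ] E}
    (hf : ∀ᶠ x in germFilter Δ K J, SmoothFormAt f x) :
    ∀ᶠ x in germFilter Δ K J, SmoothFormAt (dForm f) x := by
  filter_upwards [germFilter_eventually_nhds Δ hf] with x hx
  obtain ⟨n, e, η, h⟩ := hx.self_of_nhds
  exact ⟨n, e, _, dForm_isLocalRep h hx⟩

/-- The differential of the complex of germs of smooth forms. -/
noncomputable def germD (Δ : Basis ι ℝ V) (K J : Finset ι) (E : Type u) [AddCommGroup E]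
    [Module ℂ E] (k : ℕ) : smoothGerm Δ K J E k →ₗ[ℂ] smoothGerm Δ K J E (k + 1) where
  toFun g := ⟨germDAux Δ K J E k g, by
    obtain ⟨_, f, rfl, hf⟩ := g
    exact ⟨dForm f, rfl, smooth_dForm Δ hf⟩⟩
  map_add' := by
    rintro ⟨_, f, rfl, hf⟩ ⟨_, g, rfl, hg⟩
    refine Subtype.ext (Filter.Germ.coe_eq.2 ?_)
    filter_upwards [hf, hg] with x a b using dForm_add a b
  map_smul' := by
    rintro c ⟨_, f, rfl, hf⟩
    refine Subtype.ext (Filter.Germ.coe_eq.2 ?_)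
    filter_upwards [hf] with x a using dForm_smul a c

theorem germD_germD (Δ : Basis ι ℝ V) (K J : Finset ι) (E : Type u) [AddCommGroup E]
    [Module ℂ E] (k : ℕ) (g : smoothGerm Δ K J E k) :
    germD Δ K J E (k + 1) (germD Δ K J E k g) = 0 := by
  obtain ⟨_, f, rfl, hf⟩ := g
  refine Subtype.ext (Filter.Germ.coe_eq.2 ?_)
  filter_upwards [germFilter_eventually_nhds Δ hf] with x hx using dForm_dForm hx

/-- `Θ` is the restriction of `ψ` to the `K`-stratum: for every point `z` of that stratum in `U` there
is a special neighbourhood, the product of a cone `cone K J b` (with its boundary at infinity) and a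
relatively compact neighbourhood `O` of `z`, on which `ψ` is a finite sum of products of a form
`α i` pulled back from the cone, with values in `E`, and a scalar form `β i` pulled back from `O`,
and there `Θ` is the sum of the `[α i] ⊗ β i`, where `[α i] = g i` is the germ of `α i` at `o_K`.
The form `ψ` lives on `splitSpace ∅ J`, and the closure of the `J`-stratum in the partial
compactification is identified with the partial compactification of `splitSpace ∅ J`. -/
def IsRestriction [FiniteDimensional ℝ V] (Δ : Basis ι ℝ V) (K J : Finset ι) (E : Type u) [AddCommGroup E] [Module ℂ E]
    (U : Set (Corner ι)) (ψ : Form (splitSpace Δ ∅ J) E)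
    (Θ : Form (splitSpace Δ ∅ K) (∀ p, smoothGerm Δ K J E p)) : Prop :=
  ∀ z : splitSpace Δ ∅ K, orbitPt Δ K z ∈ U →
    ∃ (b : splitSpace Δ K J) (O : Set (splitSpace Δ ∅ K)),
      IsOpen O ∧ z ∈ O ∧ IsCompact (closure O) ∧
      ∃ (n : ℕ) (α : Fin n → Form (splitSpace Δ K J) E) (β : Fin n → Form (splitSpace Δ ∅ K) ℂ)
        (g : Fin n → ∀ p, smoothGerm Δ K J E p),
        (∀ i p, ∀ x ∈ cone Δ K J b, SmoothFormAt (α i p) x) ∧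
        (∀ i q, ∀ y ∈ O, SmoothFormAt (β i q) y) ∧
        (∀ i p, (g i p).1 = Filter.Germ.ofFun (α i p)) ∧
        (∀ H : splitSpace Δ ∅ J, proj _ (splitSpace Δ K J) H ∈ cone Δ K J b →
          proj _ (splitSpace Δ ∅ K) H ∈ O →
          orbitPt Δ J H ∈ U ∧
          ∀ m, ψ m H = ∑ i, wedgeTot
            (fun p => (α i p (proj _ _ H)).compLinearMap (proj _ (splitSpace Δ K J)))
            (fun q => (β i q (proj _ _ H)).compLinearMap (proj _ (splitSpace Δ ∅ K))) m) ∧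
        ∀ q, ∀ y ∈ O, Θ q y = ∑ i, coeffTensor (g i) (β i q y)

/-- `ψ` is a quasi-special form on the open set `U`, for the partial compactification of
`splitSpace ∅ J`: it is smooth, near every smaller stratum it decomposes as in `IsRestriction`, and
its restriction to that stratum is (recursively) quasi-special, with values in the space of germs
in the transverse direction. For `J = ∅` these are just the elements of `E`. -/
def IsQuasiSpecial [FiniteDimensional ℝ V] (Δ : Basis ι ℝ V) (J : Finset ι) (E : Type u) [AddCommGroup E] [Module ℂ E]
    (U : Set (Corner ι)) (ψ : Form (splitSpace Δ ∅ J) E) : Prop :=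
  (∀ k, ∀ H : splitSpace Δ ∅ J, orbitPt Δ J H ∈ U → SmoothFormAt (ψ k) H) ∧
  ∀ K, K ⊂ J → ∃ Θ : Form (splitSpace Δ ∅ K) (∀ p, smoothGerm Δ K J E p),
    IsRestriction Δ K J E U ψ Θ ∧ IsQuasiSpecial Δ K (∀ p, smoothGerm Δ K J E p) U Θ
termination_by J.card
decreasing_by exact Finset.card_lt_card (by assumption)


/-- Germs at `o_P` of quasi-special forms of degree `k`. -/
def IsQuasiSpecialGerm [FiniteDimensional ℝ V] [Fintype ι] (Δ : Basis ι ℝ V) (E : Type u)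
    [AddCommGroup E] [Module ℂ E] (k : ℕ) (g : smoothGerm Δ ∅ Finset.univ E k) : Prop :=
  ∃ U : Set (Corner ι), IsOpen U ∧ orbitPt Δ ∅ 0 ∈ U ∧
    ∃ f : splitSpace Δ ∅ Finset.univ → splitSpace Δ ∅ Finset.univ [⋀^Fin k]→ₗ[ℝ] E,
      g.1 = Filter.Germ.ofFun f ∧ IsQuasiSpecial Δ Finset.univ E U (Pi.single k f)

/-- Square of the pointwise norm at `exp H` of an alternating form with values in `E`, for the fiber
metric `|v| = ‖σ (exp H)⁻¹ v‖` and the metric on alternating forms in which the increasing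
products of an orthonormal basis of the dual are orthonormal. -/
noncomputable def fiberNormSq {E : Type*} [NormedAddCommGroup E] [InnerProductSpace ℂ E]
    (σ : Multiplicative V →* (E →L[ℂ] E)) (W : Submodule ℝ V) [FiniteDimensional ℝ W] {k : ℕ}
    (H : V) (η : W [⋀^Fin k]→ₗ[ℝ] E) : ℝ :=
  (k.factorial : ℝ)⁻¹ * ∑ s : Fin k → Fin (Module.finrank ℝ W),
    ‖σ (Multiplicative.ofAdd (-H)) (η fun j => stdOrthonormalBasis ℝ W (s j))‖ ^ 2

/-- The weighted `L²` norm of `f` on `O` is finite, for the weight `exp (-ρ H)` at `exp H`. -/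
def IsL2On [FiniteDimensional ℝ V] [MeasurableSpace V] [BorelSpace V] {E : Type*}
    [NormedAddCommGroup E] [InnerProductSpace ℂ E] (σ : Multiplicative V →* (E →L[ℂ] E))
    (ρ : V →ₗ[ℝ] ℝ) (W : Submodule ℝ V) {k : ℕ} (f : W → W [⋀^Fin k]→ₗ[ℝ] E) (O : Set W) : Prop :=
  ∫⁻ H in O, ENNReal.ofReal (fiberNormSq σ W H (f H) * Real.exp (-ρ H) ^ 2) < ⊤

/-- Germs at `o_P` of smooth forms of degree `k` that are, together with their exterior derivative,
of finite weighted `L²` norm on the trace of some neighbourhood of `o_P`. -/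
def IsL2Germ [FiniteDimensional ℝ V] [MeasurableSpace V] [BorelSpace V] [Fintype ι]
    (Δ : Basis ι ℝ V) (E : Type u) [NormedAddCommGroup E] [InnerProductSpace ℂ E]
    (σ : Multiplicative V →* (E →L[ℂ] E)) (ρ : V →ₗ[ℝ] ℝ) (k : ℕ)
    (g : smoothGerm Δ ∅ Finset.univ E k) : Prop :=
  ∃ U : Set (Corner ι), IsOpen U ∧ orbitPt Δ ∅ 0 ∈ U ∧
    ∃ f : splitSpace Δ ∅ Finset.univ → splitSpace Δ ∅ Finset.univ [⋀^Fin k]→ₗ[ℝ] E,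
      g.1 = Filter.Germ.ofFun f ∧
      (∀ H : splitSpace Δ ∅ Finset.univ, orbitPt Δ Finset.univ H ∈ U → SmoothFormAt f H) ∧
      IsL2On σ ρ _ f {H | orbitPt Δ Finset.univ (H : V) ∈ U} ∧
      IsL2On σ ρ _ (dForm f) {H | orbitPt Δ Finset.univ (H : V) ∈ U}

end Corner

section QuasiIso
variable {M : ℕ → Type*} [∀ k, AddCommGroup (M k)] [∀ k, Module ℂ (M k)]

/-- A subcomplex of the complex `(M, d)`. -/
structure Subcomplex (d : ∀ k, M k →ₗ[ℂ] M (k + 1)) where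
  carrier : ∀ k, Submodule ℂ (M k)
  d_mem : ∀ k, ∀ x ∈ carrier k, d k x ∈ carrier (k + 1)

namespace Subcomplex
variable {d : ∀ k, M k →ₗ[ℂ] M (k + 1)}

/-- The complex `(M, d)` itself. -/
def whole (d : ∀ k, M k →ₗ[ℂ] M (k + 1)) : Subcomplex d where
  carrier _ := ⊤
  d_mem _ _ _ := Submodule.mem_top

def cocycles (S : Subcomplex d) (k : ℕ) : Submodule ℂ (M k) :=
  S.carrier k ⊓ LinearMap.ker (d k)

def coboundaries (S : Subcomplex d) : ∀ k, Submodule ℂ (M k)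
  | 0 => ⊥
  | k + 1 => (S.carrier k).map (d k)

/-- Cohomology in degree `k`: cocycles modulo coboundaries. -/
abbrev Cohomology (S : Subcomplex d) (k : ℕ) : Type _ :=
  S.cocycles k ⧸ (S.coboundaries k).submoduleOf (S.cocycles k)

theorem cocycles_mono {S T : Subcomplex d} (h : ∀ k, S.carrier k ≤ T.carrier k) (k : ℕ) :
    S.cocycles k ≤ T.cocycles k := inf_le_inf_right _ (h k)

theorem coboundaries_mono {S T : Subcomplex d} (h : ∀ k, S.carrier k ≤ T.carrier k) :
    ∀ k, S.coboundaries k ≤ T.coboundaries k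
  | 0 => le_rfl
  | k + 1 => Submodule.map_mono (h k)

/-- The map induced in cohomology by an inclusion. -/
def cohomologyMap {S T : Subcomplex d} (h : ∀ k, S.carrier k ≤ T.carrier k) (k : ℕ) :
    S.Cohomology k →ₗ[ℂ] T.Cohomology k :=
  Submodule.mapQ _ _ (Submodule.inclusion (cocycles_mono h k))
    fun _ hx => coboundaries_mono h k hx

/-- `S` is contained in `T` and the inclusion induces an isomorphism in cohomology. -/
def InclusionIsQuasiIso (S T : Subcomplex d) : Prop :=
  ∃ h : ∀ k, S.carrier k ≤ T.carrier k, ∀ k, Function.Bijective (cohomologyMap h k)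

end Subcomplex
end QuasiIso

end SplitForms

open SplitForms

universe u

/-! The first point is that quasi-specialness is a finiteness condition on slices. Near a finite
point of the K-stratum write `A` as the product of `A^K` and the transverse group `A_K`, with
coordinates `(y, x)`. A form is decomposable there if its slices in `x`, for all `y` near the point,
lie in one finite-dimensional space of functions on a neighbourhood of infinity (`DecAt`). By
`isQuasiSpecialGerm_iff` a germ at `o_P` is quasi-special exactly if it is decomposable near every
stratum. The recursion in the definition costs nothing: the restriction to a stratum is a linear
image of the slices, so finiteness near the smaller strata is inherited (`decAt_sliceForm`). The
smooth factors come from `DecAt.exists_rep`, where the factor in `x` is a combination of actual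
slices and the factor in `y` is a scalar evaluation.

It remains to deform arbitrary forms into decomposable ones. Fix `K` and a root `i` in `K`, let `w`
be the root vector, which lies in the Lie algebra of `A^K`, and let `t` be the coordinate along it.
With `T_s` the translation by `s • w`, take the homotopy `h f = χ (∫_{-3}^0 ι_w T_s f ds - ∫_{-3}^3
κ(t, s) ι_w T_s f ds)`, where `κ` falls from `1` at `s = -3` to `0` at `s = 3`. By Cartan's formula
`1 - dh - hd` is, where `χ = 1`, the operator `P f = dt ∧ ι_w ∫ ∂_tκ T_s f ds - ∫ ∂_sκ T_s f ds`
(`homotopy_succ`). The kernel is built so that for `t` near a unit interval both derivatives are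
finite sums of terms `f(t) g(t + s)` with `g` of fixed compact support (`stair_separable`).
Substituting `r = t + s`, each integral becomes `f(t)` times `∫ g(r) F(H - t w + r w) dr`, and the
latter no longer depends on `t`. So `P` separates the variable `t`; doing this for all roots in `K`
separates all of `A^K`, which is decomposability near the K-stratum (`SepAt.stepChain`,
`SepAt.decAt`).

The cutoff `χ` makes the strata independent of each other. It is `1` near the K-stratum. Near an
L-stratum with `#L ≥ #K` there are two cases: if `K ⊆ L`, then `χ` and the smearing involve only the
`A^L` variable, so new slices are averages of old ones and stay in a finite-dimensional space;
otherwise `χ` vanishes. Treating the strata by decreasing cardinality, decomposability once reached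
is never lost (`DecNear.stepOp`). Each step is a homotopy preserving the larger and the smaller
complex and retracting one into the other up to homotopy, hence the inclusion is a quasi-isomorphism
(`decSubcomplex_quasiIso`).

For square-integrable germs the same homotopies work. A translation of bounded length changes fiber
metric and weight by a bounded factor, `κ` is periodic in `t` and so bounded with its derivatives,
and `χ` has bounded gradient. Thus `h` and `1 - dh - hd` preserve square-integrability, and then so
does `dh` on forms whose differential is square-integrable.

Since the coefficients form a bare vector space, derivatives and integrals are defined by testing
with linear functionals; smoothness includes local finite-dimensionality of the values, which makes
the tested element exist. -/

set_option linter.unusedSectionVars false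

namespace SplitForms

/-! ### Weak calculus for functions with values in a vector space without topology -/

section Weak
variable {X X' : Type*} [AddCommGroup X] [Module ℂ X] [AddCommGroup X'] [Module ℂ X']

theorem ext_dual {x y : X} (h : ∀ φ : Module.Dual ℂ X, φ x = φ y) : x = y := by
  rw [← sub_eq_zero, ← Module.forall_dual_apply_eq_zero_iff ℂ]
  intro φ
  rw [map_sub, h, sub_self]

open Classical in
/-- The element of `X` on which each functional `φ` takes the value `ℓ φ`, if there is one. -/
noncomputable def weakElt (ℓ : Module.Dual ℂ X → ℂ) : X :=
  if h : ∃ e, ∀ φ, φ e = ℓ φ then h.choose else 0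

theorem weakElt_eq {ℓ : Module.Dual ℂ X → ℂ} {e : X} (h : ∀ φ, φ e = ℓ φ) : weakElt ℓ = e := by
  have h' : ∃ e, ∀ φ, φ e = ℓ φ := ⟨e, h⟩
  rw [weakElt, dif_pos h']
  exact ext_dual fun φ => by rw [h'.choose_spec, h]

/-- A finite-dimensional subspace has a basis whose coordinates extend to the whole space. -/
theorem exists_coord (G : Submodule ℂ X) [FiniteDimensional ℂ G] :
    ∃ (n : ℕ) (b : Fin n → X) (c : Fin n → Module.Dual ℂ X),
      (∀ i, b i ∈ G) ∧ ∀ g ∈ G, g = ∑ i, c i g • b i := by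
  let B := Module.finBasis ℂ G
  choose c hc using fun i => LinearMap.exists_extend (B.coord i)
  refine ⟨_, fun i => B i, c, fun i => (B i).2, fun g hg => ?_⟩
  have h1 : ((∑ i, B.repr ⟨g, hg⟩ i • B i : G) : X) = g := by rw [B.sum_repr]
  have h2 : ∀ i, c i g = B.repr ⟨g, hg⟩ i := fun i => LinearMap.congr_fun (hc i) ⟨g, hg⟩
  simp only [h2]
  exact h1.symm.trans (Submodule.coe_sum _ _ _)

/-- Elements of a finite-dimensional space of functions are determined by finitely many scalar
evaluations. -/
theorem exists_evaluations {Z : Type*} (G : Submodule ℂ (Z → X)) [hG : FiniteDimensional ℂ G] :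
    ∃ (n : ℕ) (a : Fin n → Z → X) (x : Fin n → Z) (φ : Fin n → Module.Dual ℂ X),
      (∀ i, a i ∈ G) ∧ ∀ g ∈ G, g = ∑ i, φ i (g (x i)) • a i := by
  induction hd : finrank ℂ G using Nat.strong_induction_on generalizing G with
  | _ d ih =>
    by_cases hbot : G = ⊥
    · refine ⟨0, Fin.elim0, Fin.elim0, Fin.elim0, fun i => i.elim0, fun g hg => ?_⟩
      rw [hbot, Submodule.mem_bot] at hg
      simp [hg]
    obtain ⟨g₀, hg₀, hne⟩ := Submodule.exists_mem_ne_zero_of_ne_bot hbot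
    obtain ⟨x₀, hx₀⟩ := Function.ne_iff.1 hne
    obtain ⟨φ₀, hφ₀⟩ : ∃ φ₀ : Module.Dual ℂ X, φ₀ (g₀ x₀) ≠ 0 := by
      by_contra! h
      exact hx₀ ((Module.forall_dual_apply_eq_zero_iff ℂ _).1 h)
    -- A scalar evaluation that is nonzero on `g₀`; its kernel in `G` has smaller dimension, and the
    -- induction hypothesis applies to that kernel.
    let ev : (Z → X) →ₗ[ℂ] ℂ := φ₀.comp (LinearMap.proj x₀)
    have hlt : G ⊓ LinearMap.ker ev < G := by
      refine lt_of_le_of_ne inf_le_left fun h => hφ₀ ?_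
      have : g₀ ∈ G ⊓ LinearMap.ker ev := by rw [h]; exact hg₀
      exact this.2
    have : FiniteDimensional ℂ (G ⊓ LinearMap.ker ev : Submodule ℂ (Z → X)) :=
      Submodule.finiteDimensional_of_le inf_le_left
    obtain ⟨n, a, x, φ, ha, h⟩ := ih _ (hd ▸ Submodule.finrank_lt_finrank_of_lt hlt) _ rfl
    -- The old coefficients are to be read off from `g` and not from its component in the kernel of
    -- `ev`; the expansion subtracted from `g₀` compensates for the difference.
    let r : Z → X := (φ₀ (g₀ x₀))⁻¹ • (g₀ - ∑ i, φ i (g₀ (x i)) • a i)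
    refine ⟨n + 1, Fin.cons r a, Fin.cons x₀ x, Fin.cons φ₀ φ, fun i => ?_, fun g hg => ?_⟩
    · refine Fin.cases ?_ (fun i => ?_) i
      · exact G.smul_mem _ (G.sub_mem hg₀ (G.sum_mem fun i _ => G.smul_mem _ (ha i).1))
      · simpa using (ha i).1
    · have h1 := h (g - (φ₀ (g x₀) * (φ₀ (g₀ x₀))⁻¹) • g₀)
        ⟨G.sub_mem hg (G.smul_mem _ hg₀), by
          simp [ev, hφ₀]⟩
      have h2 : ∀ i, φ i ((g - (φ₀ (g x₀) * (φ₀ (g₀ x₀))⁻¹) • g₀) (x i)) • a i =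
          φ i (g (x i)) • a i - (φ₀ (g x₀) * (φ₀ (g₀ x₀))⁻¹) • φ i (g₀ (x i)) • a i := by
        intro i
        simp [sub_smul, mul_smul]
      simp only [h2, Finset.sum_sub_distrib, ← Finset.smul_sum] at h1
      rw [Fin.sum_univ_succ]
      simp only [Fin.cons_zero, Fin.cons_succ, r]
      rw [sub_eq_iff_eq_add] at h1
      refine h1.trans ?_
      rw [smul_smul, smul_sub]
      abel

variable {W : Type*} [NormedAddCommGroup W] [NormedSpace ℝ W]

/-- Smoothness at a point of a function with values in a complex vector space: near the point the
values are in a finite-dimensional subspace, and the composites with functionals are smooth. -/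
def SmoothFn (F : W → X) (x : W) : Prop :=
  (∃ G : Submodule ℂ X, FiniteDimensional ℂ G ∧ ∀ᶠ y in 𝓝 x, F y ∈ G) ∧
    ∀ φ : Module.Dual ℂ X, ContDiffAt ℝ ∞ (fun y => φ (F y)) x

theorem SmoothFn.zero (x : W) : SmoothFn (fun _ => (0 : X)) x :=
  ⟨⟨⊥, inferInstance, .of_forall fun _ => Submodule.zero_mem _⟩, fun φ => by
    simpa using contDiffAt_const⟩

theorem SmoothFn.const (e : X) (x : W) : SmoothFn (fun _ => e) x :=
  ⟨⟨Submodule.span ℂ {e}, inferInstance, .of_forall fun _ =>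
    Submodule.mem_span_singleton_self e⟩, fun _ => contDiffAt_const⟩

theorem SmoothFn.congr {F F' : W → X} {x : W} (hF : SmoothFn F x) (h : F =ᶠ[𝓝 x] F') :
    SmoothFn F' x := by
  obtain ⟨⟨G, hG, hF1⟩, hF2⟩ := hF
  refine ⟨⟨G, hG, by filter_upwards [hF1, h] with y a b; rwa [← b]⟩, fun φ => ?_⟩
  exact (hF2 φ).congr_of_eventuallyEq (by filter_upwards [h] with y a; rw [a])

theorem SmoothFn.add {F F' : W → X} {x : W} (hF : SmoothFn F x) (hF' : SmoothFn F' x) :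
    SmoothFn (fun y => F y + F' y) x := by
  obtain ⟨⟨G, hG, hF1⟩, hF2⟩ := hF
  obtain ⟨⟨G', hG', hF1'⟩, hF2'⟩ := hF'
  refine ⟨⟨G ⊔ G', inferInstance, ?_⟩, fun φ => ?_⟩
  · filter_upwards [hF1, hF1'] with y a b using Submodule.add_mem_sup a b
  · simpa using (hF2 φ).add (hF2' φ)

theorem SmoothFn.smul {F : W → X} {x : W} {c : W → ℂ} (hc : ContDiffAt ℝ ∞ c x)
    (hF : SmoothFn F x) : SmoothFn (fun y => c y • F y) x := by
  obtain ⟨⟨G, hG, hF1⟩, hF2⟩ := hF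
  refine ⟨⟨G, hG, hF1.mono fun y a => G.smul_mem _ a⟩, fun φ => ?_⟩
  simpa using hc.mul (hF2 φ)

theorem SmoothFn.const_smul {F : W → X} {x : W} (c : ℂ) (hF : SmoothFn F x) :
    SmoothFn (fun y => c • F y) x := hF.smul contDiffAt_const

theorem SmoothFn.neg {F : W → X} {x : W} (hF : SmoothFn F x) : SmoothFn (fun y => - F y) x := by
  simpa using hF.const_smul (-1)

theorem SmoothFn.sub {F F' : W → X} {x : W} (hF : SmoothFn F x) (hF' : SmoothFn F' x) :
    SmoothFn (fun y => F y - F' y) x := by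
  simpa [sub_eq_add_neg] using hF.add hF'.neg

theorem SmoothFn.sum {κ : Type*} {s : Finset κ} {F : κ → W → X} {x : W}
    (hF : ∀ i ∈ s, SmoothFn (F i) x) : SmoothFn (fun y => ∑ i ∈ s, F i y) x := by
  classical
  induction s using Finset.induction_on with
  | empty => simpa using SmoothFn.zero x
  | insert a s ha ih =>
    simp only [Finset.sum_insert ha]
    exact (hF a (by simp)).add (ih fun i hi => hF i (by simp [hi]))

theorem SmoothFn.map {F : W → X} {x : W} (hF : SmoothFn F x) (A : X →ₗ[ℂ] X') :
    SmoothFn (fun y => A (F y)) x := by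
  obtain ⟨⟨G, hG, hF1⟩, hF2⟩ := hF
  exact ⟨⟨G.map A, inferInstance, hF1.mono fun y a => Submodule.mem_map_of_mem a⟩,
    fun φ => hF2 (φ.comp A)⟩

theorem SmoothFn.comp {W' : Type*} [NormedAddCommGroup W'] [NormedSpace ℝ W'] {F : W → X}
    {g : W' → W} {x : W'} (hF : SmoothFn F (g x)) (hg : ContDiffAt ℝ ∞ g x) :
    SmoothFn (fun y => F (g y)) x := by
  obtain ⟨⟨G, hG, hF1⟩, hF2⟩ := hF
  exact ⟨⟨G, hG, hg.continuousAt.eventually hF1⟩, fun φ => (hF2 φ).comp x hg⟩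

/-- Weak directional derivative. -/
noncomputable def weakDeriv (F : W → X) (x v : W) : X :=
  weakElt fun φ => fderiv ℝ (fun y => φ (F y)) x v

/-- Coordinates on `G` reduce the derivative to finitely many scalar ones, so the element described
by functionals exists and lies in `G` again. This keeps the finiteness part of smoothness under
differentiation. -/
theorem SmoothFn.weakDeriv_mem_and_spec {F : W → X} {x : W} {G : Submodule ℂ X}
    [FiniteDimensional ℂ G] (hG : ∀ᶠ y in 𝓝 x, F y ∈ G)
    (hF : ∀ φ : Module.Dual ℂ X, DifferentiableAt ℝ (fun y => φ (F y)) x) (v : W) :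
    weakDeriv F x v ∈ G ∧
      ∀ φ : Module.Dual ℂ X, φ (weakDeriv F x v) = fderiv ℝ (fun y => φ (F y)) x v := by
  obtain ⟨n, b, c, hb, hbc⟩ := exists_coord G
  have key : ∀ φ : Module.Dual ℂ X, φ (∑ i, fderiv ℝ (fun y => c i (F y)) x v • b i) =
      fderiv ℝ (fun y => φ (F y)) x v := by
    intro φ
    have h1 : (fun y => φ (F y)) =ᶠ[𝓝 x] fun y => ∑ i, c i (F y) * φ (b i) := by
      filter_upwards [hG] with y hy
      conv_lhs => rw [hbc _ hy]
      simp
    have h2 : HasFDerivAt (fun y => ∑ i, c i (F y) * φ (b i))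
        (∑ i, φ (b i) • fderiv ℝ (fun y => c i (F y)) x) x :=
      HasFDerivAt.fun_sum fun i _ => (hF (c i)).hasFDerivAt.mul_const (φ (b i))
    rw [h1.fderiv_eq, h2.fderiv]
    simp [mul_comm]
  have he : weakDeriv F x v = ∑ i, fderiv ℝ (fun y => c i (F y)) x v • b i :=
    weakElt_eq key
  rw [he]
  exact ⟨G.sum_mem fun i _ => G.smul_mem _ (hb i), key⟩

theorem SmoothFn.differentiableAt {F : W → X} {x : W} (hF : SmoothFn F x) (φ : Module.Dual ℂ X) :
    DifferentiableAt ℝ (fun y => φ (F y)) x := (hF.2 φ).differentiableAt (by simp)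

theorem SmoothFn.weakDeriv_spec {F : W → X} {x : W} (hF : SmoothFn F x) (v : W)
    (φ : Module.Dual ℂ X) : φ (weakDeriv F x v) = fderiv ℝ (fun y => φ (F y)) x v := by
  obtain ⟨G, hG, hF1⟩ := hF.1
  exact (SmoothFn.weakDeriv_mem_and_spec hF1 hF.differentiableAt v).2 φ

theorem SmoothFn.weakDeriv {F : W → X} {x : W} (hF : ∀ᶠ y in 𝓝 x, SmoothFn F y) (v : W) :
    SmoothFn (fun y => weakDeriv F y v) x := by
  obtain ⟨⟨G, hG, hF1⟩, hF2⟩ := hF.self_of_nhds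
  refine ⟨⟨G, hG, ?_⟩, fun φ => ?_⟩
  · filter_upwards [hF, hF1.eventually_nhds] with y a b
    exact (SmoothFn.weakDeriv_mem_and_spec b a.differentiableAt v).1
  · have h1 : ContDiffAt ℝ ∞ (fun y => fderiv ℝ (fun y => φ (F y)) y v) x :=
      ((hF2 φ).fderiv_right (m := ∞) le_rfl).clm_apply contDiffAt_const
    refine h1.congr_of_eventuallyEq ?_
    filter_upwards [hF] with y a using a.weakDeriv_spec v φ

theorem weakDeriv_congr {F F' : W → X} {x : W} (h : F =ᶠ[𝓝 x] F') (v : W) :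
    weakDeriv F x v = weakDeriv F' x v := by
  rw [weakDeriv, weakDeriv]
  congr 1
  ext φ
  have : (fun y => φ (F y)) =ᶠ[𝓝 x] fun y => φ (F' y) := h.fun_comp φ
  rw [this.fderiv_eq]

theorem weakDeriv_map {F : W → X} {x : W} (hF : SmoothFn F x) (A : X →ₗ[ℂ] X') (v : W) :
    weakDeriv (fun y => A (F y)) x v = A (weakDeriv F x v) :=
  weakElt_eq fun φ => hF.weakDeriv_spec v (φ.comp A)

theorem weakDeriv_add_right {F : W → X} {x : W} (hF : SmoothFn F x) (v v' : W) :
    weakDeriv F x (v + v') = weakDeriv F x v + weakDeriv F x v' :=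
  ext_dual fun φ => by simp [hF.weakDeriv_spec]

theorem weakDeriv_smul_right {F : W → X} {x : W} (hF : SmoothFn F x) (c : ℝ) (v : W) :
    weakDeriv F x (c • v) = (c : ℂ) • weakDeriv F x v :=
  ext_dual fun φ => by simp [hF.weakDeriv_spec]

theorem weakDeriv_add {F F' : W → X} {x : W} (hF : SmoothFn F x) (hF' : SmoothFn F' x) (v : W) :
    weakDeriv (fun y => F y + F' y) x v = weakDeriv F x v + weakDeriv F' x v :=
  weakElt_eq fun φ => by
    have := ((hF.differentiableAt φ).hasFDerivAt.add (hF'.differentiableAt φ).hasFDerivAt).fderiv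
    simp only [map_add, hF.weakDeriv_spec, hF'.weakDeriv_spec]
    exact (DFunLike.congr_fun this v).symm

theorem weakDeriv_smul {F : W → X} {x : W} {c : W → ℂ} (hc : DifferentiableAt ℝ c x)
    (hF : SmoothFn F x) (v : W) :
    weakDeriv (fun y => c y • F y) x v = fderiv ℝ c x v • F x + c x • weakDeriv F x v :=
  weakElt_eq fun φ => by
    have := (hc.hasFDerivAt.mul (hF.differentiableAt φ).hasFDerivAt).fderiv
    simp only [map_add, map_smul, hF.weakDeriv_spec, smul_eq_mul]
    refine Eq.trans ?_ (DFunLike.congr_fun this v).symm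
    simp
    ring

theorem weakDeriv_zero (x v : W) : weakDeriv (fun _ : W => (0 : X)) x v = 0 :=
  weakElt_eq fun φ => by simp

theorem weakDeriv_sum {κ : Type*} {s : Finset κ} {F : κ → W → X} {x : W}
    (hF : ∀ i ∈ s, SmoothFn (F i) x) (v : W) :
    weakDeriv (fun y => ∑ i ∈ s, F i y) x v = ∑ i ∈ s, weakDeriv (F i) x v := by
  classical
  induction s using Finset.induction_on with
  | empty => simpa using weakDeriv_zero x v
  | insert a s ha ih =>
    simp only [Finset.sum_insert ha]
    rw [weakDeriv_add (hF a (by simp)) (SmoothFn.sum fun i hi => hF i (by simp [hi])),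
      ih fun i hi => hF i (by simp [hi])]

theorem weakDeriv_comp {W' : Type*} [NormedAddCommGroup W'] [NormedSpace ℝ W'] {F : W → X}
    {L : W' →L[ℝ] W} {x : W'} (hF : SmoothFn F (L x)) (v : W') :
    weakDeriv (fun y => F (L y)) x v = weakDeriv F (L x) (L v) :=
  weakElt_eq fun φ => by
    have := ((hF.differentiableAt φ).hasFDerivAt.comp x L.hasFDerivAt).fderiv
    rw [hF.weakDeriv_spec]
    exact (DFunLike.congr_fun this v).symm

end Weak
end SplitForms

namespace SplitForms

/-! ### Scalar integrals depending smoothly on a parameter -/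

section ParamIntegral

theorem continuousOn_slice {W Y : Type*} [TopologicalSpace W] [TopologicalSpace Y] {U : Set (W × ℝ)} {Ψ : W × ℝ → Y}
    (hΨ : ContinuousOn Ψ U) {a b : ℝ} {x : W} (hx : ∀ s ∈ Set.uIcc a b, (x, s) ∈ U) :
    ContinuousOn (fun s => Ψ (x, s)) (Set.uIcc a b) :=
  hΨ.comp (by fun_prop) fun s hs => hx s hs

theorem aestronglyMeasurable_slice {W Y : Type*} [TopologicalSpace W] [NormedAddCommGroup Y] {U : Set (W × ℝ)}
    {Ψ : W × ℝ → Y} (hΨ : ContinuousOn Ψ U) {a b : ℝ} {x : W}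
    (hx : ∀ s ∈ Set.uIcc a b, (x, s) ∈ U) :
    AEStronglyMeasurable (fun s => Ψ (x, s)) (volume.restrict (Set.uIoc a b)) :=
  ((continuousOn_slice hΨ hx).aestronglyMeasurable_of_isCompact isCompact_uIcc
    measurableSet_uIcc).mono_set Set.uIoc_subset_uIcc

variable {W : Type*} [NormedAddCommGroup W] [NormedSpace ℝ W] [FiniteDimensional ℝ W]

/-- Compactness of the interval gives one ball of parameters and one bound for all `s`: the
domination needed for limits under the integral. -/
theorem exists_tube_bound {Y : Type*} [NormedAddCommGroup Y] {U : Set (W × ℝ)} (hU : IsOpen U)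
    {a b : ℝ} {x₀ : W} (hx₀ : ∀ s ∈ Set.uIcc a b, (x₀, s) ∈ U) {Ψ : W × ℝ → Y}
    (hΨ : ContinuousOn Ψ U) :
    ∃ ε > 0, ∃ C, ∀ x ∈ Metric.ball x₀ ε, ∀ s ∈ Set.uIcc a b, (x, s) ∈ U ∧ ‖Ψ (x, s)‖ ≤ C := by
  obtain ⟨u, v, hu, -, hxu, hv, huv⟩ := generalized_tube_lemma (isCompact_singleton (x := x₀))
    (isCompact_uIcc (a := a) (b := b)) hU (by rintro ⟨x, s⟩ ⟨rfl, hs⟩; exact hx₀ s hs)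
  obtain ⟨ε, hε, hball⟩ := Metric.isOpen_iff.1 hu x₀ (hxu rfl)
  have hK : IsCompact (Metric.closedBall x₀ (ε / 2) ×ˢ Set.uIcc a b) :=
    (isCompact_closedBall _ _).prod isCompact_uIcc
  have hsub : Metric.closedBall x₀ (ε / 2) ×ˢ Set.uIcc a b ⊆ U := fun p hp =>
    huv ⟨hball (Metric.closedBall_subset_ball (by linarith) hp.1), hv hp.2⟩
  obtain ⟨C, hC⟩ := hK.exists_bound_of_continuousOn (hΨ.mono hsub)
  refine ⟨ε / 2, by positivity, C, fun x hx s hs => ?_⟩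
  have hm : (x, s) ∈ Metric.closedBall x₀ (ε / 2) ×ˢ Set.uIcc a b :=
    ⟨Metric.ball_subset_closedBall hx, hs⟩
  exact ⟨hsub hm, hC _ hm⟩

theorem continuousAt_paramIntegral {U : Set (W × ℝ)} (hU : IsOpen U) {a b : ℝ} {x₀ : W}
    (hx₀ : ∀ s ∈ Set.uIcc a b, (x₀, s) ∈ U) {Φ : W × ℝ → ℂ} (hΦ : ContinuousOn Φ U) :
    ContinuousAt (fun x => ∫ s in a..b, Φ (x, s)) x₀ := by
  obtain ⟨ε, hε, C, hC⟩ := exists_tube_bound hU hx₀ hΦ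
  refine intervalIntegral.continuousAt_of_dominated_interval (bound := fun _ => C) ?_ ?_ (by simp) ?_
  · filter_upwards [Metric.ball_mem_nhds x₀ hε] with x hx
    exact aestronglyMeasurable_slice hΦ fun s hs => (hC x hx s hs).1
  · filter_upwards [Metric.ball_mem_nhds x₀ hε] with x hx
    exact .of_forall fun s hs => (hC x hx s (Set.uIoc_subset_uIcc hs)).2
  · refine .of_forall fun s hs => ?_
    have := (hΦ.continuousAt (hU.mem_nhds (hx₀ s (Set.uIoc_subset_uIcc hs))))
    exact ContinuousAt.comp (f := fun x => (x, s)) this (by fun_prop)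

theorem hasFDerivAt_paramIntegral {U : Set (W × ℝ)} (hU : IsOpen U) {a b : ℝ} {x₀ : W}
    (hx₀ : ∀ s ∈ Set.uIcc a b, (x₀, s) ∈ U) {Φ : W × ℝ → ℂ} (hΦ : ContDiffOn ℝ 1 Φ U) :
    HasFDerivAt (fun x => ∫ s in a..b, Φ (x, s))
      (∫ s in a..b, (fderiv ℝ Φ (x₀, s)).comp (ContinuousLinearMap.inl ℝ W ℝ)) x₀ := by
  have hd : ContinuousOn (fun p => (fderiv ℝ Φ p).comp (ContinuousLinearMap.inl ℝ W ℝ)) U :=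
    ContinuousOn.clm_comp (hΦ.continuousOn_fderiv_of_isOpen hU le_rfl) continuousOn_const
  obtain ⟨ε, hε, C, hC⟩ := exists_tube_bound hU hx₀ hd
  refine intervalIntegral.hasFDerivAt_integral_of_dominated_of_fderiv_le
    (F' := fun x s => (fderiv ℝ Φ (x, s)).comp (ContinuousLinearMap.inl ℝ W ℝ))
    (bound := fun _ => C) (Metric.ball_mem_nhds x₀ hε) ?_ ?_ ?_ ?_ (by simp) ?_
  · filter_upwards [Metric.ball_mem_nhds x₀ hε] with x hx
    exact aestronglyMeasurable_slice hΦ.continuousOn fun s hs => (hC x hx s hs).1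
  · exact (continuousOn_slice hΦ.continuousOn hx₀).intervalIntegrable
  · exact aestronglyMeasurable_slice hd hx₀
  · exact .of_forall fun s hs x hx => (hC x hx s (Set.uIoc_subset_uIcc hs)).2
  · refine .of_forall fun s hs x hx => ?_
    have h1 := (hΦ.contDiffAt (hU.mem_nhds (hC x hx s (Set.uIoc_subset_uIcc hs)).1)).differentiableAt
      (by simp)
    exact HasFDerivAt.comp (f := fun x => (x, s)) x h1.hasFDerivAt (hasFDerivAt_prodMk_left x s)

theorem fderiv_paramIntegral {U : Set (W × ℝ)} (hU : IsOpen U) {a b : ℝ} {x₀ : W}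
    (hx₀ : ∀ s ∈ Set.uIcc a b, (x₀, s) ∈ U) {Φ : W × ℝ → ℂ} (hΦ : ContDiffOn ℝ 1 Φ U) (v : W) :
    fderiv ℝ (fun x => ∫ s in a..b, Φ (x, s)) x₀ v = ∫ s in a..b, fderiv ℝ Φ (x₀, s) (v, 0) := by
  rw [(hasFDerivAt_paramIntegral hU hx₀ hΦ).fderiv, ContinuousLinearMap.intervalIntegral_apply]
  · rfl
  · refine ContinuousOn.intervalIntegrable (continuousOn_slice (Ψ := fun p =>
      (fderiv ℝ Φ p).comp (ContinuousLinearMap.inl ℝ W ℝ)) ?_ hx₀)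
    exact ContinuousOn.clm_comp (hΦ.continuousOn_fderiv_of_isOpen hU le_rfl) continuousOn_const

/-- Induction on the order: a directional derivative of the integral is again an integral of the
same type, of the differentiated integrand. -/
theorem contDiffOn_paramIntegral {Ω : Set W} (hΩ : IsOpen Ω) {U : Set (W × ℝ)} (hU : IsOpen U)
    {a b : ℝ} (hsub : ∀ x ∈ Ω, ∀ s ∈ Set.uIcc a b, (x, s) ∈ U) (n : ℕ) {Φ : W × ℝ → ℂ}
    (hΦ : ContDiffOn ℝ n Φ U) : ContDiffOn ℝ n (fun x => ∫ s in a..b, Φ (x, s)) Ω := by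
  induction n generalizing Φ with
  | zero =>
    have : ContinuousOn Φ U := hΦ.continuousOn
    simp only [CharP.cast_eq_zero, contDiffOn_zero]
    exact fun x hx => (continuousAt_paramIntegral hU (hsub x hx) this).continuousWithinAt
  | succ n ih =>
    have h1 : ContDiffOn ℝ 1 Φ U := hΦ.of_le (by exact_mod_cast Nat.le_add_left 1 n)
    push_cast at hΦ ⊢
    rw [contDiffOn_succ_iff_fderiv_of_isOpen hΩ]
    refine ⟨fun x hx => (hasFDerivAt_paramIntegral hU (hsub x hx)
      h1).differentiableAt.differentiableWithinAt, by simp, contDiffOn_clm_apply.2 fun v => ?_⟩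
    have h2 : ContDiffOn ℝ n (fun p => fderiv ℝ Φ p (v, 0)) U :=
      (hΦ.fderiv_of_isOpen hU le_rfl).clm_apply contDiffOn_const
    exact (ih h2).congr fun x hx => fderiv_paramIntegral hU (hsub x hx) h1 v

end ParamIntegral

/-! ### Averaging along a line with a kernel that depends on the base point -/

section Smear
variable {X X' : Type*} [AddCommGroup X] [Module ℂ X] [AddCommGroup X'] [Module ℂ X']
variable {W : Type*} [NormedAddCommGroup W] [NormedSpace ℝ W]

/-- Integral of the translates of `F` along `w`, with kernel `κ`. -/
noncomputable def smear (w : W) (u : W →L[ℝ] ℝ) (κ : ℝ × ℝ → ℝ) (a b : ℝ) (F : W → X) (H : W) : X :=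
  weakElt fun φ => ∫ s in a..b, (κ (u H, s) : ℂ) * φ (F (H + s • w))

/-- `F` is smooth near the segment from `H + a • w` to `H + b • w`. -/
def SegSmooth (w : W) (a b : ℝ) (F : W → X) (H : W) : Prop :=
  ∀ᶠ H' in 𝓝 H, ∀ s ∈ Set.uIcc a b, SmoothFn F (H' + s • w)

variable {w : W} {u : W →L[ℝ] ℝ} {κ κ₁ κ₂ : ℝ × ℝ → ℝ} {a b : ℝ} {F F' : W → X} {H : W}

theorem SegSmooth.eventually (h : SegSmooth w a b F H) : ∀ᶠ H' in 𝓝 H, SegSmooth w a b F H' :=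
  Filter.Eventually.eventually_nhds h

theorem SegSmooth.map (h : SegSmooth w a b F H) (A : X →ₗ[ℂ] X') :
    SegSmooth w a b (fun y => A (F y)) H :=
  h.mono fun _ hy s hs => (hy s hs).map A

theorem SegSmooth.nhds (h : SegSmooth w a b F H) {s : ℝ} (hs : s ∈ Set.uIcc a b) :
    ∀ᶠ y in 𝓝 (H + s • w), SmoothFn F y := by
  have h1 : Tendsto (fun y => y - s • w) (𝓝 (H + s • w)) (𝓝 H) := by
    have : Continuous fun y : W => y - s • w := by fun_prop
    simpa using this.tendsto (H + s • w)
  filter_upwards [h1.eventually h] with y hy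
  simpa using hy s hs

theorem SegSmooth.weakDeriv (h : SegSmooth w a b F H) (v : W) :
    SegSmooth w a b (fun y => weakDeriv F y v) H := by
  filter_upwards [h.eventually] with H' h' s hs
  exact SmoothFn.weakDeriv (h'.nhds hs) v

/-- The segment is compact, so finitely many of the local finite-dimensional subspaces suffice, and
their sum serves for all nearby parallel segments. -/
theorem SegSmooth.exists_finiteDimensional (h : SegSmooth w a b F H) :
    ∃ G : Submodule ℂ X, FiniteDimensional ℂ G ∧
      ∀ᶠ H' in 𝓝 H, ∀ s ∈ Set.uIcc a b, F (H' + s • w) ∈ G := by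
  refine (isCompact_uIcc (a := a) (b := b)).induction_on (p := fun t =>
    ∃ G : Submodule ℂ X, FiniteDimensional ℂ G ∧ ∀ᶠ H' in 𝓝 H, ∀ s ∈ t, F (H' + s • w) ∈ G)
    ⟨⊥, inferInstance, by simp⟩ ?_ ?_ ?_
  · rintro s t hst ⟨G, hG, hF⟩
    exact ⟨G, hG, hF.mono fun _ h x hx => h x (hst hx)⟩
  · rintro s t ⟨G, hG, hF⟩ ⟨G', hG', hF'⟩
    refine ⟨G ⊔ G', inferInstance, ?_⟩
    filter_upwards [hF, hF'] with y h1 h2 x hx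
    rcases hx with hx | hx
    · exact Submodule.mem_sup_left (h1 x hx)
    · exact Submodule.mem_sup_right (h2 x hx)
  · intro s hs
    obtain ⟨G, hG, hF⟩ := (h.self_of_nhds s hs).1
    have hc : Continuous fun p : W × ℝ => p.1 + p.2 • w := by fun_prop
    have := (hc.tendsto (H, s)).eventually hF
    rw [nhds_prod_eq] at this
    obtain ⟨p, hp, q, hq, hpq⟩ := eventually_prod_iff.1 this
    refine ⟨{s | q s}, mem_nhdsWithin_of_mem_nhds hq, G, hG, hp.mono fun y hy t ht => ?_⟩
    exact hpq hy ht

theorem SegSmooth.continuousOn (h : SegSmooth w a b F H) (φ : Module.Dual ℂ X) :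
    ContinuousOn (fun s => φ (F (H + s • w))) (Set.uIcc a b) := by
  intro s hs
  have := ((h.self_of_nhds s hs).2 φ).continuousAt
  exact (ContinuousAt.comp (f := fun s : ℝ => H + s • w) this (by fun_prop)).continuousWithinAt

theorem SegSmooth.intervalIntegrable (h : SegSmooth w a b F H) (hκ : Continuous κ)
    (φ : Module.Dual ℂ X) :
    IntervalIntegrable (fun s => (κ (u H, s) : ℂ) * φ (F (H + s • w))) volume a b :=
  ContinuousOn.intervalIntegrable (ContinuousOn.mul (by fun_prop) (h.continuousOn φ))

/-- In coordinates on `G` the weak integral is a finite sum of scalar integrals times vectors, so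
`weakElt` does not take its default value here. -/
theorem smear_mem_and_spec (h : SegSmooth w a b F H) (hκ : Continuous κ) {G : Submodule ℂ X}
    [FiniteDimensional ℂ G] (hG : ∀ s ∈ Set.uIcc a b, F (H + s • w) ∈ G) :
    smear w u κ a b F H ∈ G ∧ ∀ φ : Module.Dual ℂ X, φ (smear w u κ a b F H) =
      ∫ s in a..b, (κ (u H, s) : ℂ) * φ (F (H + s • w)) := by
  obtain ⟨n, e, c, he, hec⟩ := exists_coord G
  have key : ∀ φ : Module.Dual ℂ X,
      φ (∑ i, (∫ s in a..b, (κ (u H, s) : ℂ) * c i (F (H + s • w))) • e i) =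
        ∫ s in a..b, (κ (u H, s) : ℂ) * φ (F (H + s • w)) := by
    intro φ
    have h1 : ∫ s in a..b, (κ (u H, s) : ℂ) * φ (F (H + s • w)) =
        ∫ s in a..b, ∑ i, (κ (u H, s) : ℂ) * c i (F (H + s • w)) * φ (e i) := by
      refine intervalIntegral.integral_congr fun s hs => ?_
      conv_lhs => rw [hec _ (hG s hs)]
      simp [Finset.mul_sum, mul_assoc]
    rw [h1, intervalIntegral.integral_finsetSum fun i _ =>
      (h.intervalIntegrable hκ (c i)).mul_const _]
    simp
  have he' : smear w u κ a b F H =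
      ∑ i, (∫ s in a..b, (κ (u H, s) : ℂ) * c i (F (H + s • w))) • e i := weakElt_eq key
  rw [he']
  exact ⟨G.sum_mem fun i _ => G.smul_mem _ (he i), key⟩

theorem smear_spec (h : SegSmooth w a b F H) (hκ : Continuous κ) (φ : Module.Dual ℂ X) :
    φ (smear w u κ a b F H) = ∫ s in a..b, (κ (u H, s) : ℂ) * φ (F (H + s • w)) := by
  obtain ⟨G, hG, hF⟩ := h.exists_finiteDimensional
  exact (smear_mem_and_spec h hκ hF.self_of_nhds).2 φ

theorem smear_congr (h : ∀ s ∈ Set.uIcc a b, F (H + s • w) = F' (H + s • w)) :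
    smear w u κ a b F H = smear w u κ a b F' H := by
  rw [smear, smear]
  congr 1
  ext φ
  exact intervalIntegral.integral_congr fun s hs => by simp only [h s hs]

theorem smear_map (h : SegSmooth w a b F H) (hκ : Continuous κ) (A : X →ₗ[ℂ] X') :
    smear w u κ a b (fun y => A (F y)) H = A (smear w u κ a b F H) :=
  weakElt_eq fun φ => smear_spec h hκ (φ.comp A)

theorem smear_sum {σ : Type*} {t : Finset σ} {f : σ → W → X} (h : ∀ i ∈ t, SegSmooth w a b (f i) H)
    (hκ : Continuous κ) :
    smear w u κ a b (fun y => ∑ i ∈ t, f i y) H = ∑ i ∈ t, smear w u κ a b (f i) H :=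
  weakElt_eq fun φ => by
    simp only [map_sum, Finset.mul_sum]
    rw [intervalIntegral.integral_finsetSum fun i hi => (h i hi).intervalIntegrable hκ φ]
    exact Finset.sum_congr rfl fun i hi => smear_spec (h i hi) hκ φ

theorem smear_const_smul (h : SegSmooth w a b F H) (hκ : Continuous κ) (c : ℂ) :
    smear w u κ a b (fun y => c • F y) H = c • smear w u κ a b F H := by
  simpa using smear_map (u := u) h hκ (c • (LinearMap.id : X →ₗ[ℂ] X))

theorem smear_sub (h : SegSmooth w a b F H) (h' : SegSmooth w a b F' H) (hκ : Continuous κ) :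
    smear w u κ a b (fun y => F y - F' y) H =
      smear w u κ a b F H - smear w u κ a b F' H :=
  weakElt_eq fun φ => by
    simp only [map_sub, smear_spec h hκ, smear_spec h' hκ, mul_sub]
    rw [intervalIntegral.integral_sub (h.intervalIntegrable hκ φ) (h'.intervalIntegrable hκ φ)]

theorem contDiffOn_smearIntegrand (hκ : ContDiff ℝ ∞ κ) (φ : Module.Dual ℂ X) :
    ContDiffOn ℝ ∞ (fun p : W × ℝ => (κ (u p.1, p.2) : ℂ) * φ (F (p.1 + p.2 • w)))
      {p | p.1 + p.2 • w ∈ interior {y | SmoothFn F y}} := by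
  intro p hp
  have h1 : p.1 + p.2 • w ∈ {y | SmoothFn F y} := interior_subset hp
  refine ContDiffAt.contDiffWithinAt (ContDiffAt.mul ?_ ?_)
  · have : ContDiff ℝ ∞ fun p : W × ℝ => κ (u p.1, p.2) := hκ.comp (by fun_prop)
    exact (Complex.ofRealCLM.contDiff.comp this).contDiffAt
  · exact ContDiffAt.comp (f := fun p : W × ℝ => p.1 + p.2 • w) p (h1.2 φ)
      (by fun_prop)

theorem isOpen_smearIntegrand :
    IsOpen {p : W × ℝ | p.1 + p.2 • w ∈ interior {y | SmoothFn F y}} :=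
  isOpen_interior.preimage (by fun_prop)

theorem SegSmooth.mem_interior (h : SegSmooth w a b F H) {s : ℝ} (hs : s ∈ Set.uIcc a b) :
    H + s • w ∈ interior {y | SmoothFn F y} :=
  mem_interior_iff_mem_nhds.2 (h.nhds hs)

/-- Integration by parts in `s`: the derivative along `w` is the derivative in the integration
variable. -/
theorem smear_weakDeriv_self (h : SegSmooth w a b F H) (hκ₂ : Continuous κ₂)
    (hd : ∀ t s, HasDerivAt (fun s => κ (t, s)) (κ₂ (t, s)) s) :
    smear w u κ a b (fun y => weakDeriv F y w) H = (κ (u H, b) : ℂ) • F (H + b • w) -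
      (κ (u H, a) : ℂ) • F (H + a • w) - smear w u κ₂ a b F H := by
  refine weakElt_eq fun φ => ?_
  simp only [map_sub, map_smul, smul_eq_mul, smear_spec h hκ₂]
  have h1 : ∀ s ∈ Set.uIcc a b, HasDerivAt (fun s => (κ (u H, s) : ℂ)) (κ₂ (u H, s) : ℂ) s :=
    fun s _ => (hd (u H) s).ofReal_comp
  have h2 : ∀ s ∈ Set.uIcc a b, HasDerivAt (fun s : ℝ => φ (F (H + s • w)))
      (φ (SplitForms.weakDeriv F (H + s • w) w)) s := by
    intro s hs
    have hs' := h.self_of_nhds s hs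
    rw [hs'.weakDeriv_spec]
    have e1 : HasDerivAt (fun s : ℝ => H + s • w) w s := by
      simpa using ((hasDerivAt_id s).smul_const w).const_add H
    exact HasFDerivAt.comp_hasDerivAt s (hs'.differentiableAt φ).hasFDerivAt e1
  rw [intervalIntegral.integral_mul_deriv_eq_deriv_mul h1 h2
    (Continuous.intervalIntegrable (by fun_prop) _ _)
    (((h.weakDeriv w).continuousOn φ).intervalIntegrable)]

variable [FiniteDimensional ℝ W]

theorem smoothFn_smear (h : SegSmooth w a b F H) (hκ : ContDiff ℝ ∞ κ) :
    SmoothFn (smear w u κ a b F) H := by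
  obtain ⟨G, hG, hF⟩ := h.exists_finiteDimensional
  refine ⟨⟨G, hG, ?_⟩, fun φ => ?_⟩
  · filter_upwards [h.eventually, hF] with H' h1 h2
      using (smear_mem_and_spec h1 hκ.continuous h2).1
  · obtain ⟨Ω, hΩ, hΩo, hH⟩ := eventually_nhds_iff.1 h.eventually
    have h1 : ContDiffOn ℝ ∞ (fun x => ∫ s in a..b, (κ (u x, s) : ℂ) * φ (F (x + s • w))) Ω := by
      refine contDiffOn_infty.2 fun n => ?_
      exact contDiffOn_paramIntegral hΩo isOpen_smearIntegrand
        (fun x hx s hs => (hΩ x hx).mem_interior hs) n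
        ((contDiffOn_smearIntegrand hκ φ).of_le (by exact_mod_cast le_top))
    refine (h1.contDiffAt (hΩo.mem_nhds hH)).congr_of_eventuallyEq ?_
    filter_upwards [h.eventually] with x hx using smear_spec hx hκ.continuous φ

/-- Differentiation under the integral sign. The kernel depends on the point through `u`, which
accounts for the term with `κ₁`; for the homotopy it is the source of `dt ∧ ι_w`. -/
theorem weakDeriv_smear (h : SegSmooth w a b F H) (hκ : ContDiff ℝ ∞ κ) (hκ₁ : Continuous κ₁)
    (hd : ∀ t s, HasDerivAt (fun t => κ (t, s)) (κ₁ (t, s)) t) (v : W) :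
    weakDeriv (smear w u κ a b F) H v =
      (u v : ℂ) • smear w u κ₁ a b F H + smear w u κ a b (fun y => weakDeriv F y v) H := by
  refine weakElt_eq fun φ => ?_
  have h1 : (fun y => φ (smear w u κ a b F y)) =ᶠ[𝓝 H]
      fun x => ∫ s in a..b, (κ (u x, s) : ℂ) * φ (F (x + s • w)) := by
    filter_upwards [h.eventually] with x hx using smear_spec hx hκ.continuous φ
  rw [h1.fderiv_eq, fderiv_paramIntegral isOpen_smearIntegrand (fun s hs => h.mem_interior hs)
    ((contDiffOn_smearIntegrand hκ φ).of_le (by simp))]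
  simp only [map_add, map_smul, smul_eq_mul, smear_spec h hκ₁,
    smear_spec (h.weakDeriv v) hκ.continuous]
  rw [← intervalIntegral.integral_const_mul, ← intervalIntegral.integral_add
    ((h.intervalIntegrable hκ₁ φ).const_mul _) ((h.weakDeriv v).intervalIntegrable hκ.continuous φ)]
  refine intervalIntegral.integral_congr fun s hs => ?_
  have hs' := h.self_of_nhds s hs
  rw [hs'.weakDeriv_spec]
  have e1 : HasFDerivAt (fun p : W × ℝ => (κ (u p.1, p.2) : ℂ) * φ (F (p.1 + p.2 • w)))
      (fderiv ℝ (fun p : W × ℝ => (κ (u p.1, p.2) : ℂ) * φ (F (p.1 + p.2 • w))) (H, s)) (H, s) :=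
    (((contDiffOn_smearIntegrand hκ φ).contDiffAt
      (isOpen_smearIntegrand.mem_nhds (h.mem_interior hs))).differentiableAt (by simp)).hasFDerivAt
  have e2 : HasFDerivAt (fun x : W => (κ (u x, s) : ℂ) * φ (F (x + s • w))) _ H :=
    HasFDerivAt.comp (f := fun x : W => (x, s)) H e1 (hasFDerivAt_prodMk_left H s)
  have e3 : HasFDerivAt (fun x : W => φ (F (x + s • w)))
      (fderiv ℝ (fun y => φ (F y)) (H + s • w)) H :=
    (hasFDerivAt_comp_add_right (s • w)).2 (hs'.differentiableAt φ).hasFDerivAt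
  have e4 : HasFDerivAt (fun x : W => κ (u x, s)) (κ₁ (u H, s) • u) H :=
    (hd (u H) s).comp_hasFDerivAt H u.hasFDerivAt
  have e5 := (Complex.ofRealCLM.hasFDerivAt.comp H e4).mul e3
  have := DFunLike.congr_fun (e2.unique e5) v
  simp only [ContinuousLinearMap.comp_apply, ContinuousLinearMap.inl_apply] at this
  refine Eq.trans ?_ this.symm
  simp
  ring

end Smear
end SplitForms

namespace SplitForms

/-! ### Vector-valued forms, exterior derivative, contraction and multiplication by one-forms -/

section CoeffTensor
variable {W : Type*} [NormedAddCommGroup W] [NormedSpace ℝ W]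
variable {E : Type*} [AddCommGroup E] [Module ℂ E] {k : ℕ}

theorem coeffTensor_add (e : E) (ε ε' : W [⋀^Fin k]→ₗ[ℝ] ℂ) :
    coeffTensor e (ε + ε') = coeffTensor e ε + coeffTensor e ε' := by
  ext v; simp [coeffTensor_apply, add_smul]

theorem coeffTensor_smul (e : E) (c : ℂ) (ε : W [⋀^Fin k]→ₗ[ℝ] ℂ) :
    coeffTensor e (c • ε) = c • coeffTensor e ε := by
  ext v; simp [coeffTensor_apply, mul_smul]

variable (W k) in
/-- `coeffTensor` as a linear map. -/
noncomputable def coeffTensorLM (e : E) :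
    (W [⋀^Fin k]→ₗ[ℝ] ℂ) →ₗ[ℂ] W [⋀^Fin k]→ₗ[ℝ] E where
  toFun := coeffTensor e
  map_add' := coeffTensor_add e
  map_smul' := coeffTensor_smul e

end CoeffTensor

section FormCalculus
variable {W : Type*} [NormedAddCommGroup W] [NormedSpace ℝ W] [FiniteDimensional ℝ W]
variable {E E' : Type*} [AddCommGroup E] [Module ℂ E] [AddCommGroup E'] [Module ℂ E'] {k : ℕ}

instance finiteDimensional_alternatingMap :
    FiniteDimensional ℂ (W [⋀^Fin k]→ₗ[ℝ] ℂ) := by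
  have : Module.Finite ℝ (W [⋀^Fin k]→ₗ[ℝ] ℂ) :=
    Module.Finite.of_injective (AlternatingMap.toMultilinearMapLM (S := ℝ) :
      (W [⋀^Fin k]→ₗ[ℝ] ℂ) →ₗ[ℝ] MultilinearMap ℝ (fun _ : Fin k => W) ℂ)
      AlternatingMap.coe_multilinearMap_injective
  exact Module.Finite.of_restrictScalars_finite ℝ ℂ _

instance finiteDimensional_real_alternatingMap : FiniteDimensional ℝ (W [⋀^Fin k]→ₗ[ℝ] ℂ) :=
  Module.Finite.of_injective (AlternatingMap.toMultilinearMapLM (S := ℝ) :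
    (W [⋀^Fin k]→ₗ[ℝ] ℂ) →ₗ[ℝ] MultilinearMap ℝ (fun _ : Fin k => W) ℂ)
    AlternatingMap.coe_multilinearMap_injective

instance finiteDimensional_continuousAlternatingMap :
    FiniteDimensional ℝ (W [⋀^Fin k]→L[ℝ] ℂ) :=
  Module.Finite.of_injective (ContinuousAlternatingMap.toAlternatingMapLinear (R := ℝ) (A := ℝ) :
    (W [⋀^Fin k]→L[ℝ] ℂ) →ₗ[ℝ] (W [⋀^Fin k]→ₗ[ℝ] ℂ))
    ContinuousAlternatingMap.toAlternatingMap_injective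

theorem continuous_alternatingMap (ε : W [⋀^Fin k]→ₗ[ℝ] ℂ) : Continuous ε := by
  classical
  let b := Module.finBasis ℝ W
  have h : ∀ v : Fin k → W, ε v = ∑ r : Fin k → Fin (finrank ℝ W),
      (∏ i, b.repr (v i) (r i)) • ε fun i => b (r i) := by
    intro v
    have h1 : v = fun i => ∑ j, b.repr (v i) j • b j := by
      ext i; rw [b.sum_repr]
    conv_lhs => rw [h1]
    rw [← AlternatingMap.coe_multilinearMap, MultilinearMap.map_sum]
    simp [MultilinearMap.map_smul_univ]
  have h2 : (ε : (Fin k → W) → ℂ) = fun v => ∑ r : Fin k → Fin (finrank ℝ W),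
      (∏ i, b.repr (v i) (r i)) • ε fun i => b (r i) := funext h
  rw [h2]
  have h3 : ∀ j, Continuous fun w : W => b.repr w j := fun j =>
    (b.coord j).continuous_of_finiteDimensional
  refine continuous_finsetSum _ fun r _ => Continuous.fun_smul
    (continuous_finsetProd _ fun i _ => ?_) continuous_const
  exact (h3 (r i)).comp (continuous_apply i)

/-- An alternating map on a finite-dimensional space as a continuous one. -/
noncomputable def toCont (ε : W [⋀^Fin k]→ₗ[ℝ] ℂ) : W [⋀^Fin k]→L[ℝ] ℂ :=
  { ε with cont := continuous_alternatingMap ε }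

/-- Scalar alternating forms have a finite dual system of evaluations. -/
theorem exists_form_evaluations (W : Type*) [NormedAddCommGroup W] [NormedSpace ℝ W]
    [FiniteDimensional ℝ W] (k : ℕ) :
    ∃ (n : ℕ) (v : Fin n → Fin k → W) (ε : Fin n → W [⋀^Fin k]→ₗ[ℝ] ℂ),
      ∀ c : W [⋀^Fin k]→ₗ[ℝ] ℂ, c = ∑ j, c (v j) • ε j := by
  let A : (W [⋀^Fin k]→ₗ[ℝ] ℂ) →ₗ[ℂ] ((Fin k → W) → ℂ) :=
    { toFun := fun c => c, map_add' := fun _ _ => rfl, map_smul' := fun _ _ => rfl }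
  obtain ⟨n, a, v, φ, ha, h⟩ := exists_evaluations (LinearMap.range A)
  choose ε hε using ha
  -- A functional on `ℂ` is multiplication by its value at `1`, so evaluations followed by
  -- functionals are plain evaluations after rescaling `ε`.
  refine ⟨n, v, fun j => φ j 1 • ε j, fun c => ?_⟩
  ext w
  have h1 := congrFun (h (A c) ⟨c, rfl⟩) w
  rw [altSum_apply]
  refine h1.trans ?_
  rw [Finset.sum_apply]
  refine Finset.sum_congr rfl fun j _ => ?_
  have h2 : φ j (c (v j)) = c (v j) * φ j 1 := by
    rw [← smul_eq_mul, ← map_smul, smul_eq_mul, mul_one]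
  rw [← hε j]
  change φ j (c (v j)) * ε j w = c (v j) * (φ j 1 * ε j w)
  rw [h2, mul_assoc]

/-- Composing with functionals of `E` reduces this to scalar forms, so one dual system serves all
coefficient spaces. -/
theorem eq_sum_coeffTensor {n : ℕ} {v : Fin n → Fin k → W} {ε : Fin n → W [⋀^Fin k]→ₗ[ℝ] ℂ}
    (h : ∀ c : W [⋀^Fin k]→ₗ[ℝ] ℂ, c = ∑ j, c (v j) • ε j) (b : W [⋀^Fin k]→ₗ[ℝ] E) :
    b = ∑ j, coeffTensor (b (v j)) (ε j) := by
  ext w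
  refine ext_dual fun φ => ?_
  have h1 := DFunLike.congr_fun (h ((φ.restrictScalars ℝ).compAlternatingMap b)) w
  rw [altSum_apply] at h1 ⊢
  rw [map_sum]
  refine h1.trans (Finset.sum_congr rfl fun j _ => ?_)
  rw [coeffTensor_apply, map_smul]
  exact mul_comm _ _

theorem SmoothFormAt.sum {κ : Type*} {s : Finset κ} {f : κ → W → W [⋀^Fin k]→ₗ[ℝ] E} {x : W}
    (hf : ∀ i ∈ s, SmoothFormAt (f i) x) : SmoothFormAt (fun y => ∑ i ∈ s, f i y) x := by
  classical
  induction s using Finset.induction_on with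
  | empty => simpa using SmoothFormAt.zero x
  | insert a s ha ih =>
    simp only [Finset.sum_insert ha]
    exact (hf a (by simp)).add (ih fun i hi => hf i (by simp [hi]))

theorem SmoothFormAt.smoothFn {f : W → W [⋀^Fin k]→ₗ[ℝ] E} {x : W} (hf : SmoothFormAt f x) :
    SmoothFn f x := by
  obtain ⟨n, e, η, h1, h2⟩ := hf
  have h3 : ∀ i, SmoothFn (fun y => (η i y).toAlternatingMap) x := by
    refine fun i => ⟨⟨⊤, inferInstance, by simp⟩, fun φ => ?_⟩
    let A : (W [⋀^Fin k]→L[ℝ] ℂ) →ₗ[ℝ] ℂ := (φ.restrictScalars ℝ).comp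
      (ContinuousAlternatingMap.toAlternatingMapLinear (R := ℝ) (A := ℝ))
    exact (LinearMap.toContinuousLinearMap A).contDiff.contDiffAt.comp x (h1 i)
  refine SmoothFn.congr (F := fun y => ∑ i, coeffTensorLM W k (e i) (η i y).toAlternatingMap)
    (SmoothFn.sum fun i _ => (h3 i).map _) ?_
  filter_upwards [h2] with y hy using hy.symm

theorem SmoothFn.smoothFormAt {f : W → W [⋀^Fin k]→ₗ[ℝ] E} {x : W} (hf : SmoothFn f x) :
    SmoothFormAt f x := by
  obtain ⟨⟨G, hG, hF1⟩, hF2⟩ := hf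
  obtain ⟨n, b, c, -, hbc⟩ := exists_coord G
  obtain ⟨m, v, ε, hε⟩ := exists_form_evaluations W k
  have h1 : SmoothFormAt (fun y => ∑ i, ∑ j, coeffTensor (b i (v j)) (c i (f y) • ε j)) x := by
    refine SmoothFormAt.sum fun i _ => SmoothFormAt.sum fun j _ => ?_
    refine ⟨1, fun _ => b i (v j), fun _ y => c i (f y) • toCont (ε j), fun _ => ?_, ?_⟩
    · exact (hF2 (c i)).smul contDiffAt_const
    · exact .of_forall fun y => by simp; rfl
  refine h1.congr ?_
  filter_upwards [hF1] with y hy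
  conv_rhs => rw [hbc _ hy]
  refine Finset.sum_congr rfl fun i _ => ?_
  conv_rhs => rw [eq_sum_coeffTensor hε (b i)]
  rw [Finset.smul_sum]
  exact Finset.sum_congr rfl fun j _ => coeffTensor_smul _ _ _

/-- Allows forms to be treated as functions with values in the vector space of alternating maps, to
which the weak calculus applies. Nontrivial is the construction of `e i ⊗ η i` from coordinates on
the space of values and a dual system of scalar forms. -/
theorem smoothFormAt_iff {f : W → W [⋀^Fin k]→ₗ[ℝ] E} {x : W} :
    SmoothFormAt f x ↔ SmoothFn f x := ⟨SmoothFormAt.smoothFn, SmoothFn.smoothFormAt⟩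

/-- Evaluation of alternating forms at a tuple, as a linear map. -/
def evalAt (E : Type*) [AddCommGroup E] [Module ℂ E] (v : Fin k → W) :
    (W [⋀^Fin k]→ₗ[ℝ] E) →ₗ[ℂ] E where
  toFun η := η v
  map_add' _ _ := rfl
  map_smul' _ _ := rfl

/-- After testing with functionals this is the formula for `extDeriv` of the scalar forms in a local
representation. -/
theorem dForm_apply {f : W → W [⋀^Fin k]→ₗ[ℝ] E} {x : W} (hf : SmoothFn f x)
    (v : Fin (k + 1) → W) :
    dForm f x v = ∑ i : Fin (k + 1), (-1 : ℂ) ^ (i : ℕ) • weakDeriv f x (v i) (i.removeNth v) := by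
  obtain ⟨n, e, η, h⟩ := hf.smoothFormAt
  rw [dForm_eq h, altSum_apply]
  refine ext_dual fun φ => ?_
  have h1 : ∀ i : Fin (k + 1), φ (weakDeriv f x (v i) (i.removeNth v)) =
      ∑ j, fderiv ℝ (fun y => η j y (i.removeNth v)) x (v i) * φ (e j) := by
    intro i
    have h2 : (fun y => φ (f y (i.removeNth v))) =ᶠ[𝓝 x]
        fun y => ∑ j, η j y (i.removeNth v) * φ (e j) := by
      filter_upwards [h.2] with y hy
      rw [hy, altSum_apply, map_sum]
      simp [coeffTensor_apply]
    have h3 := hf.weakDeriv_spec (v i) (φ.comp (evalAt E (i.removeNth v)))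
    have h4 : ∀ j, DifferentiableAt ℝ (fun y => η j y (i.removeNth v)) x := fun j =>
      (((h.1 j).differentiableAt (by simp)).hasFDerivAt.continuousAlternatingMap_apply_const
        _).differentiableAt
    have h5 : HasFDerivAt (fun y => ∑ j, η j y (i.removeNth v) * φ (e j))
        (∑ j, φ (e j) • fderiv ℝ (fun y => η j y (i.removeNth v)) x) x :=
      HasFDerivAt.fun_sum fun j _ => (h4 j).hasFDerivAt.mul_const (φ (e j))
    refine h3.trans ?_
    refine (DFunLike.congr_fun h2.fderiv_eq (v i)).trans ?_
    rw [h5.fderiv]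
    simp [mul_comm]
  simp only [map_sum, map_smul, coeffTensor_apply, h1, smul_eq_mul, Finset.mul_sum]
  rw [Finset.sum_comm]
  refine Finset.sum_congr rfl fun j _ => ?_
  have h6 := extDeriv_apply ((h.1 j).differentiableAt (by simp)) v
  refine (congrArg (· * φ (e j)) h6).trans ?_
  simp [Finset.sum_mul, mul_assoc]

/-- Contraction with a vector. -/
noncomputable def contract (E : Type*) [AddCommGroup E] [Module ℂ E] (k : ℕ) (w : W) :
    (W [⋀^Fin (k + 1)]→ₗ[ℝ] E) →ₗ[ℂ] W [⋀^Fin k]→ₗ[ℝ] E where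
  toFun η := η.curryLeft w
  map_add' _ _ := rfl
  map_smul' _ _ := rfl

/-- Left multiplication with a one-form. -/
noncomputable def extMul (E : Type*) [AddCommGroup E] [Module ℂ E] (k : ℕ) (l : W →L[ℝ] ℝ) :
    (W [⋀^Fin k]→ₗ[ℝ] E) →ₗ[ℂ] W [⋀^Fin (k + 1)]→ₗ[ℝ] E where
  toFun η := AlternatingMap.alternatizeUncurryFin ((l : W →ₗ[ℝ] ℝ).smulRight η)
  map_add' η η' := by
    ext v
    simp [AlternatingMap.alternatizeUncurryFin_apply, Finset.sum_add_distrib]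
  map_smul' c η := by
    ext v
    simp only [AlternatingMap.alternatizeUncurryFin_apply, AlternatingMap.smul_apply,
      LinearMap.smulRight_apply, Finset.smul_sum, RingHom.id_apply]
    refine Finset.sum_congr rfl fun i _ => ?_
    rw [smul_comm c, smul_comm c]

theorem extMul_apply (l : W →L[ℝ] ℝ) (η : W [⋀^Fin k]→ₗ[ℝ] E) (v : Fin (k + 1) → W) :
    extMul E k l η v = ∑ i : Fin (k + 1), (-1 : ℂ) ^ (i : ℕ) • (l (v i) : ℂ) • η (i.removeNth v) := by
  refine (AlternatingMap.alternatizeUncurryFin_apply _ v).trans (Finset.sum_congr rfl fun i _ => ?_)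
  rcases Nat.even_or_odd (i : ℕ) with h | h <;> simp [h.neg_one_pow]

/-- The operator `η ↦ l ∧ ι_w η`, which vanishes in degree `0`. -/
noncomputable def extContract (E : Type*) [AddCommGroup E] [Module ℂ E] (w : W) :
    ∀ (k : ℕ) (_ : W →L[ℝ] ℝ), (W [⋀^Fin k]→ₗ[ℝ] E) →ₗ[ℂ] W [⋀^Fin k]→ₗ[ℝ] E
  | 0, _ => 0
  | k + 1, l => (extMul E k l).comp (contract E k w)

end FormCalculus
end SplitForms

/-! ### The homotopy along one direction and the chain map it produces -/

namespace SplitForms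

/-- A kernel `κ (t, s)` going from `1` at `s = -3` to `0` at `s = 3`, with its partial
derivatives. -/
structure SmoothingKernel where
  κ : ℝ × ℝ → ℝ
  κ₁ : ℝ × ℝ → ℝ
  κ₂ : ℝ × ℝ → ℝ
  contDiff : ContDiff ℝ ∞ κ
  contDiff₁ : ContDiff ℝ ∞ κ₁
  contDiff₂ : ContDiff ℝ ∞ κ₂
  hasDerivAt₁ : ∀ t s, HasDerivAt (fun t => κ (t, s)) (κ₁ (t, s)) t
  hasDerivAt₂ : ∀ t s, HasDerivAt (fun s => κ (t, s)) (κ₂ (t, s)) s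
  left_eq : ∀ t, κ (t, -3) = 1
  right_eq : ∀ t, κ (t, 3) = 0

section Homotopy
variable {W : Type*} [NormedAddCommGroup W] [NormedSpace ℝ W] [FiniteDimensional ℝ W]
variable {X : Type*} [AddCommGroup X] [Module ℂ X]
variable {E : Type*} [AddCommGroup E] [Module ℂ E] {k : ℕ}

/-- The operator `F ↦ ∫_{-3}^0 T_s F - ∫_{-3}^3 κ T_s F`, where `T_s` is translation by `s • w`. -/
noncomputable def smearDiff (N : SmoothingKernel) (w : W) (u : W →L[ℝ] ℝ) (F : W → X) (H : W) : X :=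
  smear w u (fun _ => 1) (-3) 0 F H - smear w u N.κ (-3) 3 F H

/-- The homotopy operator for the cutoff `χ`. -/
noncomputable def homotopyOp (N : SmoothingKernel) (w : W) (u : W →L[ℝ] ℝ) (χ : W → ℝ)
    (f : W → W [⋀^Fin (k + 1)]→ₗ[ℝ] E) (H : W) : W [⋀^Fin k]→ₗ[ℝ] E :=
  (χ H : ℂ) • smearDiff N w u (fun y => contract E k w (f y)) H

/-- Smoothing in the direction `w`, the chain map homotopic to the identity for `χ = 1`. -/
noncomputable def smoothingOp (N : SmoothingKernel) (w : W) (u : W →L[ℝ] ℝ)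
    (f : W → W [⋀^Fin k]→ₗ[ℝ] E) (H : W) : W [⋀^Fin k]→ₗ[ℝ] E :=
  extContract E w k u (smear w u N.κ₁ (-3) 3 f H) - smear w u N.κ₂ (-3) 3 f H

/-- The chain map homotopic to the identity by `homotopyOp`. -/
noncomputable def chainOp (N : SmoothingKernel) (w : W) (u : W →L[ℝ] ℝ) (χ : W → ℝ)
    (f : W → W [⋀^Fin k]→ₗ[ℝ] E) (H : W) : W [⋀^Fin k]→ₗ[ℝ] E :=
  f H - (χ H : ℂ) • (f H - smoothingOp N w u f H) -
    extContract E w k (fderiv ℝ χ H) (smearDiff N w u f H)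

variable {N : SmoothingKernel} {w : W} {u : W →L[ℝ] ℝ} {χ : W → ℝ} {a b : ℝ} {κ : ℝ × ℝ → ℝ}
  {F : W → X} {H : W}

theorem SegSmooth.mono {a' b' : ℝ} (h : SegSmooth w a b F H)
    (hs : Set.uIcc a' b' ⊆ Set.uIcc a b) : SegSmooth w a' b' F H :=
  Filter.Eventually.mono h fun _ hy s hs' => hy s (hs hs')

theorem SegSmooth.left (h : SegSmooth w (-3) 3 F H) : SegSmooth w (-3) 0 F H :=
  h.mono (by rw [Set.uIcc_of_le (by norm_num), Set.uIcc_of_le (by norm_num)]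
             exact Set.Icc_subset_Icc le_rfl (by norm_num))

theorem smoothFn_smearDiff (h : SegSmooth w (-3) 3 F H) : SmoothFn (smearDiff N w u F) H :=
  (smoothFn_smear h.left contDiff_const).sub (smoothFn_smear h N.contDiff)

theorem smearDiff_map {X' : Type*} [AddCommGroup X'] [Module ℂ X'] (h : SegSmooth w (-3) 3 F H)
    (A : X →ₗ[ℂ] X') :
    smearDiff N w u (fun y => A (F y)) H = A (smearDiff N w u F H) := by
  rw [smearDiff, smearDiff, smear_map h.left continuous_const, smear_map h N.contDiff.continuous,
    map_sub]

theorem contDiffAt_ofReal (hχ : ContDiff ℝ ∞ χ) : ContDiffAt ℝ ∞ (fun y => (χ y : ℂ)) H :=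
  (Complex.ofRealCLM.contDiff.comp hχ).contDiffAt

theorem smoothFn_homotopyOp {f : W → W [⋀^Fin (k + 1)]→ₗ[ℝ] E} (h : SegSmooth w (-3) 3 f H)
    (hχ : ContDiff ℝ ∞ χ) : SmoothFn (homotopyOp N w u χ f) H :=
  (smoothFn_smearDiff (h.map _)).smul (contDiffAt_ofReal hχ)

/-- The first of the two integrals has a constant kernel, so only `κ` contributes a derivative in
`t`. -/
theorem weakDeriv_smearDiff (h : SegSmooth w (-3) 3 F H) (v : W) :
    weakDeriv (smearDiff N w u F) H v =
      smearDiff N w u (fun y => weakDeriv F y v) H - (u v : ℂ) • smear w u N.κ₁ (-3) 3 F H := by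
  have h1 := weakDeriv_smear (u := u) h.left (κ := fun _ => 1) (κ₁ := fun _ => 0) contDiff_const
    continuous_const (fun t s => hasDerivAt_const t _) v
  have h2 := weakDeriv_smear (u := u) h N.contDiff N.contDiff₁.continuous N.hasDerivAt₁ v
  have h3 : smear w u (fun _ => 0) (-3) 0 F H = 0 := weakElt_eq fun φ => by simp
  have h4 : SmoothFn (fun y => -smear w u N.κ (-3) 3 F y) H := (smoothFn_smear h N.contDiff).neg
  have h5 := weakDeriv_add (smoothFn_smear (u := u) h.left (κ := fun _ => 1) contDiff_const) h4 v
  have h6 := weakDeriv_map (smoothFn_smear (u := u) h N.contDiff) (-(LinearMap.id : X →ₗ[ℂ] X)) v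
  simp only [LinearMap.neg_apply, LinearMap.id_apply] at h6
  rw [h6, h1, h2, h3] at h5
  have h7 : (fun y => smear w u (fun _ => 1) (-3) 0 F y + -smear w u N.κ (-3) 3 F y) =
      smearDiff N w u F := by ext y; rw [smearDiff, sub_eq_add_neg]
  rw [h7] at h5
  rw [h5, smearDiff]
  simp only [smul_zero, zero_add]
  abel

/-- The boundary terms at `s = -3` cancel because both kernels are `1` there, `κ` vanishes at `s =
3`, and the upper limit `0` of the first integral leaves the form itself. -/
theorem smearDiff_weakDeriv_self (h : SegSmooth w (-3) 3 F H) :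
    smearDiff N w u (fun y => weakDeriv F y w) H = F H + smear w u N.κ₂ (-3) 3 F H := by
  rw [smearDiff, smear_weakDeriv_self (κ₂ := fun _ => 0) h.left continuous_const
    (fun t s => hasDerivAt_const s _), smear_weakDeriv_self h N.contDiff₂.continuous N.hasDerivAt₂,
    N.left_eq, N.right_eq]
  have h3 : smear w u (fun _ => 0) (-3) 0 F H = 0 := weakElt_eq fun φ => by simp
  rw [h3]
  simp
  abel

theorem smearDiff_sum {σ : Type*} {t : Finset σ} {f : σ → W → X}
    (h : ∀ i ∈ t, SegSmooth w (-3) 3 (f i) H) :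
    smearDiff N w u (fun y => ∑ i ∈ t, f i y) H = ∑ i ∈ t, smearDiff N w u (f i) H := by
  rw [smearDiff, smear_sum (fun i hi => (h i hi).left) continuous_const,
    smear_sum h N.contDiff.continuous, ← Finset.sum_sub_distrib]
  rfl

/-- Cartan's formula, smeared. -/
theorem smearDiff_cartan {f : W → W [⋀^Fin (k + 1)]→ₗ[ℝ] E} (h : SegSmooth w (-3) 3 f H)
    (hd : SegSmooth w (-3) 3 (dForm f) H) (v : Fin (k + 1) → W) :
    ∑ i : Fin (k + 1), (-1 : ℂ) ^ (i : ℕ) •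
        smearDiff N w u (fun y => weakDeriv (fun z => contract E k w (f z)) y (v i)) H
          (i.removeNth v) =
      smearDiff N w u (fun y => weakDeriv f y w) H v -
        smearDiff N w u (fun y => contract E (k + 1) w (dForm f y)) H v := by
  have h1 : ∀ i, SegSmooth w (-3) 3 (fun y => weakDeriv (fun z => contract E k w (f z)) y (v i)) H :=
    fun i => (h.map _).weakDeriv _
  have e1 : ∀ i : Fin (k + 1), (-1 : ℂ) ^ (i : ℕ) •
      smearDiff N w u (fun y => weakDeriv (fun z => contract E k w (f z)) y (v i)) H
          (i.removeNth v) =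
      smearDiff N w u (fun y => ((-1 : ℂ) ^ (i : ℕ) • evalAt E (i.removeNth v))
        (weakDeriv (fun z => contract E k w (f z)) y (v i))) H :=
    fun i => (smearDiff_map (h1 i) ((-1 : ℂ) ^ (i : ℕ) • evalAt E (i.removeNth v))).symm
  have e2 : smearDiff N w u (fun y => weakDeriv f y w) H v =
      smearDiff N w u (fun y => evalAt E v (weakDeriv f y w)) H :=
    (smearDiff_map (h.weakDeriv w) (evalAt E v)).symm
  have e3 : smearDiff N w u (fun y => contract E (k + 1) w (dForm f y)) H v =
      smearDiff N w u (fun y => evalAt E v (contract E (k + 1) w (dForm f y))) H :=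
    (smearDiff_map (hd.map _) (evalAt E v)).symm
  simp only [e1, e2, e3]
  rw [← smearDiff_sum fun i _ => (h1 i).map _, sub_eq_add_neg, ← neg_one_smul ℂ,
    eq_comm]
  have e4 : ∀ s ∈ Set.uIcc (-3 : ℝ) 3, evalAt E v (weakDeriv f (H + s • w) w) -
      evalAt E v (contract E (k + 1) w (dForm f (H + s • w))) =
      ∑ i : Fin (k + 1), ((-1 : ℂ) ^ (i : ℕ) • evalAt E (i.removeNth v))
        (weakDeriv (fun z => contract E k w (f z)) (H + s • w) (v i)) := by
    intro s hs
    have h2 : SmoothFn f (H + s • w) := h.self_of_nhds s hs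
    have h3 : contract E (k + 1) w (dForm f (H + s • w)) v =
        dForm f (H + s • w) (Fin.cons w v) := rfl
    change weakDeriv f (H + s • w) w v - contract E (k + 1) w (dForm f (H + s • w)) v = _
    rw [h3, dForm_apply h2, Fin.sum_univ_succ]
    simp only [Fin.val_zero, pow_zero, one_smul, Fin.cons_zero, Fin.removeNth_zero, Fin.tail_cons,
      Fin.cons_succ, sub_add_cancel_left]
    rw [← Finset.sum_neg_distrib]
    refine Finset.sum_congr rfl fun i _ => ?_
    rw [weakDeriv_map h2]
    have h4 : (i.succ.removeNth (Fin.cons w v : Fin (k + 2) → W)) = Fin.cons w (i.removeNth v) := by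
      ext j
      refine Fin.cases ?_ (fun j => ?_) j <;> simp [Fin.removeNth]
    rw [h4]
    simp only [Fin.val_succ, pow_succ, mul_neg, mul_one, neg_smul, neg_neg]
    rfl
  have e5 : SegSmooth w (-3) 3 (fun y => evalAt E v (weakDeriv f y w)) H := (h.weakDeriv w).map _
  have e6 : SegSmooth w (-3) 3 (fun y => evalAt E v (contract E (k + 1) w (dForm f y))) H :=
    (hd.map (contract E (k + 1) w)).map (evalAt E v)
  rw [neg_one_smul, ← sub_eq_add_neg]
  simp only [smearDiff]
  rw [sub_sub_sub_comm, ← smear_sub e5.left e6.left continuous_const,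
    ← smear_sub e5 e6 N.contDiff.continuous]
  congr 1
  · refine smear_congr fun s hs => e4 s ?_
    rw [Set.uIcc_of_le (by norm_num)] at hs ⊢
    exact ⟨hs.1, hs.2.trans (by norm_num)⟩
  · exact smear_congr e4

/-- Degree `0` is separate because the homotopy lowers degree: only the term `hd` is present, and
the contraction of `df` is the derivative along `w`. -/
theorem homotopy_zero {f : W → W [⋀^Fin 0]→ₗ[ℝ] E} (h : SegSmooth w (-3) 3 f H) :
    homotopyOp N w u χ (dForm f) H = f H - chainOp N w u χ f H := by
  have e1 : smearDiff N w u (fun y => contract E 0 w (dForm f y)) H =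
      smearDiff N w u (fun y => weakDeriv f y w) H := by
    have e2 : ∀ s ∈ Set.uIcc (-3 : ℝ) 3, contract E 0 w (dForm f (H + s • w)) =
        weakDeriv f (H + s • w) w := by
      intro s hs
      ext v
      change dForm f (H + s • w) (Fin.cons w v) = _
      rw [dForm_apply (h.self_of_nhds s hs)]
      simp
    rw [smearDiff, smearDiff]
    congr 1
    · refine smear_congr fun s hs => e2 s ?_
      rw [Set.uIcc_of_le (by norm_num)] at hs ⊢
      exact ⟨hs.1, hs.2.trans (by norm_num)⟩
    · exact smear_congr e2
  rw [homotopyOp, e1, smearDiff_weakDeriv_self h, chainOp, smoothingOp]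
  simp [extContract]

/-- The Leibniz rule splits the differential: the gradient of the cutoff gives the last term of
`chainOp`, the derivative of the kernel gives `u ∧ ι_w`, and the rest combines with `hd` by Cartan's
formula to a derivative along `w`, which is integrated by parts. -/
theorem homotopy_succ {f : W → W [⋀^Fin (k + 1)]→ₗ[ℝ] E} (h : SegSmooth w (-3) 3 f H)
    (hd : SegSmooth w (-3) 3 (dForm f) H) (hχ : ContDiff ℝ ∞ χ) :
    dForm (homotopyOp N w u χ f) H + homotopyOp N w u χ (dForm f) H =
      f H - chainOp N w u χ f H := by
  have h1 : SegSmooth w (-3) 3 (fun y => contract E k w (f y)) H := h.map _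
  have hs := smoothFn_smearDiff (N := N) (u := u) h1
  have hc : DifferentiableAt ℝ (fun y => (χ y : ℂ)) H :=
    (contDiffAt_ofReal hχ).differentiableAt (by simp)
  have hc' : ∀ v, fderiv ℝ (fun y => (χ y : ℂ)) H v = (fderiv ℝ χ H v : ℂ) := by
    intro v
    have := (Complex.ofRealCLM.hasFDerivAt.comp H
      ((hχ.differentiable (by simp)) H).hasFDerivAt).fderiv
    exact DFunLike.congr_fun this v
  ext v
  rw [AlternatingMap.add_apply, dForm_apply (smoothFn_homotopyOp h hχ)]
  have e1 : ∀ i : Fin (k + 1), weakDeriv (homotopyOp N w u χ f) H (v i) (i.removeNth v) =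
      (fderiv ℝ χ H (v i) : ℂ) • smearDiff N w u (fun y => contract E k w (f y)) H (i.removeNth v) +
      (χ H : ℂ) • (smearDiff N w u (fun y => weakDeriv (fun z => contract E k w (f z)) y (v i)) H
        (i.removeNth v) - (u (v i) : ℂ) • contract E k w (smear w u N.κ₁ (-3) 3 f H)
          (i.removeNth v)) := by
    intro i
    have := weakDeriv_smul hc hs (v i)
    rw [weakDeriv_smearDiff h1, hc', smear_map h N.contDiff₁.continuous] at this
    exact DFunLike.congr_fun this (i.removeNth v)
  simp only [e1, smul_add, smul_sub, Finset.sum_add_distrib, Finset.sum_sub_distrib]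
  have e2 : ∑ i : Fin (k + 1), (-1 : ℂ) ^ (i : ℕ) • (χ H : ℂ) •
        smearDiff N w u (fun y => weakDeriv (fun z => contract E k w (f z)) y (v i)) H
          (i.removeNth v) = (χ H : ℂ) • (smearDiff N w u (fun y => weakDeriv f y w) H v -
        smearDiff N w u (fun y => contract E (k + 1) w (dForm f y)) H v) := by
    rw [← smearDiff_cartan h hd, Finset.smul_sum]
    exact Finset.sum_congr rfl fun i _ => smul_comm _ _ _
  have e3 : ∑ i : Fin (k + 1), (-1 : ℂ) ^ (i : ℕ) • (χ H : ℂ) • (u (v i) : ℂ) •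
      contract E k w (smear w u N.κ₁ (-3) 3 f H) (i.removeNth v) =
      (χ H : ℂ) • extContract E w (k + 1) u (smear w u N.κ₁ (-3) 3 f H) v := by
    change _ = (χ H : ℂ) • extMul E k u (contract E k w (smear w u N.κ₁ (-3) 3 f H)) v
    rw [extMul_apply, Finset.smul_sum]
    exact Finset.sum_congr rfl fun i _ => smul_comm _ _ _
  have e4 : ∑ i : Fin (k + 1), (-1 : ℂ) ^ (i : ℕ) • (fderiv ℝ χ H (v i) : ℂ) •
      smearDiff N w u (fun y => contract E k w (f y)) H (i.removeNth v) =
      extContract E w (k + 1) (fderiv ℝ χ H) (smearDiff N w u f H) v := by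
    rw [smearDiff_map h]
    exact (extMul_apply _ _ v).symm
  rw [e2, e3, e4, smearDiff_weakDeriv_self h]
  simp only [homotopyOp, chainOp, smoothingOp, AlternatingMap.sub_apply, AlternatingMap.smul_apply,
    AlternatingMap.add_apply]
  simp only [smul_add, smul_sub]
  abel

end Homotopy
end SplitForms

namespace SplitForms

/-! ### The kernel whose derivatives are locally of finite rank -/

section StairKernel

/-- A smooth function that is `0` for `t ≤ 1 / 3` and `1` for `t ≥ 2 / 3`. -/
noncomputable def riseFn (t : ℝ) : ℝ := Real.smoothTransition (3 * t - 1)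

/-- A smooth function that is `1` for `r ≤ 0` and `0` for `r ≥ 1`. -/
noncomputable def dropFn (r : ℝ) : ℝ := Real.smoothTransition (1 - r)

theorem contDiff_riseFn : ContDiff ℝ ∞ riseFn := Real.smoothTransition.contDiff.comp (by fun_prop)

theorem contDiff_dropFn : ContDiff ℝ ∞ dropFn := Real.smoothTransition.contDiff.comp (by fun_prop)

theorem riseFn_zero {t : ℝ} (h : t ≤ 1 / 3) : riseFn t = 0 :=
  Real.smoothTransition.zero_of_nonpos (by linarith)

theorem riseFn_one {t : ℝ} (h : 2 / 3 ≤ t) : riseFn t = 1 :=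
  Real.smoothTransition.one_of_one_le (by linarith)

theorem dropFn_one {r : ℝ} (h : r ≤ 0) : dropFn r = 1 :=
  Real.smoothTransition.one_of_one_le (by linarith)

theorem dropFn_zero {r : ℝ} (h : 1 ≤ r) : dropFn r = 0 :=
  Real.smoothTransition.zero_of_nonpos (by linarith)

/-- The kernel with transition between the nodes `m` and `m + 1`. -/
noncomputable def nodeKernel (m : ℤ) (p : ℝ × ℝ) : ℝ :=
  (1 - riseFn (p.1 - m)) * dropFn (p.1 + p.2 - m) + riseFn (p.1 - m) * dropFn (p.1 + p.2 - m - 1)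

noncomputable def stairKernel (p : ℝ × ℝ) : ℝ := nodeKernel ⌊p.1⌋ p

theorem contDiff_nodeKernel (m : ℤ) : ContDiff ℝ ∞ (nodeKernel m) := by
  have h1 : ContDiff ℝ ∞ fun p : ℝ × ℝ => riseFn (p.1 - m) := contDiff_riseFn.comp (by fun_prop)
  have h2 : ContDiff ℝ ∞ fun p : ℝ × ℝ => dropFn (p.1 + p.2 - m) :=
    contDiff_dropFn.comp (by fun_prop)
  have h3 : ContDiff ℝ ∞ fun p : ℝ × ℝ => dropFn (p.1 + p.2 - m - 1) :=
    contDiff_dropFn.comp (by fun_prop)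
  exact ((contDiff_const.sub h1).mul h2).add (h1.mul h3)

/-- The interpolation weight is constant within `1/3` of every integer, so neighbouring node kernels
agree there. The formula of node `m` thus holds beyond both ends of its unit interval, which gives
smoothness and a margin for working near an arbitrary `t`. -/
theorem stairKernel_eq {m : ℤ} {p : ℝ × ℝ} (h1 : m - 1 / 3 < p.1) (h2 : p.1 < m + 4 / 3) :
    stairKernel p = nodeKernel m p := by
  have hf := Int.floor_le p.1
  have hl := Int.lt_floor_add_one p.1
  have h3 : ⌊p.1⌋ = m - 1 ∨ ⌊p.1⌋ = m ∨ ⌊p.1⌋ = m + 1 := by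
    have a1 : (m : ℝ) - 2 < ⌊p.1⌋ := by linarith
    have a2 : (⌊p.1⌋ : ℝ) < m + 2 := by linarith
    have a3 : m - 2 < ⌊p.1⌋ := by exact_mod_cast a1
    have a4 : ⌊p.1⌋ < m + 2 := by exact_mod_cast a2
    omega
  unfold stairKernel
  rcases h3 with h | h | h
  · rw [h] at hl ⊢
    push_cast at hl
    unfold nodeKernel
    push_cast
    rw [riseFn_one (t := p.1 - (m - 1)) (by linarith), riseFn_zero (t := p.1 - m) (by linarith)]
    simp only [sub_self, zero_mul, zero_add, sub_zero, one_mul, add_zero]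
    congr 1
    ring
  · rw [h]
  · rw [h] at hf ⊢
    push_cast at hf
    unfold nodeKernel
    push_cast
    rw [riseFn_zero (t := p.1 - (m + 1)) (by linarith), riseFn_one (t := p.1 - m) (by linarith)]
    simp only [sub_self, zero_mul, zero_add, sub_zero, one_mul, add_zero]
    congr 1
    ring

theorem eventually_node (m : ℤ) {t : ℝ} (h1 : m - 1 / 3 < t) (h2 : t < m + 4 / 3) :
    ∀ᶠ t' in 𝓝 t, (m : ℝ) - 1 / 3 < t' ∧ t' < m + 4 / 3 :=
  (eventually_gt_nhds h1).and (eventually_lt_nhds h2)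

theorem contDiff_stairKernel : ContDiff ℝ ∞ stairKernel := by
  refine contDiff_iff_contDiffAt.2 fun p => ?_
  have hf := Int.floor_le p.1
  have hl := Int.lt_floor_add_one p.1
  refine (contDiff_nodeKernel ⌊p.1⌋).contDiffAt.congr_of_eventuallyEq ?_
  filter_upwards [continuous_fst.continuousAt.eventually
    (eventually_node ⌊p.1⌋ (t := p.1) (by linarith) (by linarith))] with q hq
    using stairKernel_eq hq.1 hq.2

theorem stairKernel_periodic (p : ℝ × ℝ) : stairKernel (p + (1, 0)) = stairKernel p := by
  unfold stairKernel nodeKernel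
  simp only [Prod.fst_add, Prod.snd_add, Int.floor_add_one, add_zero]
  push_cast
  congr 3 <;> ring_nf

theorem hasDerivAt_fst {κ : ℝ × ℝ → ℝ} (h : ContDiff ℝ ∞ κ) (t s : ℝ) :
    HasDerivAt (fun t => κ (t, s)) (fderiv ℝ κ (t, s) (1, 0)) t := by
  have h1 : HasDerivAt (fun t : ℝ => (t, s)) (1, 0) t := (hasDerivAt_id t).prodMk (hasDerivAt_const t s)
  exact HasFDerivAt.comp_hasDerivAt (f := fun t : ℝ => (t, s)) t
    ((h.differentiable (by simp)) (t, s)).hasFDerivAt h1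

theorem hasDerivAt_snd {κ : ℝ × ℝ → ℝ} (h : ContDiff ℝ ∞ κ) (t s : ℝ) :
    HasDerivAt (fun s => κ (t, s)) (fderiv ℝ κ (t, s) (0, 1)) s := by
  have h1 : HasDerivAt (fun s : ℝ => (t, s)) (0, 1) s := (hasDerivAt_const s t).prodMk (hasDerivAt_id s)
  exact HasFDerivAt.comp_hasDerivAt (f := fun s : ℝ => (t, s)) s
    ((h.differentiable (by simp)) (t, s)).hasFDerivAt h1

/-- The smoothing kernel averaging over the unit intervals to the right of the integers. -/
noncomputable def stair : SmoothingKernel where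
  κ := stairKernel
  κ₁ p := fderiv ℝ stairKernel p (1, 0)
  κ₂ p := fderiv ℝ stairKernel p (0, 1)
  contDiff := contDiff_stairKernel
  contDiff₁ := (contDiff_stairKernel.fderiv_right (m := ∞) le_rfl).clm_apply contDiff_const
  contDiff₂ := (contDiff_stairKernel.fderiv_right (m := ∞) le_rfl).clm_apply contDiff_const
  hasDerivAt₁ := hasDerivAt_fst contDiff_stairKernel
  hasDerivAt₂ := hasDerivAt_snd contDiff_stairKernel
  left_eq t := by
    have hl := Int.lt_floor_add_one t
    simp only [stairKernel, nodeKernel]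
    rw [dropFn_one (by linarith), dropFn_one (by linarith)]
    ring
  right_eq t := by
    have hf := Int.floor_le t
    simp only [stairKernel, nodeKernel]
    rw [dropFn_zero (by linarith), dropFn_zero (by linarith)]
    ring

/-- Near `m` the derivatives of the kernel are of finite rank. -/
theorem stair_separable (m : ℤ) : ∃ f₁ f₂ g : Fin 3 → ℝ → ℝ, (∀ e, ContDiff ℝ ∞ (g e)) ∧
    (∀ e r, r ∉ Set.Icc (m : ℝ) (m + 2) → g e r = 0) ∧
    ∀ t s, (m : ℝ) - 1 / 3 < t → t < m + 4 / 3 →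
      stair.κ₁ (t, s) = ∑ e, f₁ e t * g e (t + s) ∧ stair.κ₂ (t, s) = ∑ e, f₂ e t * g e (t + s) := by
  have hd : ContDiff ℝ ∞ (deriv dropFn) := contDiff_dropFn.deriv'
  have hd0 : ∀ r, r < 0 → deriv dropFn r = 0 := fun r hr => by
    have : dropFn =ᶠ[𝓝 r] fun _ => 1 := by
      filter_upwards [eventually_lt_nhds hr] with x hx using dropFn_one hx.le
    rw [this.deriv_eq, deriv_const]
  have hd1 : ∀ r, 1 < r → deriv dropFn r = 0 := fun r hr => by
    have : dropFn =ᶠ[𝓝 r] fun _ => 0 := by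
      filter_upwards [eventually_gt_nhds hr] with x hx using dropFn_zero hx.le
    rw [this.deriv_eq, deriv_const]
  have hdr : ∀ r, HasDerivAt dropFn (deriv dropFn r) r := fun r =>
    ((contDiff_dropFn.differentiable (by simp)) r).hasDerivAt
  have hri : ∀ r, HasDerivAt riseFn (deriv riseFn r) r := fun r =>
    ((contDiff_riseFn.differentiable (by simp)) r).hasDerivAt
  -- Two terms differentiate the steps at the nodes; the third, present only in the derivative in
  -- `t`, differentiates the weight and multiplies the difference of the two steps. That difference
  -- vanishes outside `[m, m + 2]`, as both steps are `1` to the left and `0` to the right.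
  refine ⟨![fun t => 1 - riseFn (t - m), fun t => riseFn (t - m), fun t => deriv riseFn (t - m)],
    ![fun t => 1 - riseFn (t - m), fun t => riseFn (t - m), fun t => 0],
    ![fun r => deriv dropFn (r - m), fun r => deriv dropFn (r - m - 1),
      fun r => dropFn (r - m - 1) - dropFn (r - m)], ?_, ?_, ?_⟩
  · intro e
    fin_cases e
    · exact hd.comp (by fun_prop)
    · exact hd.comp (by fun_prop)
    · exact (contDiff_dropFn.comp (by fun_prop : ContDiff ℝ ∞ fun r : ℝ => r - m - 1)).sub
        (contDiff_dropFn.comp (by fun_prop : ContDiff ℝ ∞ fun r : ℝ => r - m))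
  · intro e r hr
    rw [Set.mem_Icc, not_and_or, not_le, not_le] at hr
    fin_cases e
    · rcases hr with hr | hr
      · exact hd0 _ (by linarith)
      · exact hd1 _ (by linarith)
    · rcases hr with hr | hr
      · exact hd0 _ (by linarith)
      · exact hd1 _ (by linarith)
    · rcases hr with hr | hr
      · simp [dropFn_one (r := r - m - 1) (by linarith), dropFn_one (r := r - m) (by linarith)]
      · simp [dropFn_zero (r := r - m - 1) (by linarith), dropFn_zero (r := r - m) (by linarith)]
  · intro t s ht1 ht2
    have k1 : HasDerivAt (fun s => nodeKernel m (t, s)) ((1 - riseFn (t - m)) *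
        deriv dropFn (t + s - m) + riseFn (t - m) * deriv dropFn (t + s - m - 1)) s := by
      have a1 : HasDerivAt (fun s => t + s - m) 1 s := ((hasDerivAt_id s).const_add t).sub_const _
      have a2 : HasDerivAt (fun s => t + s - m - 1) 1 s := a1.sub_const _
      simpa [nodeKernel, Function.comp_def, Pi.add_def, Pi.mul_def] using (((hdr _).comp s a1).const_mul (1 - riseFn (t - m))).add
        (((hdr _).comp s a2).const_mul (riseFn (t - m)))
    have k2 : HasDerivAt (fun t => nodeKernel m (t, s)) ((-deriv riseFn (t - m) *
        dropFn (t + s - m) + (1 - riseFn (t - m)) * deriv dropFn (t + s - m)) +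
        (deriv riseFn (t - m) * dropFn (t + s - m - 1) +
          riseFn (t - m) * deriv dropFn (t + s - m - 1))) t := by
      have a0 : HasDerivAt (fun t : ℝ => t - m) 1 t := (hasDerivAt_id t).sub_const _
      have a1 : HasDerivAt (fun t => t + s - m) 1 t := ((hasDerivAt_id t).add_const s).sub_const _
      have a2 : HasDerivAt (fun t => t + s - m - 1) 1 t := a1.sub_const _
      have b0 := (hri _).comp t a0
      simpa [nodeKernel, Function.comp_def, Pi.add_def, Pi.mul_def] using ((b0.const_sub 1).mul ((hdr _).comp t a1)).add
        (b0.mul ((hdr _).comp t a2))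
    have e1 : (fun t => stairKernel (t, s)) =ᶠ[𝓝 t] fun t => nodeKernel m (t, s) := by
      filter_upwards [eventually_node m ht1 ht2] with t' ht' using stairKernel_eq ht'.1 ht'.2
    have e2 : (fun s => stairKernel (t, s)) = fun s => nodeKernel m (t, s) := by
      ext s; exact stairKernel_eq ht1 ht2
    constructor
    · rw [(stair.hasDerivAt₁ t s).unique (k2.congr_of_eventuallyEq e1)]
      simp [Fin.sum_univ_three]
      ring
    · have := stair.hasDerivAt₂ t s
      rw [show stair.κ = stairKernel from rfl, e2] at this
      rw [this.unique k1]
      simp [Fin.sum_univ_three]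

/-- By periodicity only the compact rectangle `[0, 1] × [-3, 3]` matters. -/
theorem bounded_of_periodic {f : ℝ × ℝ → ℝ} (hf : Continuous f) (h : ∀ p, f (p + (1, 0)) = f p) :
    ∃ C, ∀ t, ∀ s ∈ Set.Icc (-3 : ℝ) 3, ‖f (t, s)‖ ≤ C := by
  have hK : IsCompact (Set.Icc (0 : ℝ) 1 ×ˢ Set.Icc (-3 : ℝ) 3) := isCompact_Icc.prod isCompact_Icc
  obtain ⟨C, hC⟩ := hK.exists_bound_of_continuousOn hf.continuousOn
  refine ⟨C, fun t s hs => ?_⟩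
  have h1 : Function.Periodic (fun t => f (t, s)) 1 := fun t => by
    simpa using h (t, s)
  have h2 : f (t, s) = f (Int.fract t, s) := by
    have := h1.sub_zsmul_eq ⌊t⌋ (x := t)
    rw [Int.fract]
    simpa using this.symm
  rw [h2]
  exact hC _ ⟨⟨Int.fract_nonneg t, (Int.fract_lt_one t).le⟩, hs⟩

theorem stair_bounded : ∃ C, ∀ t, ∀ s ∈ Set.Icc (-3 : ℝ) 3,
    ‖stair.κ (t, s)‖ ≤ C ∧ ‖stair.κ₁ (t, s)‖ ≤ C ∧ ‖stair.κ₂ (t, s)‖ ≤ C := by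
  have hp : ∀ p, fderiv ℝ stairKernel (p + (1, 0)) = fderiv ℝ stairKernel p := by
    intro p
    rw [← fderiv_comp_add_right]
    congr 1
    ext p
    exact stairKernel_periodic p
  obtain ⟨C, hC⟩ := bounded_of_periodic stair.contDiff.continuous stairKernel_periodic
  obtain ⟨C₁, hC₁⟩ := bounded_of_periodic stair.contDiff₁.continuous fun p => by simp [stair, hp]
  obtain ⟨C₂, hC₂⟩ := bounded_of_periodic stair.contDiff₂.continuous fun p => by simp [stair, hp]
  exact ⟨max C (max C₁ C₂), fun t s hs => ⟨(hC t s hs).trans (by simp),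
    (hC₁ t s hs).trans (by simp), (hC₂ t s hs).trans (by simp)⟩⟩

end StairKernel
end SplitForms

namespace SplitForms

/-! ### Decomposability: slices in a fixed finite-dimensional space -/

section Decomposable
variable {W Y Z : Type*} [NormedAddCommGroup W] [NormedSpace ℝ W] [FiniteDimensional ℝ W]
  [NormedAddCommGroup Y] [NormedSpace ℝ Y] [FiniteDimensional ℝ Y]
  [NormedAddCommGroup Z] [NormedSpace ℝ Z] [FiniteDimensional ℝ Z]
variable {X X' : Type*} [AddCommGroup X] [Module ℂ X] [AddCommGroup X'] [Module ℂ X']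

/-- For `y` near `y₀` the slices `x ↦ F (y, x)` on a set of the filter `D` are in a fixed
finite-dimensional space of functions. -/
def DecAt (e : W ≃ₗ[ℝ] Y × Z) (D : Filter Z) (F : W → X) (y₀ : Y) : Prop :=
  ∃ G : Submodule ℂ (Z → X), FiniteDimensional ℂ G ∧ ∃ S ∈ D, ∀ᶠ y in 𝓝 y₀,
    ∃ g ∈ G, ∀ x ∈ S, F (e.symm (y, x)) = g x

variable {e : W ≃ₗ[ℝ] Y × Z} {D : Filter Z} {F F' : W → X} {y₀ : Y}

theorem DecAt.congr (h : DecAt e D F y₀)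
    (hF : ∃ S ∈ D, ∀ᶠ y in 𝓝 y₀, ∀ x ∈ S, F (e.symm (y, x)) = F' (e.symm (y, x))) :
    DecAt e D F' y₀ := by
  obtain ⟨G, hG, S, hS, h1⟩ := h
  obtain ⟨S', hS', h2⟩ := hF
  refine ⟨G, hG, S ∩ S', inter_mem hS hS', ?_⟩
  filter_upwards [h1, h2] with y ⟨g, hg, a⟩ b
  exact ⟨g, hg, fun x hx => (b x hx.2).symm.trans (a x hx.1)⟩

theorem DecAt.zero : DecAt e D (fun _ => (0 : X)) y₀ :=
  ⟨⊥, inferInstance, Set.univ, univ_mem, .of_forall fun _ => ⟨0, Submodule.zero_mem _, fun _ _ => rfl⟩⟩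

theorem DecAt.map (h : DecAt e D F y₀) (A : X →ₗ[ℂ] X') : DecAt e D (fun H => A (F H)) y₀ := by
  obtain ⟨G, hG, S, hS, h1⟩ := h
  refine ⟨G.map (A.compLeft Z), inferInstance, S, hS, h1.mono ?_⟩
  rintro y ⟨g, hg, a⟩
  exact ⟨_, Submodule.mem_map_of_mem hg, fun x hx => by simp [a x hx]⟩

theorem DecAt.add (h : DecAt e D F y₀) (h' : DecAt e D F' y₀) :
    DecAt e D (fun H => F H + F' H) y₀ := by
  obtain ⟨G, hG, S, hS, h1⟩ := h
  obtain ⟨G', hG', S', hS', h2⟩ := h'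
  refine ⟨G ⊔ G', inferInstance, S ∩ S', inter_mem hS hS', ?_⟩
  filter_upwards [h1, h2] with y ⟨g, hg, a⟩ ⟨g', hg', a'⟩
  exact ⟨g + g', Submodule.add_mem_sup hg hg', fun x hx => by simp [a x hx.1, a' x hx.2]⟩

theorem DecAt.sum {σ : Type*} {t : Finset σ} {f : σ → W → X} (h : ∀ i ∈ t, DecAt e D (f i) y₀) :
    DecAt e D (fun H => ∑ i ∈ t, f i H) y₀ := by
  classical
  induction t using Finset.induction_on with
  | empty => simpa using DecAt.zero
  | insert a s ha ih =>
    simp only [Finset.sum_insert ha]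
    exact (h a (by simp)).add (ih fun i hi => h i (by simp [hi]))

/-- A factor that is constant along each slice only rescales the slices. -/
theorem DecAt.smul {c : W → ℂ} (h : DecAt e D F y₀)
    (hc : ∃ S ∈ D, ∀ᶠ y in 𝓝 y₀, ∃ c₀, ∀ x ∈ S, c (e.symm (y, x)) = c₀) :
    DecAt e D (fun H => c H • F H) y₀ := by
  obtain ⟨G, hG, S, hS, h1⟩ := h
  obtain ⟨S', hS', h2⟩ := hc
  refine ⟨G, hG, S ∩ S', inter_mem hS hS', ?_⟩
  filter_upwards [h1, h2] with y ⟨g, hg, a⟩ ⟨c₀, b⟩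
  exact ⟨c₀ • g, G.smul_mem _ hg, fun x hx => by simp [a x hx.1, b x hx.2]⟩

theorem DecAt.sub (h : DecAt e D F y₀) (h' : DecAt e D F' y₀) :
    DecAt e D (fun H => F H - F' H) y₀ := by
  simpa [sub_eq_add_neg] using h.add (h'.map (-LinearMap.id))

/-- Restriction of functions to a set, with value `0` elsewhere. -/
noncomputable def restrictTo (X : Type*) [AddCommGroup X] [Module ℂ X] {Z : Type*} (S : Set Z) :
    (Z → X) →ₗ[ℂ] (Z → X) where
  toFun g := S.indicator g
  map_add' g g' := Set.indicator_add S g g'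
  map_smul' c g := Set.indicator_const_smul S c g

theorem restrictTo_apply_mem {S : Set Z} {x : Z} (hx : x ∈ S) (g : Z → X) :
    restrictTo X S g x = g x := Set.indicator_of_mem hx g

theorem restrictTo_apply_notMem {S : Set Z} {x : Z} (hx : x ∉ S) (g : Z → X) :
    restrictTo X S g x = 0 := Set.indicator_of_notMem hx g

theorem restrictTo_congr {S : Set Z} {g g' : Z → X} (h : ∀ x ∈ S, g x = g' x) :
    restrictTo X S g = restrictTo X S g' := Set.indicator_congr h

/-- Compactness of the segment makes both the space of slices and the neighbourhood of infinity
uniform in `s`. -/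
theorem DecAt.segment {w' : Y} {a b : ℝ} (h : ∀ s ∈ Set.uIcc a b, DecAt e D F (y₀ + s • w')) :
    ∃ G : Submodule ℂ (Z → X), FiniteDimensional ℂ G ∧ ∃ S ∈ D, ∀ᶠ y in 𝓝 y₀,
      ∀ s ∈ Set.uIcc a b, ∃ g ∈ G, ∀ x ∈ S, F (e.symm (y + s • w', x)) = g x := by
  refine (isCompact_uIcc (a := a) (b := b)).induction_on (p := fun t =>
    ∃ G : Submodule ℂ (Z → X), FiniteDimensional ℂ G ∧ ∃ S ∈ D, ∀ᶠ y in 𝓝 y₀,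
      ∀ s ∈ t, ∃ g ∈ G, ∀ x ∈ S, F (e.symm (y + s • w', x)) = g x)
    ⟨⊥, inferInstance, Set.univ, univ_mem, by simp⟩ ?_ ?_ ?_
  · rintro s t hst ⟨G, hG, S, hS, hF⟩
    exact ⟨G, hG, S, hS, hF.mono fun _ h x hx => h x (hst hx)⟩
  · rintro s t ⟨G, hG, S, hS, hF⟩ ⟨G', hG', S', hS', hF'⟩
    refine ⟨G ⊔ G', inferInstance, S ∩ S', inter_mem hS hS', ?_⟩
    filter_upwards [hF, hF'] with y h1 h2 r hr
    rcases hr with hr | hr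
    · obtain ⟨g, hg, k⟩ := h1 r hr
      exact ⟨g, Submodule.mem_sup_left hg, fun x hx => k x hx.1⟩
    · obtain ⟨g, hg, k⟩ := h2 r hr
      exact ⟨g, Submodule.mem_sup_right hg, fun x hx => k x hx.2⟩
  · intro s hs
    obtain ⟨G, hG, S, hS, hF⟩ := h s hs
    have hc : Continuous fun p : Y × ℝ => p.1 + p.2 • w' := by fun_prop
    have := (hc.tendsto (y₀, s)).eventually hF
    rw [nhds_prod_eq] at this
    obtain ⟨p, hp, q, hq, hpq⟩ := eventually_prod_iff.1 this
    refine ⟨{s | q s}, mem_nhdsWithin_of_mem_nhds hq, G, hG, S, hS, hp.mono fun y hy t ht => ?_⟩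
    exact hpq hy ht

/-- Translation and kernel involve only `y`, so a slice of the average is an average of slices.
Expanding slices by finitely many evaluations, whose values are continuous in `s`, exhibits this
average as an element of the same finite-dimensional space. -/
theorem DecAt.smear {w : W} {w' : Y} (hw : e w = (w', 0)) {u : W →L[ℝ] ℝ}
    (hu : ∀ x, u (e.symm (0, x)) = 0) {κ : ℝ × ℝ → ℝ} (hκ : Continuous κ) {a b : ℝ}
    (h : ∀ s ∈ Set.uIcc a b, DecAt e D F (y₀ + s • w'))
    (hF : ∃ S ∈ D, ∀ᶠ y in 𝓝 y₀, ∀ x ∈ S, SegSmooth w a b F (e.symm (y, x))) :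
    DecAt e D (smear w u κ a b F) y₀ := by
  obtain ⟨G, hG, S₁, hS₁, h1⟩ := DecAt.segment h
  obtain ⟨S₂, hS₂, h2⟩ := hF
  let S := S₁ ∩ S₂
  -- Cutting off to `S` turns equality on `S` into equality of functions; evaluation points outside
  -- `S` are harmless because the functions are `0` there.
  obtain ⟨n, c, x, φ, hc, hev⟩ := exists_evaluations (G.map (restrictTo X S))
  have hadd : ∀ (y : Y) (x : Z) (s : ℝ), e.symm (y, x) + s • w = e.symm (y + s • w', x) := by
    intro y x s
    have : w = e.symm (w', 0) := by rw [← hw, e.symm_apply_apply]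
    rw [this, ← map_smul, ← map_add]
    simp
  have hu' : ∀ (y : Y) (x : Z), u (e.symm (y, x)) = u (e.symm (y, 0)) := by
    intro y x
    have : (y, x) = (y, (0 : Z)) + ((0 : Y), x) := by simp
    rw [this, map_add, map_add, hu, add_zero]
  refine ⟨G.map (restrictTo X S), inferInstance, S, inter_mem hS₁ hS₂, ?_⟩
  filter_upwards [h1, h2] with y k1 k2
  let r : Fin n → ℝ → ℂ := fun l s =>
    φ l (restrictTo X S (fun z => F (e.symm (y + s • w', z))) (x l))
  have hr : ∀ l, ContinuousOn (r l) (Set.uIcc a b) := by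
    intro l
    by_cases hx : x l ∈ S
    · refine ((k2 (x l) hx.2).continuousOn (φ l)).congr fun s hs => ?_
      simp only [r, restrictTo_apply_mem hx, hadd]
    · simp only [r, restrictTo_apply_notMem hx, map_zero]
      exact continuousOn_const
  have hrep : ∀ s ∈ Set.uIcc a b, ∀ z ∈ S, F (e.symm (y + s • w', z)) = ∑ l, r l s • c l z := by
    intro s hs z hz
    obtain ⟨g, hg, k3⟩ := k1 s hs
    have k4 : restrictTo X S (fun z => F (e.symm (y + s • w', z))) = restrictTo X S g :=
      restrictTo_congr fun z hz => k3 z hz.1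
    have k5 := congrFun (hev _ (Submodule.mem_map_of_mem hg)) z
    rw [← k4, restrictTo_apply_mem hz] at k5
    simpa using k5
  refine ⟨∑ l, (∫ s in a..b, (κ (u (e.symm (y, 0)), s) : ℂ) * r l s) • c l,
    Submodule.sum_mem _ fun l _ => Submodule.smul_mem _ _ (hc l), fun z hz => weakElt_eq fun ψ => ?_⟩
  have k6 : ∫ s in a..b, (κ (u (e.symm (y, z)), s) : ℂ) * ψ (F (e.symm (y, z) + s • w)) =
      ∫ s in a..b, ∑ l, (κ (u (e.symm (y, 0)), s) : ℂ) * r l s * ψ (c l z) := by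
    refine intervalIntegral.integral_congr fun s hs => ?_
    simp only [hadd, hrep s hs z hz, hu' y z]
    simp [Finset.mul_sum, mul_assoc]
  rw [k6, intervalIntegral.integral_finsetSum fun l _ => ?_]
  · simp
  · exact (ContinuousOn.intervalIntegrable (ContinuousOn.mul (by fun_prop) (hr l))).mul_const _

/-- `D` has a basis of open sets. -/
def HasOpenBasis (D : Filter Z) : Prop := ∀ S ∈ D, ∃ S' ∈ D, IsOpen S' ∧ S' ⊆ S

/-- A smooth decomposable function is locally a finite sum of products of smooth functions. -/
theorem DecAt.exists_rep (hD : HasOpenBasis D) (h : DecAt e D F y₀)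
    (hF : ∃ S ∈ D, ∀ᶠ y in 𝓝 y₀, ∀ x ∈ S, SmoothFn F (e.symm (y, x))) :
    ∃ S ∈ D, ∃ O, IsOpen S ∧ IsOpen O ∧ y₀ ∈ O ∧
      ∃ (n : ℕ) (β : Fin n → Y → ℂ) (c : Fin n → Z → X),
        (∀ l, ∀ y ∈ O, ContDiffAt ℝ ∞ (β l) y) ∧ (∀ l, ∀ x ∈ S, SmoothFn (c l) x) ∧
        ∀ y ∈ O, ∀ x ∈ S, F (e.symm (y, x)) = ∑ l, β l y • c l x := by
  obtain ⟨G, hG, S₁, hS₁, h1⟩ := h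
  obtain ⟨S₂, hS₂, h2⟩ := hF
  obtain ⟨S, hS, hSo, hsub⟩ := hD _ (inter_mem hS₁ hS₂)
  obtain ⟨O, hO, hOo, hy⟩ := eventually_nhds_iff.1 (h1.and h2)
  have hcY : ∀ x : Z, ContDiff ℝ ∞ fun y => e.symm (y, x) := fun x =>
    (LinearMap.toContinuousLinearMap (e.symm : Y × Z →ₗ[ℝ] W)).contDiff.comp (by fun_prop)
  have hcZ : ∀ y : Y, ContDiff ℝ ∞ fun x => e.symm (y, x) := fun y =>
    (LinearMap.toContinuousLinearMap (e.symm : Y × Z →ₗ[ℝ] W)).contDiff.comp (by fun_prop)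
  let sl : Y → Z → X := fun y => restrictTo X S fun x => F (e.symm (y, x))
  -- The span of the actual slices replaces `G`, whose elements need not be smooth: the functions
  -- `c` then inherit smoothness in `x` from `F`.
  let G' : Submodule ℂ (Z → X) := Submodule.span ℂ (sl '' O)
  have hle : G' ≤ G.map (restrictTo X S) := by
    refine Submodule.span_le.2 ?_
    rintro _ ⟨y, hy, rfl⟩
    obtain ⟨g, hg, k⟩ := (hO y hy).1
    exact ⟨g, hg, (restrictTo_congr fun x hx => k x (hsub hx).1).symm⟩
  have : FiniteDimensional ℂ G' := Submodule.finiteDimensional_of_le hle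
  obtain ⟨n, c, x, φ, hc, hev⟩ := exists_evaluations G'
  refine ⟨S, hS, O, hSo, hOo, hy, n, fun l y => φ l (sl y (x l)), c, fun l y hyO => ?_,
    fun l z hz => ?_, fun y hyO z hz => ?_⟩
  · by_cases hx : x l ∈ S
    · have e1 : (fun y => φ l (sl y (x l))) = fun y => φ l (F (e.symm (y, x l))) := by
        ext y; exact congrArg (φ l) (restrictTo_apply_mem hx _)
      change ContDiffAt ℝ ∞ (fun y => φ l (sl y (x l))) y
      rw [e1]
      exact (((hO y hyO).2 _ (hsub hx).2).comp (g := fun y => e.symm (y, x l)) (hcY _).contDiffAt).2 _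
    · have e1 : (fun y => φ l (sl y (x l))) = fun y => 0 := by
        ext y; exact (congrArg (φ l) (restrictTo_apply_notMem hx _)).trans (map_zero _)
      change ContDiffAt ℝ ∞ (fun y => φ l (sl y (x l))) y
      rw [e1]
      exact contDiffAt_const
  · refine Submodule.span_induction (p := fun g _ => SmoothFn g z) ?_ (SmoothFn.zero z)
      (fun _ _ _ _ h1 h2 => h1.add h2) (fun r _ _ h1 => h1.const_smul r) (hc l)
    rintro _ ⟨y, hyO, rfl⟩
    refine SmoothFn.congr (((hO y hyO).2 z (hsub hz).2).comp (g := fun x => e.symm (y, x))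
      (hcZ _).contDiffAt) ?_
    filter_upwards [hSo.mem_nhds hz] with x hx using
      (restrictTo_apply_mem hx fun x => F (e.symm (y, x))).symm
  · have k := congrFun (hev (sl y) (Submodule.subset_span ⟨y, hyO, rfl⟩)) z
    have k' : sl y z = F (e.symm (y, z)) := restrictTo_apply_mem hz _
    rw [k'] at k
    simpa using k

theorem DecAt.of_rep {n : ℕ} {β : Fin n → Y → ℂ} {c : Fin n → Z → X}
    (h : ∃ S ∈ D, ∀ᶠ y in 𝓝 y₀, ∀ x ∈ S, F (e.symm (y, x)) = ∑ l, β l y • c l x) :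
    DecAt e D F y₀ := by
  obtain ⟨S, hS, h⟩ := h
  refine ⟨Submodule.span ℂ (Set.range c), FiniteDimensional.span_of_finite ℂ (Set.finite_range c),
    S, hS, h.mono fun y hy => ⟨∑ l, β l y • c l, ?_, fun x hx => by simp [hy x hx]⟩⟩
  exact Submodule.sum_mem _ fun l _ => Submodule.smul_mem _ _ (Submodule.subset_span ⟨l, rfl⟩)

/-- The Leibniz rule for a smooth product representation: differentiating the factor in `y` keeps
the functions of `x`, and differentiating the factor in `x` adds finitely many new ones. -/
theorem DecAt.weakDeriv (hD : HasOpenBasis D) (h : DecAt e D F y₀)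
    (hF : ∃ S ∈ D, ∀ᶠ y in 𝓝 y₀, ∀ x ∈ S, SmoothFn F (e.symm (y, x))) (v : W) :
    DecAt e D (fun H => weakDeriv F H v) y₀ := by
  obtain ⟨S, hS, O, hSo, hOo, hy, n, β, c, hβ, hc, hrep⟩ := h.exists_rep hD hF
  let L := LinearMap.toContinuousLinearMap (e : W →ₗ[ℝ] Y × Z)
  let L₁ : W →L[ℝ] Y := (ContinuousLinearMap.fst ℝ Y Z).comp L
  let L₂ : W →L[ℝ] Z := (ContinuousLinearMap.snd ℝ Y Z).comp L
  have key : ∀ y ∈ O, ∀ x ∈ S, SplitForms.weakDeriv F (e.symm (y, x)) v =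
      ∑ l, (fderiv ℝ (β l) y (e v).1 • c l x + β l y • SplitForms.weakDeriv (c l) x (e v).2) := by
    intro y hyO x hxS
    have h1 : L₁ (e.symm (y, x)) = y := by simp [L₁, L]
    have h2 : L₂ (e.symm (y, x)) = x := by simp [L₂, L]
    have h3 : F =ᶠ[𝓝 (e.symm (y, x))] fun H => ∑ l, β l (L₁ H) • c l (L₂ H) := by
      filter_upwards [L₁.continuous.continuousAt.preimage_mem_nhds (hOo.mem_nhds (h1.symm ▸ hyO)),
        L₂.continuous.continuousAt.preimage_mem_nhds (hSo.mem_nhds (h2.symm ▸ hxS))] with H a b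
      rw [← hrep _ a _ b]
      congr 1
      exact (e.symm_apply_apply H).symm
    have h4 : ∀ l, SmoothFn (c l) (L₂ (e.symm (y, x))) := fun l => by rw [h2]; exact hc l x hxS
    have h5 : ∀ l, ContDiffAt ℝ ∞ (β l) (L₁ (e.symm (y, x))) := fun l => by
      rw [h1]; exact hβ l y hyO
    have h6 : ∀ l, ContDiffAt ℝ ∞ (fun H => β l (L₁ H)) (e.symm (y, x)) := fun l =>
      (h5 l).comp _ L₁.contDiff.contDiffAt
    have h7 : ∀ l, SmoothFn (fun H => c l (L₂ H)) (e.symm (y, x)) := fun l =>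
      (h4 l).comp L₂.contDiff.contDiffAt
    rw [weakDeriv_congr h3, weakDeriv_sum fun l _ => (h7 l).smul (h6 l)]
    refine Finset.sum_congr rfl fun l _ => ?_
    rw [weakDeriv_smul ((h6 l).differentiableAt (by simp)) (h7 l), weakDeriv_comp (h4 l)]
    have h8 : fderiv ℝ (fun H => β l (L₁ H)) (e.symm (y, x)) v = fderiv ℝ (β l) y (e v).1 := by
      have := (((h5 l).differentiableAt (by simp)).hasFDerivAt.comp (e.symm (y, x))
        L₁.hasFDerivAt).fderiv
      rw [h1] at this
      exact DFunLike.congr_fun this v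
    rw [h8, h1, h2]
    rfl
  have h1 : DecAt e D (fun H => ∑ l, fderiv ℝ (β l) (e H).1 (e v).1 • c l (e H).2) y₀ :=
    DecAt.of_rep (β := fun l y => fderiv ℝ (β l) y (e v).1) (c := c)
      ⟨Set.univ, univ_mem, .of_forall fun y x _ => by simp⟩
  have h2 : DecAt e D (fun H => ∑ l, β l (e H).1 • SplitForms.weakDeriv (c l) (e H).2 (e v).2) y₀ :=
    DecAt.of_rep (β := β) (c := fun l x => SplitForms.weakDeriv (c l) x (e v).2)
      ⟨Set.univ, univ_mem, .of_forall fun y x _ => by simp⟩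
  refine (h1.add h2).congr ⟨S, hS, ?_⟩
  filter_upwards [hOo.mem_nhds hy] with y hyO x hxS
  rw [key y hyO x hxS, Finset.sum_add_distrib]
  simp

variable {E : Type*} [AddCommGroup E] [Module ℂ E] {k : ℕ}

/-- Writes the exterior derivative through directional derivatives followed by constant linear maps,
operations under which decomposability is stable. -/
theorem dForm_eq_sum_extMul {f : W → W [⋀^Fin k]→ₗ[ℝ] E} {H : W} (hf : SmoothFn f H)
    {σ : Type*} [Fintype σ] (b : Basis σ ℝ W) :
    dForm f H = ∑ j, extMul E k (LinearMap.toContinuousLinearMap (b.coord j))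
      (weakDeriv f H (b j)) := by
  ext v
  rw [dForm_apply hf]
  have h1 : ∀ (t : Finset σ) (T : σ → W [⋀^Fin (k + 1)]→ₗ[ℝ] E), (∑ j ∈ t, T j) v = ∑ j ∈ t, T j v :=
    fun t T => map_sum (evalAt E v) T t
  rw [h1]
  simp only [extMul_apply]
  rw [Finset.sum_comm]
  refine Finset.sum_congr rfl fun i _ => ?_
  rw [← Finset.smul_sum]
  congr 1
  have h2 : weakDeriv f H (v i) = ∑ j, (b.coord j (v i) : ℂ) • weakDeriv f H (b j) := by
    let A : W →ₗ[ℝ] W [⋀^Fin k]→ₗ[ℝ] E :=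
      { toFun := weakDeriv f H
        map_add' := weakDeriv_add_right hf
        map_smul' := fun c v => (weakDeriv_smul_right hf c v).trans (by ext; simp) }
    change A (v i) = _
    conv_lhs => rw [← b.sum_repr (v i)]
    rw [map_sum]
    refine Finset.sum_congr rfl fun j _ => ?_
    rw [map_smul]
    ext; simp [A]
  rw [h2]
  exact map_sum (evalAt E (i.removeNth v)) _ _

theorem DecAt.dForm (hD : HasOpenBasis D) {f : W → W [⋀^Fin k]→ₗ[ℝ] E} (h : DecAt e D f y₀)
    (hF : ∃ S ∈ D, ∀ᶠ y in 𝓝 y₀, ∀ x ∈ S, SmoothFn f (e.symm (y, x))) :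
    DecAt e D (dForm f) y₀ := by
  let b := Module.finBasis ℝ W
  have h1 : DecAt e D (fun H => ∑ j, extMul E k (LinearMap.toContinuousLinearMap (b.coord j))
      (SplitForms.weakDeriv f H (b j))) y₀ :=
    DecAt.sum fun j _ => (h.weakDeriv hD hF (b j)).map _
  refine h1.congr ?_
  obtain ⟨S, hS, h2⟩ := hF
  exact ⟨S, hS, h2.mono fun y hy x hx => (dForm_eq_sum_extMul (hy x hx) b).symm⟩

end Decomposable
end SplitForms

namespace SplitForms

/-! ### Geometry of the strata: orthogonal splittings and neighbourhoods of boundary points -/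

section SplitSpace
variable {V : Type u} [NormedAddCommGroup V] [InnerProductSpace ℝ V] [FiniteDimensional ℝ V]
  {ι : Type*} (Δ : Basis ι ℝ V) {K J : Finset ι}

theorem splitSpace_empty (J : Finset ι) :
    splitSpace Δ ∅ J = Submodule.span ℝ (Δ '' (J : Set ι)) := by
  simp [splitSpace]

theorem root_mem_splitSpace {i : ι} (hi : i ∈ J) : Δ i ∈ splitSpace Δ ∅ J := by
  rw [splitSpace_empty]
  exact Submodule.subset_span ⟨i, hi, rfl⟩

theorem splitSpace_empty_le {P : Submodule ℝ V} (h : ∀ i ∈ J, Δ i ∈ P) :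
    splitSpace Δ ∅ J ≤ P := by
  rw [splitSpace_empty, Submodule.span_le]
  rintro _ ⟨i, hi, rfl⟩
  exact h i hi

theorem splitSpace_empty_mono (h : K ⊆ J) : splitSpace Δ ∅ K ≤ splitSpace Δ ∅ J := by
  rw [splitSpace_empty, splitSpace_empty]
  exact Submodule.span_mono (Set.image_mono (by exact_mod_cast h))

theorem splitSpace_le (K J : Finset ι) : splitSpace Δ K J ≤ splitSpace Δ ∅ J := by
  rw [splitSpace_empty]
  exact inf_le_left

theorem splitSpace_eq (K J : Finset ι) :
    splitSpace Δ K J = splitSpace Δ ∅ J ⊓ (splitSpace Δ ∅ K)ᗮ := by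
  rw [splitSpace_empty, splitSpace_empty, splitSpace]

theorem inner_eq_zero_of_mem_splitSpace {y x : V} (hy : y ∈ splitSpace Δ ∅ K)
    (hx : x ∈ splitSpace Δ K J) : ⟪y, x⟫_ℝ = 0 := by
  rw [splitSpace_eq] at hx
  exact (Submodule.mem_orthogonal _ _).1 hx.2 y hy

theorem inner_root_eq_zero {i : ι} (hi : i ∈ K) (x : splitSpace Δ K J) :
    ⟪Δ i, (x : V)⟫_ℝ = 0 :=
  inner_eq_zero_of_mem_splitSpace Δ (root_mem_splitSpace Δ hi) x.2

theorem proj_add_left (y : splitSpace Δ ∅ K) (x : splitSpace Δ K J)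
    (hm : (y + x : V) ∈ splitSpace Δ ∅ J) :
    proj _ (splitSpace Δ ∅ K) (⟨y + x, hm⟩ : splitSpace Δ ∅ J) = y := by
  refine Subtype.ext ?_
  change (splitSpace Δ ∅ K).starProjection (y + x : V) = y
  refine Submodule.eq_starProjection_of_mem_of_inner_eq_zero y.2 (fun w hw => ?_) |>.symm ▸ rfl
  rw [add_sub_cancel_left, real_inner_comm]
  exact inner_eq_zero_of_mem_splitSpace Δ hw x.2

theorem proj_add_right (y : splitSpace Δ ∅ K) (x : splitSpace Δ K J)
    (hm : (y + x : V) ∈ splitSpace Δ ∅ J) :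
    proj _ (splitSpace Δ K J) (⟨y + x, hm⟩ : splitSpace Δ ∅ J) = x := by
  refine Subtype.ext ?_
  change (splitSpace Δ K J).starProjection (y + x : V) = x
  refine Submodule.eq_starProjection_of_mem_of_inner_eq_zero x.2 (fun w hw => ?_) |>.symm ▸ rfl
  rw [add_sub_cancel_right]
  exact inner_eq_zero_of_mem_splitSpace Δ y.2 hw

theorem proj_add_proj (h : K ⊆ J) (H : splitSpace Δ ∅ J) :
    ((proj _ (splitSpace Δ ∅ K) H : V) + (proj _ (splitSpace Δ K J) H : V)) = H := by
  have h1 : (H : V) - (proj _ (splitSpace Δ ∅ K) H : V) ∈ splitSpace Δ K J := by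
    rw [splitSpace_eq]
    exact ⟨Submodule.sub_mem _ H.2 (splitSpace_empty_mono Δ h (proj _ (splitSpace Δ ∅ K) H).2),
      Submodule.sub_starProjection_mem_orthogonal (H : V)⟩
  have h2 := proj_add_right Δ (proj _ (splitSpace Δ ∅ K) H) ⟨_, h1⟩ (by simp)
  have h3 : (⟨(proj _ (splitSpace Δ ∅ K) H : V) + ((H : V) - (proj _ (splitSpace Δ ∅ K) H : V)),
      by simp⟩ : splitSpace Δ ∅ J) = H := Subtype.ext (by simp)
  rw [h3] at h2
  rw [h2]
  simp

/-- The orthogonal decomposition `H = y + x`, as an equivalence `H ↦ (y, x)`. -/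
noncomputable def splitEquiv (h : K ⊆ J) :
    splitSpace Δ ∅ J ≃ₗ[ℝ] splitSpace Δ ∅ K × splitSpace Δ K J where
  toFun H := (proj _ _ H, proj _ _ H)
  map_add' H H' := by simp
  map_smul' c H := by simp
  invFun p := ⟨p.1 + p.2, Submodule.add_mem _ (splitSpace_empty_mono Δ h p.1.2)
    (splitSpace_le Δ K J p.2.2)⟩
  left_inv H := Subtype.ext (proj_add_proj Δ h H)
  right_inv p := Prod.ext (proj_add_left Δ p.1 p.2 _) (proj_add_right Δ p.1 p.2 _)

theorem splitEquiv_symm_coe (h : K ⊆ J) (y : splitSpace Δ ∅ K) (x : splitSpace Δ K J) :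
    (((splitEquiv Δ h).symm (y, x) : splitSpace Δ ∅ J) : V) = y + x := rfl

/-- The transverse space is orthogonal to the roots in `K`, so these roots see only the coordinate
on the stratum. -/
theorem inner_root_symm_of_mem (h : K ⊆ J) {i : ι} (hi : i ∈ K) (y : splitSpace Δ ∅ K)
    (x : splitSpace Δ K J) :
    ⟪Δ i, (((splitEquiv Δ h).symm (y, x) : splitSpace Δ ∅ J) : V)⟫_ℝ = ⟪Δ i, (y : V)⟫_ℝ := by
  rw [splitEquiv_symm_coe, inner_add_right, inner_root_eq_zero Δ hi, add_zero]

theorem inner_root_symm (h : K ⊆ J) (i : ι) (y : splitSpace Δ ∅ K) (x : splitSpace Δ K J) :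
    ⟪Δ i, (((splitEquiv Δ h).symm (y, x) : splitSpace Δ ∅ J) : V)⟫_ℝ =
      ⟪Δ i, (y : V)⟫_ℝ + ⟪Δ i, (x : V)⟫_ℝ := by
  rw [splitEquiv_symm_coe, inner_add_right]

theorem splitEquiv_root (h : K ⊆ J) {i : ι} (hi : i ∈ K) :
    splitEquiv Δ h ⟨Δ i, root_mem_splitSpace Δ (h hi)⟩ = (⟨Δ i, root_mem_splitSpace Δ hi⟩, 0) := by
  rw [← LinearEquiv.eq_symm_apply]
  exact Subtype.ext (by simp [splitEquiv_symm_coe])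

/-- The points of `splitSpace K J` where all roots in `J` outside `K` exceed `B`. -/
def far (K J : Finset ι) (B : ℝ) : Set (splitSpace Δ K J) :=
  {x | ∀ i ∈ J, i ∉ K → B < ⟪Δ i, (x : V)⟫_ℝ}

theorem isOpen_far (B : ℝ) : IsOpen (far Δ K J B) := by
  have : far Δ K J B = ⋂ i ∈ J, {x : splitSpace Δ K J | i ∉ K → B < ⟪Δ i, (x : V)⟫_ℝ} := by
    ext x; simp [far]
  rw [this]
  refine isOpen_biInter_finset fun i _ => ?_
  by_cases hi : i ∈ K
  · simp [hi]
  · simp only [hi, not_false_eq_true, forall_true_left]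
    exact isOpen_lt continuous_const (by fun_prop)

theorem far_anti {B B' : ℝ} (h : B ≤ B') : far Δ K J B' ⊆ far Δ K J B :=
  fun _ hx i hi hK => h.trans_lt (hx i hi hK)

/-- Pairing with the roots is injective on their span because the inner product is definite;
equality of dimensions gives surjectivity. -/
theorem exists_inner_root_eq (J : Finset ι) (c : ι → ℝ) :
    ∃ H : splitSpace Δ ∅ J, ∀ i ∈ J, ⟪Δ i, (H : V)⟫_ℝ = c i := by
  classical
  let A : splitSpace Δ ∅ J →ₗ[ℝ] (J → ℝ) :=
    LinearMap.pi fun i => (innerₛₗ ℝ (Δ i)).comp (splitSpace Δ ∅ J).subtype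
  have hA : ∀ H i, A H i = ⟪Δ i, (H : V)⟫_ℝ := fun _ _ => rfl
  have hinj : Function.Injective A := by
    rw [← LinearMap.ker_eq_bot, LinearMap.ker_eq_bot']
    intro H hH
    have h1 : splitSpace Δ ∅ J ≤ (ℝ ∙ (H : V))ᗮ := by
      refine splitSpace_empty_le Δ fun i hi => ?_
      rw [Submodule.mem_orthogonal_singleton_iff_inner_left]
      exact (hA H ⟨i, hi⟩).symm.trans (by rw [hH]; rfl)
    have h2 := h1 H.2
    rw [Submodule.mem_orthogonal_singleton_iff_inner_left, inner_self_eq_zero] at h2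
    exact Subtype.ext h2
  have hdim : finrank ℝ (splitSpace Δ ∅ J) = finrank ℝ (J → ℝ) := by
    have h1 : LinearIndependent ℝ fun i : J => Δ i :=
      Δ.linearIndependent.comp _ Subtype.val_injective
    have h2 := finrank_span_eq_card h1
    have h3 : Set.range (fun i : J => Δ i) = Δ '' (J : Set ι) := by
      ext x; simp
    rw [h3] at h2
    rw [splitSpace_empty, h2]
    simp
  obtain ⟨H, hH⟩ := (LinearMap.injective_iff_surjective_of_finrank_eq_finrank hdim).1 hinj
    fun i => c i
  exact ⟨H, fun i hi => congrFun hH ⟨i, hi⟩⟩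

theorem exists_inner_root_eq_const (h : K ⊆ J) (B : ℝ) :
    ∃ b : splitSpace Δ K J, ∀ i ∈ J, i ∉ K → ⟪Δ i, (b : V)⟫_ℝ = B := by
  classical
  obtain ⟨H, hH⟩ := exists_inner_root_eq Δ J fun i => if i ∈ K then 0 else B
  have h1 : (H : V) ∈ splitSpace Δ K J := by
    rw [splitSpace_eq]
    refine ⟨H.2, ?_⟩
    have : splitSpace Δ ∅ K ≤ (ℝ ∙ (H : V))ᗮ := by
      refine splitSpace_empty_le Δ fun i hi => ?_
      rw [Submodule.mem_orthogonal_singleton_iff_inner_left, hH i (h hi)]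
      exact if_pos hi
    refine (Submodule.mem_orthogonal _ _).2 fun y hy => ?_
    exact Submodule.mem_orthogonal_singleton_iff_inner_left.1 (this hy)
  exact ⟨⟨H, h1⟩, fun i hi hK => (hH i hi).trans (if_neg hK)⟩

/-- The open subset of the partial compactification where all coordinates exceed `exp T`. -/
def corner (ι : Type*) (T : ℝ) : Set (Corner ι) :=
  {c | ∀ i, ENNReal.ofReal (Real.exp T) < (c i : ℝ≥0∞)}

theorem isOpen_corner [Finite ι] (T : ℝ) : IsOpen (corner ι T) := by
  have : corner ι T = ⋂ i, {c | ENNReal.ofReal (Real.exp T) < (c i : ℝ≥0∞)} := by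
    ext x; simp [corner]
  rw [this]
  exact isOpen_iInter_of_finite fun i => isOpen_lt continuous_const (by fun_prop)

theorem orbitPt_mem_corner {T : ℝ} {H : V} :
    orbitPt Δ K H ∈ corner ι T ↔ ∀ i ∈ K, T < ⟪Δ i, H⟫_ℝ := by
  refine forall_congr' fun i => ?_
  by_cases hi : i ∈ K
  · simp [orbitPt, hi, ENNReal.ofReal_lt_ofReal_iff, Real.exp_pos]
  · simp [orbitPt, hi]

theorem orbitPt_empty_mem_corner (T : ℝ) : orbitPt Δ ∅ 0 ∈ corner ι T :=
  (orbitPt_mem_corner Δ).2 (by simp)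

theorem exists_lt_of_mem_nhds_top {N : Set (Set.Ioi (0 : ℝ≥0∞))} (hN : N ∈ 𝓝 ⟨⊤, by simp⟩) :
    ∃ T : ℝ, ∀ c : Set.Ioi (0 : ℝ≥0∞), ENNReal.ofReal (Real.exp T) < c → c ∈ N := by
  rw [nhds_subtype, mem_comap] at hN
  obtain ⟨t, ht, hs⟩ := hN
  obtain ⟨a, ha, h⟩ := ENNReal.nhds_top_basis.mem_iff.1 ht
  -- The bound `a` itself serves as logarithmic bound, since `a + 1 ≤ exp a`.
  refine ⟨a.toReal, fun c hc => hs (h (Set.mem_Ioi.2 (lt_of_le_of_lt ?_ hc)))⟩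
  rw [← ENNReal.ofReal_toReal ha.ne, ENNReal.toReal_ofReal ENNReal.toReal_nonneg]
  exact ENNReal.ofReal_le_ofReal ((le_add_of_nonneg_right zero_le_one).trans (Real.add_one_le_exp _))

theorem exists_corner_subset [Finite ι] {U : Set (Corner ι)} (hU : IsOpen U)
    (h : orbitPt Δ ∅ 0 ∈ U) : ∃ T, corner ι T ⊆ U := by
  cases nonempty_fintype ι
  obtain ⟨N, hN, hs⟩ := isOpen_pi_iff'.1 hU _ h
  have h1 : ∀ i, ∃ T : ℝ, ∀ c : Set.Ioi (0 : ℝ≥0∞), ENNReal.ofReal (Real.exp T) < c → c ∈ N i :=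
    fun i => exists_lt_of_mem_nhds_top
      ((hN i).1.mem_nhds (by have := (hN i).2; simpa [orbitPt] using this))
  choose T hT using h1
  obtain ⟨M, hM⟩ := (Set.finite_range T).bddAbove
  refine ⟨M, fun c hc => hs fun i _ => hT i _ (lt_of_le_of_lt ?_ (hc i))⟩
  exact ENNReal.ofReal_le_ofReal (Real.exp_le_exp.2 (hM ⟨i, rfl⟩))

/-- On `splitSpace K J` the coordinates in `K` are constantly `1` and those outside `J` constantly
`∞`, as at `o_K`; only the roots in `J` outside `K` impose a condition, and as they are finitely
many one lower bound suffices. -/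
theorem mem_germFilter_iff [Finite ι] (h : K ⊆ J) {S : Set (splitSpace Δ K J)} :
    S ∈ germFilter Δ K J ↔ ∃ B, far Δ K J B ⊆ S := by
  classical
  cases nonempty_fintype ι
  constructor
  · rintro ⟨t, ht, hs⟩
    obtain ⟨U, hUt, hUo, hU⟩ := mem_nhds_iff.1 ht
    obtain ⟨N, hN, hNU⟩ := isOpen_pi_iff'.1 hUo _ hU
    have h1 : ∀ i, ∃ T : ℝ, i ∉ K → ∀ c : Set.Ioi (0 : ℝ≥0∞),
        ENNReal.ofReal (Real.exp T) < c → c ∈ N i := by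
      intro i
      by_cases hi : i ∈ K
      · exact ⟨0, fun h => absurd hi h⟩
      · obtain ⟨T, hT⟩ := exists_lt_of_mem_nhds_top
          ((hN i).1.mem_nhds (by have := (hN i).2; simpa [orbitPt, hi] using this))
        exact ⟨T, fun _ => hT⟩
    choose T hT using h1
    obtain ⟨M, hM⟩ := (Set.finite_range T).bddAbove
    refine ⟨M, fun x hx => hs (hUt (hNU fun i _ => ?_))⟩
    by_cases hi : i ∈ K
    · have h2 : orbitPt Δ J (x : V) i = orbitPt Δ K 0 i := by
        simp [orbitPt, hi, h hi, inner_root_eq_zero Δ hi x]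
      change orbitPt Δ J (x : V) i ∈ N i
      rw [h2]
      exact (hN i).2
    · refine hT i hi _ ?_
      by_cases hJ : i ∈ J
      · simp only [orbitPt, hJ, if_true]
        refine (ENNReal.ofReal_lt_ofReal_iff (Real.exp_pos _)).2 (Real.exp_lt_exp.2 ?_)
        exact lt_of_le_of_lt (hM ⟨i, rfl⟩) (hx i hJ hi)
      · simp [orbitPt, hJ]
  · rintro ⟨B, hB⟩
    refine mem_of_superset (mem_comap.2 ⟨⋂ i ∈ (Finset.univ \ K),
      {c | ENNReal.ofReal (Real.exp B) < (c i : ℝ≥0∞)}, ?_, ?_⟩) hB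
    · refine (isOpen_biInter_finset fun i _ =>
        isOpen_lt continuous_const (by fun_prop)).mem_nhds ?_
      simp only [Finset.mem_sdiff, Finset.mem_univ, true_and, Set.mem_iInter, Set.mem_ofPred_eq]
      intro i hi
      simp [orbitPt, hi]
    · intro x hx i hJ hK
      simp only [Finset.mem_sdiff, Finset.mem_univ, true_and, Set.mem_iInter, Set.mem_ofPred_eq,
        Set.mem_preimage] at hx
      have := hx i hK
      simpa [orbitPt, hJ, ENNReal.ofReal_lt_ofReal_iff, Real.exp_pos] using this

theorem far_mem [Finite ι] (h : K ⊆ J) (B : ℝ) : far Δ K J B ∈ germFilter Δ K J :=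
  (mem_germFilter_iff Δ h).2 ⟨B, subset_rfl⟩

theorem hasOpenBasis_germFilter [Finite ι] (h : K ⊆ J) : HasOpenBasis (germFilter Δ K J) := by
  intro S hS
  obtain ⟨B, hB⟩ := (mem_germFilter_iff Δ h).1 hS
  exact ⟨_, far_mem Δ h B, isOpen_far Δ B, hB⟩

theorem cone_mem [Finite ι] (h : K ⊆ J) (b : splitSpace Δ K J) :
    cone Δ K J b ∈ germFilter Δ K J := by
  obtain ⟨M, hM⟩ := ((J.finite_toSet).image fun i => ⟪Δ i, (b : V)⟫_ℝ).bddAbove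
  exact mem_of_superset (far_mem Δ h M) fun x hx i hi hK =>
    lt_of_le_of_lt (hM ⟨i, hi, rfl⟩) (hx i hi hK)

theorem exists_cone_subset [Finite ι] (h : K ⊆ J) {S : Set (splitSpace Δ K J)}
    (hS : S ∈ germFilter Δ K J) : ∃ b, cone Δ K J b ⊆ S := by
  obtain ⟨B, hB⟩ := (mem_germFilter_iff Δ h).1 hS
  obtain ⟨b, hb⟩ := exists_inner_root_eq_const Δ h B
  exact ⟨b, fun x hx => hB fun i hi hK => (hb i hi hK) ▸ hx i hi hK⟩

/-- The points of `splitSpace ∅ J` where all roots in `J` exceed `T`. -/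
def region (J : Finset ι) (T : ℝ) : Set (splitSpace Δ ∅ J) :=
  {H | ∀ i ∈ J, T < ⟪Δ i, (H : V)⟫_ℝ}

theorem region_eq_far (T : ℝ) : region Δ J T = far Δ ∅ J T := by
  ext; simp [region, far]

theorem isOpen_region (T : ℝ) : IsOpen (region Δ J T) := by
  rw [region_eq_far]; exact isOpen_far Δ T

theorem region_anti {T T' : ℝ} (h : T ≤ T') : region Δ J T' ⊆ region Δ J T :=
  fun _ hx i hi => h.trans_lt (hx i hi)

theorem mem_germFilter_empty_iff [Finite ι] {S : Set (splitSpace Δ ∅ J)} :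
    S ∈ germFilter Δ ∅ J ↔ ∃ T, region Δ J T ⊆ S := by
  simp only [region_eq_far]
  exact mem_germFilter_iff Δ (by simp)

theorem eventually_lt_inner_root [Finite ι] (h : K ⊆ J) {i : ι} (hi : i ∈ J) (hK : i ∉ K)
    (y₀ : splitSpace Δ ∅ K) (B : ℝ) :
    ∀ᶠ p in 𝓝 y₀ ×ˢ germFilter Δ K J,
      B < ⟪Δ i, (((splitEquiv Δ h).symm p : splitSpace Δ ∅ J) : V)⟫_ℝ := by
  have h1 : ∀ᶠ y : splitSpace Δ ∅ K in 𝓝 y₀, ⟪Δ i, (y₀ : V)⟫_ℝ - 1 < ⟪Δ i, (y : V)⟫_ℝ :=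
    (continuous_const.inner continuous_subtype_val).continuousAt.eventually
      (lt_mem_nhds (sub_one_lt _))
  filter_upwards [h1.prod_mk (far_mem Δ h (B - ⟪Δ i, (y₀ : V)⟫_ℝ + 1))] with p hp
  rw [inner_root_symm]
  linarith [hp.1, hp.2 i hi hK]

theorem eventually_mem_region [Finite ι] (h : K ⊆ J) {T : ℝ} {y₀ : splitSpace Δ ∅ K}
    (hy : y₀ ∈ region Δ K T) :
    ∀ᶠ p in 𝓝 y₀ ×ˢ germFilter Δ K J, (splitEquiv Δ h).symm p ∈ region Δ J T := by
  have h1 : ∀ i : J, ∀ᶠ p in 𝓝 y₀ ×ˢ germFilter Δ K J,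
      T < ⟪Δ i, (((splitEquiv Δ h).symm p : splitSpace Δ ∅ J) : V)⟫_ℝ := by
    rintro ⟨i, hi⟩
    by_cases hK : i ∈ K
    · filter_upwards [tendsto_fst.eventually ((isOpen_region Δ T).mem_nhds hy)] with p hp
      rw [inner_root_symm_of_mem Δ h hK]
      exact hp i hK
    · exact eventually_lt_inner_root Δ h hi hK y₀ T
  filter_upwards [eventually_all.2 h1] with p hp i hi using hp ⟨i, hi⟩

/-- Translates between the product filter, convenient for combining conditions, and the order of
quantifiers used in `DecAt`. -/
theorem eventually_prod_iff_exists {Y Z : Type*} [TopologicalSpace Y] {y₀ : Y} {D : Filter Z}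
    {p : Y × Z → Prop} :
    (∀ᶠ q in 𝓝 y₀ ×ˢ D, p q) ↔ ∃ S ∈ D, ∀ᶠ y in 𝓝 y₀, ∀ x ∈ S, p (y, x) := by
  constructor
  · intro h
    obtain ⟨a, ha, b, hb, hab⟩ := eventually_prod_iff.1 h
    exact ⟨{x | b x}, hb, ha.mono fun y hy x hx => hab hy hx⟩
  · rintro ⟨S, hS, h⟩
    filter_upwards [h.prod_mk hS] with q hq using hq.1 _ hq.2

end SplitSpace
end SplitForms

namespace SplitForms

/-! ### The cutoff attached to a stratum -/

section Cutoff
variable {V : Type u} [NormedAddCommGroup V] [InnerProductSpace ℝ V] [FiniteDimensional ℝ V]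
  {ι : Type*} [Fintype ι] (Δ : Basis ι ℝ V) {K L J : Finset ι}

open Classical in
/-- A smooth cutoff that is `1` where all roots outside `K` exceed all roots in `K` by `1`, and
vanishes where some root in `K` exceeds some root outside `K`. -/
noncomputable def cutoff (K : Finset ι) (H : V) : ℝ :=
  ∏ p ∈ K ×ˢ Kᶜ, Real.smoothTransition (⟪Δ p.2, H⟫_ℝ - ⟪Δ p.1, H⟫_ℝ)

theorem contDiff_cutoff (K : Finset ι) : ContDiff ℝ ∞ (cutoff Δ K) :=
  contDiff_prod fun _ _ => Real.smoothTransition.contDiff.comp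
    ((contDiff_const.inner ℝ contDiff_id).sub (contDiff_const.inner ℝ contDiff_id))

theorem smoothTransition_deriv_bounded : ∃ C, ∀ t, |deriv Real.smoothTransition t| ≤ C := by
  have hc : Continuous (deriv Real.smoothTransition) :=
    (Real.smoothTransition.contDiff (n := 1)).continuous_deriv le_rfl
  have hs : HasCompactSupport (deriv Real.smoothTransition) := by
    refine HasCompactSupport.intro (isCompact_Icc (a := 0) (b := 1)) fun t ht => ?_
    rw [Set.mem_Icc, not_and_or, not_le, not_le] at ht
    rcases ht with ht | ht
    · have : Real.smoothTransition =ᶠ[𝓝 t] fun _ => 0 := by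
        filter_upwards [gt_mem_nhds ht] with s hs using Real.smoothTransition.zero_of_nonpos hs.le
      rw [this.deriv_eq, deriv_const]
    · have : Real.smoothTransition =ᶠ[𝓝 t] fun _ => 1 := by
        filter_upwards [lt_mem_nhds ht] with s hs using Real.smoothTransition.one_of_one_le hs.le
      rw [this.deriv_eq, deriv_const]
  obtain ⟨C, hC⟩ := hs.exists_bound_of_continuous hc
  exact ⟨C, hC⟩

/-- Each factor is a bounded function with bounded derivative applied to a linear form; the product
is handled factor by factor with the Leibniz rule. -/
theorem cutoff_bounded (K : Finset ι) :
    ∃ C, ∀ H : V, |cutoff Δ K H| ≤ C ∧ ‖fderiv ℝ (cutoff Δ K) H‖ ≤ C := by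
  classical
  have key : ∀ t : Finset (ι × ι), ∃ C, ∀ H : V,
      |∏ p ∈ t, Real.smoothTransition (⟪Δ p.2, H⟫_ℝ - ⟪Δ p.1, H⟫_ℝ)| ≤ C ∧
      ‖fderiv ℝ (fun H : V => ∏ p ∈ t, Real.smoothTransition (⟪Δ p.2, H⟫_ℝ - ⟪Δ p.1, H⟫_ℝ)) H‖
        ≤ C := by
    intro t
    induction t using Finset.induction_on with
    | empty => exact ⟨1, fun H => by simp⟩
    | insert p t hp ih =>
      obtain ⟨C, hC⟩ := ih
      obtain ⟨B, hB⟩ := smoothTransition_deriv_bounded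
      simp only [Finset.prod_insert hp]
      let l : V →L[ℝ] ℝ := innerSL ℝ (Δ p.2) - innerSL ℝ (Δ p.1)
      have hl : ∀ H : V, l H = ⟪Δ p.2, H⟫_ℝ - ⟪Δ p.1, H⟫_ℝ := fun H => by simp [l]
      simp only [← hl]
      have hd : ∀ H : V, HasFDerivAt (fun H => Real.smoothTransition (l H))
          (deriv Real.smoothTransition (l H) • l) H := fun H =>
        (((Real.smoothTransition.contDiff (n := 1)).differentiable (by simp)
          (l H)).hasDerivAt.comp_hasFDerivAt H l.hasFDerivAt)
      have hd' : ∀ H : V, DifferentiableAt ℝ (fun H : V =>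
          ∏ p ∈ t, Real.smoothTransition (⟪Δ p.2, H⟫_ℝ - ⟪Δ p.1, H⟫_ℝ)) H := fun H =>
        ((contDiff_prod (n := 1) fun p _ => Real.smoothTransition.contDiff.comp
          ((contDiff_const.inner ℝ contDiff_id).sub
            (contDiff_const.inner ℝ contDiff_id))).differentiable (by simp)) H
      have hB0 : 0 ≤ B := (abs_nonneg _).trans (hB 0)
      have hC0 : 0 ≤ C := (abs_nonneg _).trans (hC 0).1
      have hs : ∀ t, |Real.smoothTransition t| ≤ 1 := fun t => by
        rw [abs_of_nonneg (Real.smoothTransition.nonneg t)]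
        exact Real.smoothTransition.le_one t
      refine ⟨C + C * (B * ‖l‖), fun H => ⟨?_, ?_⟩⟩
      · rw [abs_mul]
        have := mul_le_mul (hs (l H)) (hC H).1 (abs_nonneg _) zero_le_one
        have h2 : 0 ≤ C * (B * ‖l‖) := by positivity
        linarith
      · rw [((hd H).fun_mul (hd' H).hasFDerivAt).fderiv]
        refine (norm_add_le _ _).trans (add_le_add ?_ ?_)
        · rw [norm_smul]
          simpa using mul_le_mul (hs (l H)) (hC H).2 (norm_nonneg _) zero_le_one
        · rw [norm_smul, norm_smul]
          exact mul_le_mul (hC H).1 (mul_le_mul_of_nonneg_right (hB _) (norm_nonneg _))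
            (by positivity) hC0
  exact key _

theorem eventually_inner_root_lt (h : L ⊆ J) {i : ι} (hi : i ∈ L) (z : splitSpace Δ ∅ L) :
    ∀ᶠ p in 𝓝 z ×ˢ germFilter Δ L J,
      ⟪Δ i, (((splitEquiv Δ h).symm p : splitSpace Δ ∅ J) : V)⟫_ℝ < ⟪Δ i, (z : V)⟫_ℝ + 1 := by
  have h1 : ∀ᶠ y : splitSpace Δ ∅ L in 𝓝 z, ⟪Δ i, (y : V)⟫_ℝ < ⟪Δ i, (z : V)⟫_ℝ + 1 :=
    (continuous_const.inner continuous_subtype_val).continuousAt.eventually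
      (gt_mem_nhds (lt_add_one _))
  filter_upwards [tendsto_fst.eventually h1] with p hp
  rwa [inner_root_symm_of_mem Δ h hi]

/-- By the cardinalities there are `i` in `K` outside `L` and `j` in `L` outside `K`. Near the
L-stratum the root `i` tends to infinity while `j` stays bounded, so the factor at `(i, j)` is zero.
-/
theorem cutoff_eventually_zero (h : L ⊆ Finset.univ) (hcard : K.card ≤ L.card) (hKL : ¬ K ⊆ L)
    (z : splitSpace Δ ∅ L) :
    ∀ᶠ p in 𝓝 z ×ˢ germFilter Δ L Finset.univ, cutoff Δ K ((splitEquiv Δ h).symm p : V) = 0 := by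
  classical
  obtain ⟨i, hiK, hiL⟩ := Finset.not_subset.1 hKL
  have hLK : ¬ L ⊆ K := fun hs => hKL (Finset.eq_of_subset_of_card_le hs hcard).ge
  obtain ⟨j, hjL, hjK⟩ := Finset.not_subset.1 hLK
  filter_upwards [eventually_inner_root_lt Δ h hjL z,
    eventually_lt_inner_root Δ h (Finset.mem_univ i) hiL z (⟪Δ j, (z : V)⟫_ℝ + 1)] with p h1 h2
  refine Finset.prod_eq_zero (i := (i, j)) (by simp [hiK, hjK]) ?_
  exact Real.smoothTransition.zero_of_nonpos (by simp only; linarith)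

/-- Factors comparing two roots in `L` depend only on the coordinate of the stratum, and factors
with second root outside `L` are `1` because that root tends to infinity. -/
theorem cutoff_eventually_eq (h : L ⊆ Finset.univ) (hKL : K ⊆ L) (z : splitSpace Δ ∅ L) :
    ∃ c : splitSpace Δ ∅ L → ℝ, ∀ᶠ p in 𝓝 z ×ˢ germFilter Δ L Finset.univ,
      cutoff Δ K ((splitEquiv Δ h).symm p : V) = c p.1 := by
  classical
  have h1 : ∀ q : ι × ι, ∀ᶠ p in 𝓝 z ×ˢ germFilter Δ L Finset.univ, q.1 ∈ K →
      Real.smoothTransition (⟪Δ q.2, ((splitEquiv Δ h).symm p : V)⟫_ℝ -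
        ⟪Δ q.1, ((splitEquiv Δ h).symm p : V)⟫_ℝ) =
      if q.2 ∈ L then Real.smoothTransition (⟪Δ q.2, (p.1 : V)⟫_ℝ - ⟪Δ q.1, (p.1 : V)⟫_ℝ)
      else 1 := by
    intro q
    by_cases hq : q.1 ∈ K
    swap
    · exact .of_forall fun _ h => absurd h hq
    by_cases hq2 : q.2 ∈ L
    · refine .of_forall fun p _ => ?_
      rw [if_pos hq2, inner_root_symm_of_mem Δ h hq2, inner_root_symm_of_mem Δ h (hKL hq)]
    · filter_upwards [eventually_inner_root_lt Δ h (hKL hq) z,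
        eventually_lt_inner_root Δ h (Finset.mem_univ q.2) hq2 z (⟪Δ q.1, (z : V)⟫_ℝ + 2)]
        with p h1 h2 _
      rw [if_neg hq2]
      exact Real.smoothTransition.one_of_one_le (by linarith)
  refine ⟨fun y => ∏ q ∈ K ×ˢ Kᶜ, if q.2 ∈ L then
    Real.smoothTransition (⟪Δ q.2, (y : V)⟫_ℝ - ⟪Δ q.1, (y : V)⟫_ℝ) else 1, ?_⟩
  filter_upwards [eventually_all.2 h1] with p hp
  rw [cutoff]
  exact Finset.prod_congr (by congr!) fun q hq => hp q (Finset.mem_product.1 hq).1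

end Cutoff
end SplitForms

namespace SplitForms

/-! ### Homological algebra of homotopies that preserve subcomplexes -/

namespace Subcomplex
variable {M : ℕ → Type*} [∀ k, AddCommGroup (M k)] [∀ k, Module ℂ (M k)]
  {d : ∀ k, M k →ₗ[ℂ] M (k + 1)} {S T R : Subcomplex d}

theorem inclusionIsQuasiIso_iff : S.InclusionIsQuasiIso T ↔
    (∀ k, S.carrier k ≤ T.carrier k) ∧
    (∀ k, ∀ x ∈ S.cocycles k, x ∈ T.coboundaries k → x ∈ S.coboundaries k) ∧
    ∀ k, ∀ x ∈ T.cocycles k, ∃ y ∈ S.cocycles k, x - y ∈ T.coboundaries k := by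
  have key : ∀ h : ∀ k, S.carrier k ≤ T.carrier k, (∀ k, Function.Bijective (cohomologyMap h k)) ↔
      (∀ k, ∀ x ∈ S.cocycles k, x ∈ T.coboundaries k → x ∈ S.coboundaries k) ∧
      ∀ k, ∀ x ∈ T.cocycles k, ∃ y ∈ S.cocycles k, x - y ∈ T.coboundaries k := by
    intro h
    have hinj : ∀ k, Function.Injective (cohomologyMap h k) ↔
        ∀ x ∈ S.cocycles k, x ∈ T.coboundaries k → x ∈ S.coboundaries k := by
      intro k
      rw [injective_iff_map_eq_zero]
      constructor
      · intro hi x hx hxT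
        have := hi (Submodule.Quotient.mk ⟨x, hx⟩)
          ((Submodule.Quotient.mk_eq_zero _).2 (by exact hxT))
        exact (Submodule.Quotient.mk_eq_zero
          ((S.coboundaries k).submoduleOf (S.cocycles k))).1 this
      · intro hi a ha
        obtain ⟨⟨x, hx⟩, rfl⟩ := Submodule.Quotient.mk_surjective _ a
        exact (Submodule.Quotient.mk_eq_zero _).2
          (hi x hx ((Submodule.Quotient.mk_eq_zero
            ((T.coboundaries k).submoduleOf (T.cocycles k))).1 ha))
    have hsurj : ∀ k, Function.Surjective (cohomologyMap h k) ↔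
        ∀ x ∈ T.cocycles k, ∃ y ∈ S.cocycles k, x - y ∈ T.coboundaries k := by
      intro k
      constructor
      · intro hs x hx
        obtain ⟨a, ha⟩ := hs (Submodule.Quotient.mk ⟨x, hx⟩)
        obtain ⟨⟨y, hy⟩, rfl⟩ := Submodule.Quotient.mk_surjective _ a
        exact ⟨y, hy, (Submodule.Quotient.eq ((T.coboundaries k).submoduleOf (T.cocycles k))).1 ha.symm⟩
      · intro hs a
        obtain ⟨⟨x, hx⟩, rfl⟩ := Submodule.Quotient.mk_surjective _ a
        obtain ⟨y, hy, hxy⟩ := hs x hx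
        exact ⟨Submodule.Quotient.mk ⟨y, hy⟩, ((Submodule.Quotient.eq
          ((T.coboundaries k).submoduleOf (T.cocycles k))).2 hxy).symm⟩
    constructor
    · intro hb
      exact ⟨fun k => (hinj k).1 (hb k).1, fun k => (hsurj k).1 (hb k).2⟩
    · rintro ⟨h1, h2⟩ k
      exact ⟨(hinj k).2 (h1 k), (hsurj k).2 (h2 k)⟩
  exact ⟨fun ⟨h, hb⟩ => ⟨h, (key h).1 hb⟩, fun ⟨h, hb⟩ => ⟨h, (key h).2 hb⟩⟩

theorem InclusionIsQuasiIso.trans (h : S.InclusionIsQuasiIso T) (h' : T.InclusionIsQuasiIso R) :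
    S.InclusionIsQuasiIso R := by
  rw [inclusionIsQuasiIso_iff] at *
  obtain ⟨a, b, c⟩ := h
  obtain ⟨a', b', c'⟩ := h'
  refine ⟨fun k => (a k).trans (a' k), fun k x hx hR => b k x hx (b' k x (cocycles_mono a k hx) hR),
    fun k x hx => ?_⟩
  obtain ⟨y, hy, hxy⟩ := c' k x hx
  obtain ⟨z, hz, hyz⟩ := c k y hy
  exact ⟨z, hz, by simpa using Submodule.add_mem _ hxy (coboundaries_mono a' k hyz)⟩

/-- `d ∘ H`. -/
def dAfter (d : ∀ k, M k →ₗ[ℂ] M (k + 1)) (H : ∀ k, M (k + 1) → M k) : ∀ k, M k → M k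
  | 0 => fun _ => 0
  | k + 1 => fun x => d k (H k x)

/-- The map `1 - d H - H d`. -/
def chainMap (d : ∀ k, M k →ₗ[ℂ] M (k + 1)) (H : ∀ k, M (k + 1) → M k) (k : ℕ) (x : M k) : M k :=
  x - dAfter d H k x - H k (d k x)

variable {H H' : ∀ k, M (k + 1) → M k}

theorem dAfter_mem (hT : ∀ k, ∀ x ∈ T.carrier (k + 1), H k x ∈ T.carrier k) (k : ℕ) :
    ∀ x ∈ T.carrier k, dAfter d H k x ∈ T.carrier k := by
  cases k with
  | zero => exact fun x _ => Submodule.zero_mem _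
  | succ k => exact fun x hx => T.d_mem _ _ (hT k x hx)

theorem chainMap_mem (hT : ∀ k, ∀ x ∈ T.carrier (k + 1), H k x ∈ T.carrier k) {k : ℕ} {x : M k}
    (hx : x ∈ T.carrier k) : chainMap d H k x ∈ T.carrier k :=
  Submodule.sub_mem _ (Submodule.sub_mem _ hx (dAfter_mem hT k x hx)) (hT k _ (T.d_mem k x hx))

theorem d_dAfter (hdd : ∀ k x, d (k + 1) (d k x) = 0) (k : ℕ) (x : M k) :
    d k (dAfter d H k x) = 0 := by
  cases k with
  | zero => exact map_zero _
  | succ k => exact hdd _ _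

theorem chainMap_d (hdd : ∀ k x, d (k + 1) (d k x) = 0) (h0 : ∀ k, H k 0 = 0) (k : ℕ) (x : M k) :
    chainMap d H (k + 1) (d k x) = d k (chainMap d H k x) := by
  have h1 : chainMap d H (k + 1) (d k x) =
    d k x - d k (H k (d k x)) - H (k + 1) (d (k + 1) (d k x)) := rfl
  rw [h1, hdd, h0, chainMap, map_sub, map_sub, d_dAfter hdd, sub_zero, sub_zero]

/-- The homotopy belonging to the composite of two chain maps. -/
def compHomotopy (d : ∀ k, M k →ₗ[ℂ] M (k + 1)) (H H' : ∀ k, M (k + 1) → M k) (k : ℕ)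
    (x : M (k + 1)) : M k := H k x + H' k (chainMap d H (k + 1) x)

/-- Uses that `1 - dH - Hd` commutes with `d`. Linearity of the homotopies plays no role, only that
`H` sends `0` to `0`. -/
theorem chainMap_compHomotopy (hdd : ∀ k x, d (k + 1) (d k x) = 0) (h0 : ∀ k, H k 0 = 0)
    (k : ℕ) (x : M k) :
    chainMap d (compHomotopy d H H') k x = chainMap d H' k (chainMap d H k x) := by
  have h1 := chainMap_d hdd h0 k x
  have h2 : dAfter d (compHomotopy d H H') k x =
      dAfter d H k x + dAfter d H' k (chainMap d H k x) := by
    cases k with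
    | zero => exact (add_zero _).symm
    | succ k => exact map_add _ _ _
  rw [chainMap, h2, compHomotopy, h1]
  conv_rhs => rw [chainMap]
  conv_rhs => enter [1, 1]; rw [chainMap]
  abel

/-- A cocycle of `T` is moved into `S` by the chain map and changes by the coboundary of its
homotopy. On cocycles only the value `H 0 = 0` is used, so `H` need not be additive. -/
theorem inclusionIsQuasiIso_of_homotopy (hdd : ∀ k x, d (k + 1) (d k x) = 0)
    (h0 : ∀ k, H k 0 = 0) (hST : ∀ k, S.carrier k ≤ T.carrier k)
    (hS : ∀ k, ∀ x ∈ S.carrier (k + 1), H k x ∈ S.carrier k)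
    (hT : ∀ k, ∀ x ∈ T.carrier (k + 1), H k x ∈ T.carrier k)
    (hP : ∀ k, ∀ x ∈ T.carrier k, chainMap d H k x ∈ S.carrier k) : S.InclusionIsQuasiIso T := by
  refine inclusionIsQuasiIso_iff.2 ⟨hST, fun k x hx hxT => ?_, fun k x hx => ?_⟩
  · cases k with
    | zero => exact hxT
    | succ k =>
      obtain ⟨y, hy, rfl⟩ := hxT
      -- This primitive equals `y - dH y`, so it has the same differential as `y`; its first summand
      -- lies in `S` as an image of the chain map, its second because the coboundary `d y` is
      -- assumed to lie in `S`.
      refine ⟨chainMap d H k y + H k (d k y), Submodule.add_mem _ (hP k y hy) (hS k _ hx.1), ?_⟩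
      simp [chainMap, d_dAfter hdd]
  · have hx0 : d k x = 0 := hx.2
    have h1 : chainMap d H k x = x - dAfter d H k x := by rw [chainMap, hx0, h0, sub_zero]
    refine ⟨chainMap d H k x, ⟨hP k x hx.1, ?_⟩, ?_⟩
    · change d k (chainMap d H k x) = 0
      rw [h1, map_sub, hx0, d_dAfter hdd, sub_zero]
    · rw [h1, sub_sub_cancel]
      cases k with
      | zero => exact Submodule.zero_mem _
      | succ k => exact ⟨H k x, hT k x hx.1, rfl⟩

end Subcomplex
end SplitForms

namespace SplitForms

/-! ### The homotopies preserve decomposability near strata of at least the same cardinality -/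

section Preservation
variable {V : Type u} [NormedAddCommGroup V] [InnerProductSpace ℝ V] [FiniteDimensional ℝ V]
  {ι : Type*} [Fintype ι] (Δ : Basis ι ℝ V) {K L : Finset ι}
  {X : Type*} [AddCommGroup X] [Module ℂ X] {E : Type*} [AddCommGroup E] [Module ℂ E] {k : ℕ}

/-- The root `Δ i` as a point of the full split space. -/
noncomputable def rootVec (i : ι) : splitSpace Δ ∅ Finset.univ :=
  ⟨Δ i, root_mem_splitSpace Δ (Finset.mem_univ i)⟩

/-- The coordinate at `Δ i` of the projection to `splitSpace ∅ K`. -/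
noncomputable def rootCoord (K : Finset ι) (i : ι) : splitSpace Δ ∅ Finset.univ →L[ℝ] ℝ :=
  LinearMap.toContinuousLinearMap
    ((Δ.coord i).comp ((splitSpace Δ ∅ K).subtype.comp (proj _ (splitSpace Δ ∅ K))))

theorem rootCoord_apply (i : ι) (H : splitSpace Δ ∅ Finset.univ) :
    rootCoord Δ K i H = Δ.coord i (splitEquiv Δ (Finset.subset_univ K) H).1 := rfl

theorem rootCoord_symm (i : ι) (p : splitSpace Δ ∅ K × splitSpace Δ K Finset.univ) :
    rootCoord Δ K i ((splitEquiv Δ (Finset.subset_univ K)).symm p) = Δ.coord i p.1 := by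
  rw [rootCoord_apply, LinearEquiv.apply_symm_apply]

/-- For `K ⊆ L` the transverse space of `L` is contained in that of `K`, hence orthogonal to the
space on which the coordinate is taken. So the kernel, too, depends only on the coordinate along the
L-stratum. -/
theorem rootCoord_symm_zero (h : K ⊆ L) (i : ι) (x : splitSpace Δ L Finset.univ) :
    rootCoord Δ K i ((splitEquiv Δ (Finset.subset_univ L)).symm (0, x)) = 0 := by
  have h1 : ((splitEquiv Δ (Finset.subset_univ L)).symm (0, x) : V) ∈ splitSpace Δ K Finset.univ := by
    rw [splitEquiv_symm_coe, ZeroMemClass.coe_zero, zero_add]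
    have h2 := (splitSpace_eq Δ L Finset.univ).le x.2
    exact (splitSpace_eq Δ K Finset.univ).ge
      ⟨h2.1, Submodule.orthogonal_le (splitSpace_empty_mono Δ h) h2.2⟩
  have h2 : (splitEquiv Δ (Finset.subset_univ L)).symm (0, x) =
      (splitEquiv Δ (Finset.subset_univ K)).symm (0, ⟨_, h1⟩) :=
    Subtype.ext (by simp [splitEquiv_symm_coe])
  rw [h2, rootCoord_symm]
  simp

/-- A bound for the change of the roots under moves by at most `4` in each root direction. -/
noncomputable def rootShift : ℝ := ∑ i, ∑ j, 4 * |⟪Δ i, Δ j⟫_ℝ|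

theorem sum_le_rootShift (i : ι) : ∑ j, 4 * |⟪Δ i, Δ j⟫_ℝ| ≤ rootShift Δ :=
  Finset.single_le_sum (f := fun i => ∑ j, 4 * |⟪Δ i, Δ j⟫_ℝ|) (fun i _ => by positivity)
    (Finset.mem_univ i)

theorem le_rootShift (i j : ι) : 4 * |⟪Δ i, Δ j⟫_ℝ| ≤ rootShift Δ :=
  (Finset.single_le_sum (f := fun j => 4 * |⟪Δ i, Δ j⟫_ℝ|) (fun i _ => by positivity)
    (Finset.mem_univ j)).trans (sum_le_rootShift Δ i)

theorem abs_smul_root_le {s : ℝ} (hs : |s| ≤ 4) (i j : ι) :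
    |⟪Δ i, s • Δ j⟫_ℝ| ≤ rootShift Δ := by
  rw [real_inner_smul_right, abs_mul]
  exact (mul_le_mul_of_nonneg_right hs (abs_nonneg _)).trans (le_rootShift Δ i j)

theorem abs_le_four_of_mem {s : ℝ} (hs : s ∈ Set.uIcc (-3 : ℝ) 3) : |s| ≤ 4 := by
  rw [Set.uIcc_of_le (by norm_num)] at hs
  exact abs_le.2 ⟨by linarith [hs.1], by linarith [hs.2]⟩

theorem add_smul_mem_region {J : Finset ι} {T : ℝ} {H w : splitSpace Δ ∅ J} {j : ι}
    (hw : (w : V) = Δ j) (hH : H ∈ region Δ J (T + rootShift Δ)) {s : ℝ} (hs : |s| ≤ 4) :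
    H + s • w ∈ region Δ J T := by
  intro i hi
  have h1 := hH i hi
  have h2 := abs_le.1 (abs_smul_root_le Δ hs i j)
  have h3 : ((H + s • w : splitSpace Δ ∅ J) : V) = H + s • Δ j := by simp [hw]
  rw [h3, inner_add_right]
  linarith [h2.1]

theorem segSmooth_of_region {T : ℝ} {F : splitSpace Δ ∅ Finset.univ → X}
    (hF : ∀ H ∈ region Δ Finset.univ T, SmoothFn F H) (j : ι) {H : splitSpace Δ ∅ Finset.univ}
    (hH : H ∈ region Δ Finset.univ (T + rootShift Δ)) : SegSmooth (rootVec Δ j) (-3) 3 F H := by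
  filter_upwards [(isOpen_region Δ _).mem_nhds hH] with H' hH' s hs
  exact hF _ (add_smul_mem_region Δ rfl hH' (abs_le_four_of_mem hs))

/-- Decomposability near all finite points of the `L`-stratum close to the corner. -/
def DecNear (L : Finset ι) (F : splitSpace Δ ∅ Finset.univ → X) : Prop :=
  ∃ T, ∀ z ∈ region Δ L T,
    DecAt (splitEquiv Δ (Finset.subset_univ L)) (germFilter Δ L Finset.univ) F z

/-- Smoothness close to the corner. -/
def SmoothNear (F : splitSpace Δ ∅ Finset.univ → X) : Prop :=
  ∃ T, ∀ H ∈ region Δ Finset.univ T, SmoothFn F H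

variable {Δ} {F F' : splitSpace Δ ∅ Finset.univ → X}

theorem eventually_region_iff {J : Finset ι} {p : splitSpace Δ ∅ J → Prop} :
    (∀ᶠ H in germFilter Δ ∅ J, p H) ↔ ∃ T, ∀ H ∈ region Δ J T, p H :=
  mem_germFilter_empty_iff Δ

theorem smoothNear_iff : SmoothNear Δ F ↔ ∀ᶠ H in germFilter Δ ∅ Finset.univ, SmoothFn F H :=
  eventually_region_iff.symm

theorem exists_of_region {z : splitSpace Δ ∅ L} {T : ℝ} (hz : z ∈ region Δ L T)
    {P : splitSpace Δ ∅ Finset.univ → Prop} (h : ∀ H ∈ region Δ Finset.univ T, P H) :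
    ∃ S ∈ germFilter Δ L Finset.univ, ∀ᶠ y in 𝓝 z, ∀ x ∈ S,
      P ((splitEquiv Δ (Finset.subset_univ L)).symm (y, x)) :=
  eventually_prod_iff_exists (p := fun p => P ((splitEquiv Δ (Finset.subset_univ L)).symm p)).1
    ((eventually_mem_region Δ (Finset.subset_univ L) hz).mono fun _ hp => h _ hp)

theorem DecNear.congr (h : DecNear Δ L F) (hF : F =ᶠ[germFilter Δ ∅ Finset.univ] F') :
    DecNear Δ L F' := by
  obtain ⟨T, h⟩ := h
  obtain ⟨T', h'⟩ := eventually_region_iff.1 hF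
  refine ⟨max T T', fun z hz => (h z (region_anti Δ (le_max_left _ _) hz)).congr ?_⟩
  exact exists_of_region (P := fun H => F H = F' H) (region_anti Δ (le_max_right _ _) hz) h'

theorem DecNear.add (h : DecNear Δ L F) (h' : DecNear Δ L F') :
    DecNear Δ L (fun H => F H + F' H) := by
  obtain ⟨T, h⟩ := h
  obtain ⟨T', h'⟩ := h'
  exact ⟨max T T', fun z hz => (h z (region_anti Δ (le_max_left _ _) hz)).add
    (h' z (region_anti Δ (le_max_right _ _) hz))⟩

theorem DecNear.map {X' : Type*} [AddCommGroup X'] [Module ℂ X'] (h : DecNear Δ L F)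
    (A : X →ₗ[ℂ] X') : DecNear Δ L (fun H => A (F H)) := by
  obtain ⟨T, h⟩ := h
  exact ⟨T, fun z hz => (h z hz).map A⟩

theorem DecNear.zero : DecNear Δ L (fun _ => (0 : X)) := ⟨0, fun _ _ => DecAt.zero⟩

theorem DecNear.dForm {f : splitSpace Δ ∅ Finset.univ →
      splitSpace Δ ∅ Finset.univ [⋀^Fin k]→ₗ[ℝ] E}
    (h : DecNear Δ L f) (hf : SmoothNear Δ f) : DecNear Δ L (dForm f) := by
  obtain ⟨T, h⟩ := h
  obtain ⟨T', h'⟩ := hf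
  refine ⟨max T T', fun z hz => (h z (region_anti Δ (le_max_left _ _) hz)).dForm
    (hasOpenBasis_germFilter Δ (Finset.subset_univ L)) ?_⟩
  exact exists_of_region (P := SmoothFn f) (region_anti Δ (le_max_right _ _) hz) h'

variable (Δ) in
/-- The homotopy operator of the stratum `K` in the direction of the root `i`. -/
noncomputable def stepOp (K : Finset ι) (i : ι) (f : splitSpace Δ ∅ Finset.univ →
    splitSpace Δ ∅ Finset.univ [⋀^Fin (k + 1)]→ₗ[ℝ] E) :
    splitSpace Δ ∅ Finset.univ → splitSpace Δ ∅ Finset.univ [⋀^Fin k]→ₗ[ℝ] E :=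
  homotopyOp stair (rootVec Δ i) (rootCoord Δ K i) (fun H => cutoff Δ K H) f

variable (Δ) in
theorem contDiff_cutoff_coe (K : Finset ι) :
    ContDiff ℝ ∞ fun H : splitSpace Δ ∅ Finset.univ => cutoff Δ K (H : V) :=
  (contDiff_cutoff Δ K).comp (splitSpace Δ ∅ Finset.univ).subtypeL.contDiff

theorem SmoothNear.stepOp {f : splitSpace Δ ∅ Finset.univ →
      splitSpace Δ ∅ Finset.univ [⋀^Fin (k + 1)]→ₗ[ℝ] E} (hf : SmoothNear Δ f)
    (K : Finset ι) (i : ι) : SmoothNear Δ (stepOp Δ K i f) := by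
  obtain ⟨T, h⟩ := hf
  exact ⟨T + rootShift Δ, fun H hH =>
    smoothFn_homotopyOp (segSmooth_of_region Δ h i hH) (contDiff_cutoff_coe Δ K)⟩

/-- If `K ⊆ L`, the direction, the kernel and the cutoff all live on the L-stratum, so slices are
averaged and rescaled. If not, the condition on cardinalities makes the cutoff vanish near that
stratum. -/
theorem DecNear.stepOp {f : splitSpace Δ ∅ Finset.univ →
      splitSpace Δ ∅ Finset.univ [⋀^Fin (k + 1)]→ₗ[ℝ] E} (h : DecNear Δ L f)
    (hf : SmoothNear Δ f) {i : ι} (hi : i ∈ K) (hcard : K.card ≤ L.card) :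
    DecNear Δ L (stepOp Δ K i f) := by
  obtain ⟨T₁, h⟩ := h
  obtain ⟨T₂, h'⟩ := hf
  let T := max T₁ T₂
  refine ⟨T + rootShift Δ, fun z hz => ?_⟩
  by_cases hKL : K ⊆ L
  · have hw := splitEquiv_root Δ (Finset.subset_univ L) (hKL hi)
    have hu := rootCoord_symm_zero Δ hKL i
    have hseg : ∃ S ∈ germFilter Δ L Finset.univ, ∀ᶠ y in 𝓝 z, ∀ x ∈ S,
        SegSmooth (rootVec Δ i) (-3) 3 (fun H => contract E k (rootVec Δ i) (f H))
          ((splitEquiv Δ (Finset.subset_univ L)).symm (y, x)) := by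
      refine exists_of_region (P := SegSmooth (rootVec Δ i) (-3) 3
        fun H => contract E k (rootVec Δ i) (f H)) hz fun H hp => ?_
      exact (segSmooth_of_region Δ h' i
        (region_anti Δ (add_le_add_left (le_max_right T₁ T₂) _) hp)).map _
    have hdec : ∀ s ∈ Set.uIcc (-3 : ℝ) 3, DecAt (splitEquiv Δ (Finset.subset_univ L))
        (germFilter Δ L Finset.univ) (fun H => contract E k (rootVec Δ i) (f H))
        (z + s • ⟨Δ i, root_mem_splitSpace Δ (hKL hi)⟩) := fun s hs =>
      (h _ (region_anti Δ (le_max_left T₁ T₂)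
        (add_smul_mem_region Δ rfl hz (abs_le_four_of_mem hs)))).map _
    have hsub : Set.uIcc (-3 : ℝ) 0 ⊆ Set.uIcc (-3 : ℝ) 3 := by
      rw [Set.uIcc_of_le (by norm_num), Set.uIcc_of_le (by norm_num)]
      exact Set.Icc_subset_Icc le_rfl (by norm_num)
    obtain ⟨c, hc⟩ := cutoff_eventually_eq Δ (Finset.subset_univ L) hKL z
    refine DecAt.smul ((DecAt.smear hw hu continuous_const (fun s hs => hdec s (hsub hs)) ?_).sub
      (DecAt.smear hw hu stair.contDiff.continuous hdec hseg)) (eventually_prod_iff_exists.1 hc |>.imp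
        fun S hS => ⟨hS.1, hS.2.mono fun y hy => ⟨(c y : ℂ), fun x hx => by simp only [hy x hx]⟩⟩)
    obtain ⟨S, hS, h1⟩ := hseg
    exact ⟨S, hS, h1.mono fun y hy x hx => (hy x hx).left⟩
  · refine DecAt.zero.congr ?_
    obtain ⟨S, hS, h1⟩ := eventually_prod_iff_exists.1
      (cutoff_eventually_zero Δ (Finset.subset_univ L) hcard hKL z)
    refine ⟨S, hS, h1.mono fun y hy x hx => ?_⟩
    rw [SplitForms.stepOp, homotopyOp, hy x hx]
    simp

end Preservation
end SplitForms

namespace SplitForms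

/-! ### Kernels of finite rank turn smearing into fixed line integrals -/

section Smear
variable {W : Type*} [NormedAddCommGroup W] [NormedSpace ℝ W] [FiniteDimensional ℝ W]
  {X : Type*} [AddCommGroup X] [Module ℂ X] {E : Type*} [AddCommGroup E] [Module ℂ E] {k : ℕ}
  {w : W} {u : W →L[ℝ] ℝ} {F : W → X} {H : W}

/-- Integration over a fixed interval of the coordinate `u` along the line `H + ℝ • w`. -/
noncomputable def lineIntegral (w : W) (u : W →L[ℝ] ℝ) (g : ℝ → ℝ) (a b : ℝ) (F : W → X) (H : W) :
    X :=
  smear w u (fun p => g p.2) a b F (H - u H • w)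

/-- `H - u H • w` is the projection along `w` to the hyperplane `u = 0`, unchanged by moving along
`w`. -/
theorem lineIntegral_add_smul_self (hu : u w = 1) (g : ℝ → ℝ) (a b s : ℝ) :
    lineIntegral w u g a b F (H + s • w) = lineIntegral w u g a b F H := by
  have : H + s • w - u (H + s • w) • w = H - u H • w := by
    rw [map_add, map_smul, hu, smul_eq_mul, mul_one, add_smul]
    abel
  rw [lineIntegral, this, lineIntegral]

theorem lineIntegral_add {v : W} (hv : u v = 0) (g : ℝ → ℝ) (a b : ℝ)
    (hF : ∀ H, F (H + v) = F H) :
    lineIntegral w u g a b F (H + v) = lineIntegral w u g a b F H := by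
  have h1 : ∀ s : ℝ, H + v - u (H + v) • w + s • w = H - u H • w + s • w + v := by
    intro s
    rw [map_add, hv, add_zero]
    abel
  simp only [lineIntegral, smear, h1, hF]

/-- The substitution `r = u H + s` makes the integrand depend on the projected point only. As `g` is
supported in `[a, b]`, the moving window of length `6` can be replaced by that fixed interval. -/
theorem smear_eq_lineIntegral {g : ℝ → ℝ} (hg : Continuous g) {a b : ℝ}
    (hab : a ≤ b) (h0 : ∀ r, r ∉ Set.Icc a b → g r = 0) (h1 : u H - 3 ≤ a) (h2 : b ≤ u H + 3)
    (h : SegSmooth w a b F (H - u H • w)) :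
    smear w u (fun p => g (p.1 + p.2)) (-3) 3 F H = lineIntegral w u g a b F H := by
  refine weakElt_eq fun φ => ?_
  rw [lineIntegral, smear_spec h (by fun_prop)]
  have e1 : ∀ s : ℝ, (g (u H + s) : ℂ) * φ (F (H + s • w)) =
      (fun r : ℝ => (g r : ℂ) * φ (F (H - u H • w + r • w))) (u H + s) := by
    intro s
    have e2 : H - u H • w + (u H + s) • w = H + s • w := by rw [add_smul]; abel
    simp only [e2]
  simp only [e1]
  rw [intervalIntegral.integral_comp_add_left
    (fun r : ℝ => (g r : ℂ) * φ (F (H - u H • w + r • w)))]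
  rw [intervalIntegral.integral_of_le hab,
    intervalIntegral.integral_of_le (show u H + -3 ≤ u H + 3 by linarith),
    ← integral_Icc_eq_integral_Ioc, ← integral_Icc_eq_integral_Ioc]
  refine (setIntegral_eq_of_subset_of_forall_sdiff_eq_zero measurableSet_Icc
    (Set.Icc_subset_Icc (by linarith) (by linarith)) fun r hr => ?_).symm
  rw [h0 r hr.2]
  simp

/-- Separates the coordinate `u`: it survives only in the scalar coefficients, the line integrals
being independent of it when `u w = 1`. -/
theorem smear_separable {f : Fin 3 → ℝ → ℝ} {g : Fin 3 → ℝ → ℝ} (hg : ∀ e, ContDiff ℝ ∞ (g e))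
    {a b : ℝ} (hab : a ≤ b) (h0 : ∀ e r, r ∉ Set.Icc a b → g e r = 0) (h1 : u H - 3 ≤ a)
    (h2 : b ≤ u H + 3) {κ : ℝ × ℝ → ℝ} (hκ : ∀ s, κ (u H, s) = ∑ e, f e (u H) * g e (u H + s))
    (h : SegSmooth w a b F (H - u H • w)) (h' : SegSmooth w (-3) 3 F H) :
    smear w u κ (-3) 3 F H = ∑ e, (f e (u H) : ℂ) • lineIntegral w u (g e) a b F H := by
  refine weakElt_eq fun φ => ?_
  simp only [hκ, map_sum, map_smul, smul_eq_mul]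
  have e1 : ∀ e, φ (lineIntegral w u (g e) a b F H) =
      ∫ s in (-3 : ℝ)..3, (g e (u H + s) : ℂ) * φ (F (H + s • w)) := by
    intro e
    rw [← smear_eq_lineIntegral (hg e).continuous hab (h0 e) h1 h2 h]
    exact smear_spec h' (by have := (hg e).continuous; fun_prop) φ
  simp only [e1]
  simp only [← intervalIntegral.integral_const_mul]
  rw [← intervalIntegral.integral_finsetSum fun e _ => ?_]
  · refine intervalIntegral.integral_congr fun s _ => ?_
    push_cast
    simp only [Finset.sum_mul, mul_assoc]
  · refine IntervalIntegrable.const_mul ?_ _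
    have := (hg e).continuous
    exact h'.intervalIntegrable (κ := fun p => g e (p.1 + p.2)) (by fun_prop) φ

theorem smear_sum_separable {σ : Type*} [Fintype σ] {c : σ → ℂ} {Φ : σ → W → X}
    {f : Fin 3 → ℝ → ℝ} {g : Fin 3 → ℝ → ℝ} {κ : ℝ × ℝ → ℝ} (hκc : Continuous κ)
    (hg : ∀ e, ContDiff ℝ ∞ (g e))
    {a b : ℝ} (hab : a ≤ b) (h0 : ∀ e r, r ∉ Set.Icc a b → g e r = 0) (h1 : u H - 3 ≤ a)
    (h2 : b ≤ u H + 3) (hκ : ∀ s, κ (u H, s) = ∑ e, f e (u H) * g e (u H + s))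
    (h : ∀ l, SegSmooth w a b (Φ l) (H - u H • w)) (h' : ∀ l, SegSmooth w (-3) 3 (Φ l) H) :
    smear w u κ (-3) 3 (fun H => ∑ l, c l • Φ l H) H =
      ∑ p : σ × Fin 3, (c p.1 * f p.2 (u H)) • lineIntegral w u (g p.2) a b (Φ p.1) H := by
  have h3 : ∀ l ∈ Finset.univ, SegSmooth w (-3) 3 (fun H => c l • Φ l H) H :=
    fun l _ => Filter.Eventually.mono (h' l) fun _ hy s hs => (hy s hs).const_smul (c l)
  refine (smear_sum (f := fun l H => c l • Φ l H) h3 hκc).trans ?_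
  rw [Fintype.sum_prod_type]
  refine Finset.sum_congr rfl fun l _ => ?_
  rw [smear_const_smul (h' l) hκc, smear_separable hg hab h0 h1 h2 hκ (h l) (h' l), Finset.smul_sum]
  exact Finset.sum_congr rfl fun e _ => smul_smul _ _ _

theorem smoothFn_lineIntegral {g : ℝ → ℝ} (hg : ContDiff ℝ ∞ g) {a b : ℝ}
    (h : SegSmooth w a b F (H - u H • w)) : SmoothFn (lineIntegral w u g a b F) H := by
  have h1 : ContDiff ℝ ∞ fun H : W => H - u H • w := by fun_prop
  exact (smoothFn_smear h (κ := fun p => g p.2) (by fun_prop)).comp (g := fun H => H - u H • w)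
    h1.contDiffAt

theorem extContract_zero (η : W [⋀^Fin k]→ₗ[ℝ] E) : extContract E w k 0 η = 0 := by
  cases k with
  | zero => rfl
  | succ k =>
    ext v
    change extMul E k 0 (contract E k w η) v = 0
    rw [extMul_apply]
    simp

end Smear

/-! ### Creation of decomposability near a stratum, one root direction at a time -/

section Creation
variable {V : Type u} [NormedAddCommGroup V] [InnerProductSpace ℝ V] [FiniteDimensional ℝ V]
  {ι : Type*} [Fintype ι] {Δ : Basis ι ℝ V} {K I : Finset ι}
  {X : Type*} [AddCommGroup X] [Module ℂ X] {E : Type*} [AddCommGroup E] [Module ℂ E] {k : ℕ}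

theorem coord_eq_zero {i : ι} (hi : i ∉ K) (y : splitSpace Δ ∅ K) : Δ.coord i (y : V) = 0 := by
  have : splitSpace Δ ∅ K ≤ LinearMap.ker (Δ.coord i) := by
    refine splitSpace_empty_le Δ fun j hj => ?_
    have : j ≠ i := fun h => hi (h ▸ hj)
    simp [this]
  exact this y.2

theorem inner_root_eq_sum (i : ι) (y : V) :
    ⟪Δ i, y⟫_ℝ = ∑ j, Δ.coord j y * ⟪Δ i, Δ j⟫_ℝ := by
  conv_lhs => rw [← Δ.sum_repr y]
  simp only [inner_sum, real_inner_smul_right]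
  rfl

open Classical in
/-- The points of `splitSpace ∅ K` whose coordinates differ from those of `z` by less than `1/3` in
`I` and by less than `4` elsewhere. -/
def box (I : Finset ι) (z : splitSpace Δ ∅ K) : Set (splitSpace Δ ∅ K) :=
  {y | ∀ j, |Δ.coord j (y : V) - Δ.coord j (z : V)| < if j ∈ I then 1 / 3 else 4}

open Classical in
theorem isOpen_box (I : Finset ι) (z : splitSpace Δ ∅ K) : IsOpen (box I z) := by
  have : box I z = ⋂ j, {y : splitSpace Δ ∅ K | |Δ.coord j (y : V) - Δ.coord j (z : V)| <
      if j ∈ I then 1 / 3 else 4} := by ext; simp [box]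
  rw [this]
  have hc : ∀ j, Continuous (Δ.coord j) := fun j => LinearMap.continuous_of_finiteDimensional _
  refine isOpen_iInter_of_finite fun j => isOpen_lt ?_ continuous_const
  exact (((hc j).comp continuous_subtype_val).sub continuous_const).abs

theorem self_mem_box (I : Finset ι) (z : splitSpace Δ ∅ K) : z ∈ box I z := by
  intro j
  rw [sub_self, abs_zero]
  split_ifs <;> norm_num

theorem abs_lt_four_of_mem_box {z y : splitSpace Δ ∅ K} (hy : y ∈ box I z) (j : ι) :
    |Δ.coord j (y : V) - Δ.coord j (z : V)| < 4 := by
  refine (hy j).trans_le ?_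
  split_ifs <;> norm_num

theorem abs_inner_root_sub_le {z y : splitSpace Δ ∅ K} (hy : y ∈ box I z) (i : ι) :
    |⟪Δ i, (y : V)⟫_ℝ - ⟪Δ i, (z : V)⟫_ℝ| ≤ rootShift Δ := by
  rw [inner_root_eq_sum, inner_root_eq_sum (Δ := Δ) i z, ← Finset.sum_sub_distrib]
  refine (Finset.abs_sum_le_sum_abs _ _).trans (le_trans ?_ (sum_le_rootShift Δ i))
  refine Finset.sum_le_sum fun j _ => ?_
  rw [← sub_mul, abs_mul]
  exact mul_le_mul_of_nonneg_right (abs_lt_four_of_mem_box hy j).le (abs_nonneg _)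

/-- Near `z` the function `F` is a finite sum of products of functions of the coordinates in `I`
and functions invariant under translations in the directions of `I`. -/
def SepAt (I : Finset ι) (z : splitSpace Δ ∅ K) (F : splitSpace Δ ∅ Finset.univ → X) : Prop :=
  ∃ S ∈ germFilter Δ K Finset.univ, IsOpen S ∧ ∃ (σ : Type) (_ : Fintype σ)
    (c : σ → splitSpace Δ ∅ K → ℂ) (Φ : σ → splitSpace Δ ∅ Finset.univ → X),
    (∀ l, ∀ j (hj : j ∈ K), j ∉ I → ∀ y (s : ℝ),
      c l (y + s • ⟨Δ j, root_mem_splitSpace Δ hj⟩) = c l y) ∧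
    (∀ l, ∀ j ∈ I, ∀ H (s : ℝ), Φ l (H + s • rootVec Δ j) = Φ l H) ∧
    (∀ l, ∀ y ∈ box I z, ∀ x ∈ S,
      SmoothFn (Φ l) ((splitEquiv Δ (Finset.subset_univ K)).symm (y, x))) ∧
    ∀ y ∈ box I z, ∀ x ∈ S, F ((splitEquiv Δ (Finset.subset_univ K)).symm (y, x)) =
      ∑ l, c l y • Φ l ((splitEquiv Δ (Finset.subset_univ K)).symm (y, x))

theorem lt_inner_root_of_mem_box {z y : splitSpace Δ ∅ K} (hy : y ∈ box I z) {B : ℝ} {i : ι}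
    (hi : i ∉ K) {x : splitSpace Δ K Finset.univ}
    (hx : x ∈ far Δ K Finset.univ (B - ⟪Δ i, (z : V)⟫_ℝ + rootShift Δ)) :
    B < ⟪Δ i, ((splitEquiv Δ (Finset.subset_univ K)).symm (y, x) : V)⟫_ℝ := by
  rw [inner_root_symm]
  have h1 := (abs_le.1 (abs_inner_root_sub_le hy i)).1
  have h2 := hx i (Finset.mem_univ i) hi
  linarith

theorem exists_far_box (z : splitSpace Δ ∅ K) (B : ℝ) : ∃ B', ∀ y ∈ box I z,
    ∀ x ∈ far Δ K Finset.univ B', ∀ i ∉ K,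
      B < ⟪Δ i, ((splitEquiv Δ (Finset.subset_univ K)).symm (y, x) : V)⟫_ℝ := by
  obtain ⟨M, hM⟩ := (Set.finite_range fun i => B - ⟪Δ i, (z : V)⟫_ℝ + rootShift Δ).bddAbove
  exact ⟨M, fun y hy x hx i hi =>
    lt_inner_root_of_mem_box hy hi (far_anti Δ (hM ⟨i, rfl⟩) hx)⟩

/-- Start of the induction over directions: one product, with constant coefficient. -/
theorem sepAt_empty {T : ℝ} {F : splitSpace Δ ∅ Finset.univ → X}
    (hF : ∀ H ∈ region Δ Finset.univ T, SmoothFn F H) {z : splitSpace Δ ∅ K}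
    (hz : z ∈ region Δ K (T + rootShift Δ)) : SepAt ∅ z F := by
  obtain ⟨B, hB⟩ := exists_far_box (I := ∅) z T
  refine ⟨_, far_mem Δ (Finset.subset_univ K) B, isOpen_far Δ B, Unit, inferInstance,
    fun _ _ => 1, fun _ => F, by simp, by simp, fun _ y hy x hx => hF _ fun i _ => ?_, by simp⟩
  by_cases hi : i ∈ K
  · rw [inner_root_symm_of_mem Δ _ hi]
    have h1 := (abs_le.1 (abs_inner_root_sub_le hy i)).1
    linarith [hz i hi]
  · exact hB y hy x hx i hi

/-- On the box the roots in `K` are bounded, while the roots outside `K` can be forced above that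
bound by `1` through a transverse condition. -/
theorem exists_cutoff_eq_one (z : splitSpace Δ ∅ K) : ∃ B, ∀ y ∈ box I z,
    ∀ x ∈ far Δ K Finset.univ B,
      cutoff Δ K ((splitEquiv Δ (Finset.subset_univ K)).symm (y, x) : V) = 1 := by
  classical
  obtain ⟨M, hM⟩ := (Set.finite_range fun i => ⟪Δ i, (z : V)⟫_ℝ).bddAbove
  obtain ⟨B, hB⟩ := exists_far_box (I := I) z (M + rootShift Δ + 1)
  refine ⟨B, fun y hy x hx => Finset.prod_eq_one fun q hq => ?_⟩
  rw [Finset.mem_product, Finset.mem_compl] at hq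
  refine Real.smoothTransition.one_of_one_le ?_
  have h1 := hB y hy x hx q.2 hq.2
  rw [inner_root_symm_of_mem Δ _ hq.1]
  have h2 := (abs_le.1 (abs_inner_root_sub_le hy q.1)).2
  have h3 := hM ⟨q.1, rfl⟩
  simp only at h3
  linarith

theorem splitEquiv_symm_add_smul {i : ι} (hi : i ∈ K) (y : splitSpace Δ ∅ K)
    (x : splitSpace Δ K Finset.univ) (s : ℝ) :
    (splitEquiv Δ (Finset.subset_univ K)).symm (y, x) + s • rootVec Δ i =
      (splitEquiv Δ (Finset.subset_univ K)).symm (y + s • ⟨Δ i, root_mem_splitSpace Δ hi⟩, x) := by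
  refine Subtype.ext ?_
  rw [splitEquiv_symm_coe]
  simp [rootVec, splitEquiv_symm_coe]
  abel

theorem coord_add_smul {i : ι} (hi : i ∈ K) (y : splitSpace Δ ∅ K) (s : ℝ) (j : ι) :
    Δ.coord j ((y + s • ⟨Δ i, root_mem_splitSpace Δ hi⟩ : splitSpace Δ ∅ K) : V) =
      Δ.coord j (y : V) + s * Δ.coord j (Δ i) := by
  rw [Submodule.coe_add, Submodule.coe_smul, map_add, map_smul, smul_eq_mul]

theorem coord_root_self (i : ι) : Δ.coord i (Δ i) = 1 := by simp

theorem coord_root_of_ne {i j : ι} (h : j ≠ i) : Δ.coord j (Δ i) = 0 := by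
  simp [Finsupp.single_eq_of_ne h]

theorem rootCoord_rootVec_self {i : ι} (hi : i ∈ K) : rootCoord Δ K i (rootVec Δ i) = 1 := by
  rw [rootCoord_apply, rootVec, splitEquiv_root Δ _ hi]
  exact coord_root_self i

theorem rootCoord_rootVec_of_ne {i j : ι} (hj : j ∈ K) (h : i ≠ j) :
    rootCoord Δ K i (rootVec Δ j) = 0 := by
  rw [rootCoord_apply, rootVec, splitEquiv_root Δ _ hj]
  exact coord_root_of_ne h

variable (Δ) in
/-- The chain map homotopic to the identity by `stepOp`. -/
noncomputable def stepChain (K : Finset ι) (i : ι) (f : splitSpace Δ ∅ Finset.univ →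
    splitSpace Δ ∅ Finset.univ [⋀^Fin k]→ₗ[ℝ] E) :
    splitSpace Δ ∅ Finset.univ → splitSpace Δ ∅ Finset.univ [⋀^Fin k]→ₗ[ℝ] E :=
  chainOp stair (rootVec Δ i) (rootCoord Δ K i) (fun H => cutoff Δ K H) f

set_option maxHeartbeats 1000000 in
open Classical in
-- Close to the stratum the cutoff is `1`, so the chain map is the smoothing operator, whose kernels
-- have finite rank in the coordinate `i`. Separation in `I` persists because the line integral
-- along `Δ i` commutes with translations along the other roots, on which the coordinate `i`
-- vanishes.
theorem SepAt.stepChain {f : splitSpace Δ ∅ Finset.univ →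
      splitSpace Δ ∅ Finset.univ [⋀^Fin k]→ₗ[ℝ] E} {z : splitSpace Δ ∅ K} (h : SepAt I z f)
    (hIK : I ⊆ K) {i : ι} (hi : i ∈ K) (hiI : i ∉ I) :
    SepAt (insert i I) z (stepChain Δ K i f) := by
  obtain ⟨S₁, hS₁, hS₁o, σ, _, c, Φ, hc, hΦ, hΦs, hf⟩ := h
  obtain ⟨B, hB⟩ := exists_cutoff_eq_one (I := I) z
  let e := splitEquiv Δ (Finset.subset_univ K)
  let w := rootVec Δ i
  let u := rootCoord Δ K i
  let S := S₁ ∩ far Δ K Finset.univ B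
  have hSo : IsOpen S := hS₁o.inter (isOpen_far Δ B)
  -- The node is taken from the centre `z`: coordinates within `1/3` of that of `z` lie between `m -
  -- 1/3` and `m + 4/3`, where one formula for the kernel is valid.
  let m := ⌊Δ.coord i (z : V)⌋
  have hm1 : (m : ℝ) ≤ Δ.coord i (z : V) := Int.floor_le _
  have hm2 : Δ.coord i (z : V) < m + 1 := Int.lt_floor_add_one _
  obtain ⟨f₁, f₂, g, hg, hg0, hsep⟩ := stair_separable m
  have hbox : box (insert i I) z ⊆ box I z := by
    intro y hy j
    refine (hy j).trans_le ?_
    by_cases hj : j ∈ I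
    · simp [hj]
    · rw [if_neg hj]; split_ifs <;> norm_num
  have hyi : ∀ y ∈ box (insert i I) z, |Δ.coord i (y : V) - Δ.coord i (z : V)| < 1 / 3 := by
    intro y hy
    simpa using hy i
  -- The old box has width `4` in coordinate `i`, which leaves room for the new width `1/3` and a
  -- shift by `3`.
  have hmove : ∀ y ∈ box (insert i I) z, ∀ s ∈ Set.uIcc (-3 : ℝ) 3,
      y + s • ⟨Δ i, root_mem_splitSpace Δ hi⟩ ∈ box I z := by
    intro y hy s hs j
    rw [coord_add_smul hi]
    by_cases hj : j = i
    · subst hj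
      rw [coord_root_self, if_neg hiI]
      rw [Set.uIcc_of_le (by norm_num)] at hs
      have := abs_lt.1 (hyi y hy)
      exact abs_lt.2 ⟨by linarith [hs.1], by linarith [hs.2]⟩
    · rw [coord_root_of_ne hj, mul_zero, add_zero]
      exact hbox hy j
  have hcontL : Continuous fun H => (e H).1 := LinearMap.continuous_of_finiteDimensional
    (proj (splitSpace Δ ∅ Finset.univ) (splitSpace Δ ∅ K))
  have hcontR : Continuous fun H => (e H).2 := LinearMap.continuous_of_finiteDimensional
    (proj (splitSpace Δ ∅ Finset.univ) (splitSpace Δ K Finset.univ))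
  have hopen : ∀ O : Set (splitSpace Δ ∅ K), IsOpen O → ∀ y ∈ O, ∀ x ∈ S,
      ∀ᶠ H in 𝓝 (e.symm (y, x)), (e H).1 ∈ O ∧ (e H).2 ∈ S := by
    intro O hO y hy x hx
    have h1 : (e (e.symm (y, x))).1 ∈ O := by rwa [e.apply_symm_apply]
    have h2 : (e (e.symm (y, x))).2 ∈ S := by rwa [e.apply_symm_apply]
    exact Filter.Eventually.and (hcontL.continuousAt (hO.mem_nhds h1))
      (hcontR.continuousAt (hSo.mem_nhds h2))
  have hseg : ∀ l, ∀ y ∈ box (insert i I) z, ∀ x ∈ S, SegSmooth w (-3) 3 (Φ l) (e.symm (y, x)) := by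
    intro l y hy x hx
    filter_upwards [hopen _ (isOpen_box _ z) y hy x hx] with H' hH' s hs
    have := hΦs l _ (hmove _ hH'.1 s hs) _ hH'.2.1
    rw [← splitEquiv_symm_add_smul hi] at this
    simpa [e] using this
  -- The segment starts at coordinate `0` and uses only parameters in `[m, m + 2]`, so its points
  -- remain within `4` of the coordinate of `z` even after moving the base point by less than `1`.
  have hseg' : ∀ l, ∀ y ∈ box (insert i I) z, ∀ x ∈ S,
      SegSmooth w m (m + 2) (Φ l) (e.symm (y, x) - u (e.symm (y, x)) • w) := by
    intro l y hy x hx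
    have e0 : e.symm (y, x) - u (e.symm (y, x)) • w =
        e.symm (y + (-Δ.coord i (y : V)) • ⟨Δ i, root_mem_splitSpace Δ hi⟩, x) := by
      rw [← splitEquiv_symm_add_smul hi, rootCoord_symm, neg_smul, sub_eq_add_neg]
    rw [e0]
    have hO : IsOpen {y : splitSpace Δ ∅ K | ∀ j, j ≠ i →
        |Δ.coord j (y : V) - Δ.coord j (z : V)| < if j ∈ I then 1 / 3 else 4} := by
      have : {y : splitSpace Δ ∅ K | ∀ j, j ≠ i →
          |Δ.coord j (y : V) - Δ.coord j (z : V)| < if j ∈ I then 1 / 3 else 4} =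
          ⋂ j, {y : splitSpace Δ ∅ K | j ≠ i →
          |Δ.coord j (y : V) - Δ.coord j (z : V)| < if j ∈ I then 1 / 3 else 4} := by ext; simp
      rw [this]
      refine isOpen_iInter_of_finite fun j => ?_
      by_cases hj : j = i
      · simp [hj]
      · simp only [ne_eq, hj, not_false_eq_true, forall_true_left]
        have hcj : Continuous (Δ.coord j) := LinearMap.continuous_of_finiteDimensional _
        exact isOpen_lt (((hcj).comp continuous_subtype_val).sub continuous_const).abs
          continuous_const
    have hO' : IsOpen {y : splitSpace Δ ∅ K | |Δ.coord i (y : V)| < 1} := by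
      have hcj : Continuous (Δ.coord i) := LinearMap.continuous_of_finiteDimensional _
      exact isOpen_lt (hcj.comp continuous_subtype_val).abs continuous_const
    filter_upwards [hopen _ (hO.inter hO') (y + (-Δ.coord i (y : V)) •
      ⟨Δ i, root_mem_splitSpace Δ hi⟩) ⟨fun j hj => by
        rw [coord_add_smul hi, coord_root_of_ne hj, mul_zero, add_zero]
        exact hbox hy j, by
        change |_| < (1 : ℝ)
        rw [coord_add_smul hi, coord_root_self]; simp⟩ x hx] with H' hH' s hs
    have hmem : (e H').1 + s • ⟨Δ i, root_mem_splitSpace Δ hi⟩ ∈ box I z := by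
      intro j
      rw [coord_add_smul hi]
      by_cases hj : j = i
      · subst hj
        rw [coord_root_self, if_neg hiI]
        rw [Set.uIcc_of_le (by linarith)] at hs
        have := abs_lt.1 (show |_| < (1 : ℝ) from hH'.1.2)
        exact abs_lt.2 ⟨by linarith [hs.1], by linarith [hs.2]⟩
      · rw [coord_root_of_ne hj, mul_zero, add_zero]
        exact hH'.1.1 j hj
    have := hΦs l _ hmem _ hH'.2.1
    rw [← splitEquiv_symm_add_smul hi] at this
    simpa [e] using this
  let Ψ : σ × Fin 3 → splitSpace Δ ∅ Finset.univ → splitSpace Δ ∅ Finset.univ [⋀^Fin k]→ₗ[ℝ] E :=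
    fun p => lineIntegral w u (g p.2) m (m + 2) (Φ p.1)
  have huw : u w = 1 := rootCoord_rootVec_self hi
  have hΨ : ∀ p, ∀ j ∈ insert i I, ∀ H (s : ℝ), Ψ p (H + s • rootVec Δ j) = Ψ p H := by
    intro p j hj H s
    rcases Finset.mem_insert.1 hj with rfl | hj
    · exact lineIntegral_add_smul_self huw _ _ _ s
    · have hji : i ≠ j := fun h => hiI (h ▸ hj)
      refine lineIntegral_add ?_ _ _ _ fun H => hΦ _ j hj H s
      rw [map_smul, rootCoord_rootVec_of_ne (hIK hj) hji, smul_zero]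
  have hΨs : ∀ p, ∀ y ∈ box (insert i I) z, ∀ x ∈ S, SmoothFn (Ψ p) (e.symm (y, x)) :=
    fun p y hy x hx => smoothFn_lineIntegral (hg p.2) (hseg' p.1 y hy x hx)
  -- Coefficients are the old ones times the left factors of the kernels; functions are the line
  -- integrals. The first family carries the term `u ∧ ι_w` with `κ₁`, the second minus the term
  -- with `κ₂`.
  refine ⟨S, inter_mem hS₁ (far_mem Δ (Finset.subset_univ K) B), hSo,
    (σ × Fin 3) ⊕ (σ × Fin 3), inferInstance,
    Sum.elim (fun p y => c p.1 y * f₁ p.2 (Δ.coord i (y : V)))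
      (fun p y => -(c p.1 y * f₂ p.2 (Δ.coord i (y : V)))),
    Sum.elim (fun p H => extContract E w k u (Ψ p H)) Ψ, ?_, ?_, ?_, ?_⟩
  · intro l j hj hjI y s
    have h1 : i ≠ j := fun h => hjI (h ▸ Finset.mem_insert_self i I)
    have h2 : j ∉ I := fun h => hjI (Finset.mem_insert_of_mem h)
    rcases l with p | p
    · simp only [Sum.elim_inl]
      rw [hc p.1 j hj h2, coord_add_smul hj, coord_root_of_ne h1, mul_zero, add_zero]
    · simp only [Sum.elim_inr]
      rw [hc p.1 j hj h2, coord_add_smul hj, coord_root_of_ne h1, mul_zero, add_zero]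
  · intro l j hj H s
    rcases l with p | p
    · simp only [Sum.elim_inl, hΨ p j hj]
    · exact hΨ p j hj H s
  · intro l y hy x hx
    rcases l with p | p
    · exact (hΨs p y hy x hx).map _
    · exact hΨs p y hy x hx
  · intro y hy x hx
    have h1 : (fun H : splitSpace Δ ∅ Finset.univ => cutoff Δ K (H : V)) =ᶠ[𝓝 (e.symm (y, x))]
        fun _ => 1 := by
      filter_upwards [hopen _ (isOpen_box _ z) y hy x hx] with H hH
      have := hB _ (hbox hH.1) _ hH.2.2
      simpa [e] using this
    have h2 : SplitForms.stepChain Δ K i f (e.symm (y, x)) = smoothingOp stair w u f (e.symm (y, x)) := by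
      rw [SplitForms.stepChain, chainOp, h1.fderiv_eq,
          show cutoff Δ K (e.symm (y, x) : V) = 1 from h1.self_of_nhds, fderiv_const_apply,
        extContract_zero]
      simp [w, u]
    have hu : u (e.symm (y, x)) = Δ.coord i (y : V) := rootCoord_symm Δ i _
    have h3 := abs_lt.1 (hyi y hy)
    have h4 : ∀ κ : ℝ × ℝ → ℝ, ∀ f' : Fin 3 → ℝ → ℝ, Continuous κ →
        (∀ s, κ (u (e.symm (y, x)), s) =
          ∑ e', f' e' (u (e.symm (y, x))) * g e' (u (e.symm (y, x)) + s)) →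
        smear w u κ (-3) 3 f (e.symm (y, x)) =
          ∑ p : σ × Fin 3, (c p.1 y * f' p.2 (Δ.coord i (y : V))) • Ψ p (e.symm (y, x)) := by
      intro κ f' hκc hκ
      -- Since `i` is not in `I`, the old coefficients do not change along `Δ i` and may be frozen
      -- at `y`.
      have h5 : smear w u κ (-3) 3 f (e.symm (y, x)) =
          smear w u κ (-3) 3 (fun H => ∑ l, c l y • Φ l H) (e.symm (y, x)) := by
        refine smear_congr fun s hs => ?_
        rw [splitEquiv_symm_add_smul hi, hf _ (hmove y hy s hs) x hx.1]
        exact Finset.sum_congr rfl fun l _ => by rw [hc l i hi hiI]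
      rw [h5, smear_sum_separable hκc hg (by linarith) hg0 (by rw [hu]; linarith)
        (by rw [hu]; linarith) hκ (fun l => hseg' l y hy x hx) (fun l => hseg l y hy x hx), hu]
    have h5 := fun s => hsep (u (e.symm (y, x))) s (by rw [hu]; linarith) (by rw [hu]; linarith)
    change SplitForms.stepChain Δ K i f (e.symm (y, x)) = _
    rw [h2, smoothingOp, h4 _ f₁ stair.contDiff₁.continuous fun s => (h5 s).1,
      h4 _ f₂ stair.contDiff₂.continuous fun s => (h5 s).2]
    simp only [Fintype.sum_sum_type, Sum.elim_inl, Sum.elim_inr, map_sum, map_smul, neg_smul,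
      Finset.sum_neg_distrib, sub_eq_add_neg]
    rfl

/-- The roots in `K` span the stratum directions. Functions invariant under all of them depend on
`x` alone and span the required space of slices. -/
theorem SepAt.decAt {F : splitSpace Δ ∅ Finset.univ → X} {z : splitSpace Δ ∅ K} (h : SepAt K z F) :
    DecAt (splitEquiv Δ (Finset.subset_univ K)) (germFilter Δ K Finset.univ) F z := by
  classical
  obtain ⟨S, hS, hSo, σ, _, c, Φ, hc, hΦ, hΦs, hF⟩ := h
  have hinv : ∀ l (y : splitSpace Δ ∅ K) x,
      Φ l ((splitEquiv Δ (Finset.subset_univ K)).symm (y, x)) =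
        Φ l ((splitEquiv Δ (Finset.subset_univ K)).symm (0, x)) := by
    intro l y x
    have h1 : ∀ t : Finset ι, t ⊆ K → ∀ H (s : ι → ℝ),
        Φ l (H + ∑ j ∈ t, s j • rootVec Δ j) = Φ l H := by
      intro t
      induction t using Finset.induction_on with
      | empty => simp
      | insert a t ha ih =>
        intro ht H s
        rw [Finset.sum_insert ha, add_comm (s a • _), ← add_assoc,
          hΦ l a (ht (Finset.mem_insert_self a t)), ih fun j hj => ht (Finset.mem_insert_of_mem hj)]
    rw [← h1 K subset_rfl ((splitEquiv Δ (Finset.subset_univ K)).symm (0, x)) fun j => Δ.coord j (y : V)]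
    congr 1
    refine Subtype.ext ?_
    simp only [splitEquiv_symm_coe, Submodule.coe_add, Submodule.coe_sum, Submodule.coe_smul,
      rootVec, Submodule.coe_zero, zero_add]
    conv_lhs => rw [← Δ.sum_repr (y : V)]
    rw [add_comm (x : V)]
    congr 1
    rw [← Finset.sum_subset (Finset.subset_univ K)]
    · rfl
    · intro j _ hj
      have := coord_eq_zero hj y
      rw [Basis.coord_apply] at this
      rw [this, zero_smul]
  refine ⟨Submodule.span ℂ (Set.range fun l x =>
    Φ l ((splitEquiv Δ (Finset.subset_univ K)).symm (0, x))),
    FiniteDimensional.span_of_finite ℂ (Set.finite_range _), S, hS, ?_⟩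
  filter_upwards [(isOpen_box K z).mem_nhds (self_mem_box K z)] with y hy
  refine ⟨∑ l, c l y • fun x => Φ l ((splitEquiv Δ (Finset.subset_univ K)).symm (0, x)),
    Submodule.sum_mem _ fun l _ => Submodule.smul_mem _ _ (Submodule.subset_span ⟨l, rfl⟩),
    fun x hx => ?_⟩
  rw [hF y hy x hx]
  simp [hinv _ y x]

end Creation
end SplitForms

namespace SplitForms

/-! ### Passage to germs and induction over the strata -/

section Chain
variable {V : Type u} [NormedAddCommGroup V] [InnerProductSpace ℝ V] [FiniteDimensional ℝ V]
  {ι : Type*} [Fintype ι] {Δ : Basis ι ℝ V} {K L I : Finset ι}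
  {X : Type*} [AddCommGroup X] [Module ℂ X] {E : Type u} [AddCommGroup E] [Module ℂ E] {k : ℕ}

theorem SmoothNear.congr {F F' : splitSpace Δ ∅ Finset.univ → X} (h : SmoothNear Δ F)
    (hF : F =ᶠ[germFilter Δ ∅ Finset.univ] F') : SmoothNear Δ F' := by
  rw [smoothNear_iff] at *
  filter_upwards [h, germFilter_eventually_nhds Δ hF] with H h1 h2 using h1.congr h2

theorem SmoothNear.dForm {f : splitSpace Δ ∅ Finset.univ →
      splitSpace Δ ∅ Finset.univ [⋀^Fin k]→ₗ[ℝ] E} (hf : SmoothNear Δ f) :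
    SmoothNear Δ (dForm f) := by
  rw [smoothNear_iff] at *
  exact (smooth_dForm Δ (hf.mono fun H h => smoothFormAt_iff.2 h)).mono
    fun H h => smoothFormAt_iff.1 h

theorem smoothNear_of_germ {g : smoothGerm Δ ∅ Finset.univ E k} {f : splitSpace Δ ∅ Finset.univ →
      splitSpace Δ ∅ Finset.univ [⋀^Fin k]→ₗ[ℝ] E} (h : g.1 = Germ.ofFun f) : SmoothNear Δ f := by
  obtain ⟨_, f', rfl, hf'⟩ := g
  exact (smoothNear_iff.2 (hf'.mono fun H h => smoothFormAt_iff.1 h)).congr (Germ.coe_eq.1 h)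

theorem mem_smoothGerm {f : splitSpace Δ ∅ Finset.univ →
      splitSpace Δ ∅ Finset.univ [⋀^Fin k]→ₗ[ℝ] E} (h : SmoothNear Δ f) :
    (Germ.ofFun f : (germFilter Δ ∅ Finset.univ).Germ _) ∈ smoothGerm Δ ∅ Finset.univ E k :=
  ⟨f, rfl, (smoothNear_iff.1 h).mono fun _ h => smoothFormAt_iff.2 h⟩

theorem exists_germ_rep (g : smoothGerm Δ ∅ Finset.univ E k) :
    ∃ f : splitSpace Δ ∅ Finset.univ → splitSpace Δ ∅ Finset.univ [⋀^Fin k]→ₗ[ℝ] E,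
      g.1 = Germ.ofFun f ∧ SmoothNear Δ f := by
  obtain ⟨_, f', rfl, hf'⟩ := g
  exact ⟨f', rfl, smoothNear_iff.2 (hf'.mono fun H h => smoothFormAt_iff.1 h)⟩

theorem germD_rep {g : smoothGerm Δ ∅ Finset.univ E k} {f : splitSpace Δ ∅ Finset.univ →
      splitSpace Δ ∅ Finset.univ [⋀^Fin k]→ₗ[ℝ] E} (h : g.1 = Germ.ofFun f) :
    (germD Δ ∅ Finset.univ E k g).1 = Germ.ofFun (dForm f) := by
  change germDAux Δ ∅ Finset.univ E k g.1 = _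
  rw [h]
  rfl

theorem homotopyOp_congr {W : Type*} [NormedAddCommGroup W] [NormedSpace ℝ W]
    [FiniteDimensional ℝ W] {N : SmoothingKernel} {w : W} {v : W →L[ℝ] ℝ} {χ : W → ℝ}
    {f f' : W → W [⋀^Fin (k + 1)]→ₗ[ℝ] E} {H : W}
    (h : ∀ s ∈ Set.uIcc (-3 : ℝ) 3, f (H + s • w) = f' (H + s • w)) :
    homotopyOp N w v χ f H = homotopyOp N w v χ f' H := by
  rw [homotopyOp, homotopyOp, smearDiff, smearDiff]
  congr 2
  · refine smear_congr fun s hs => congrArg _ (h s ?_)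
    rw [Set.uIcc_of_le (by norm_num)] at hs ⊢
    exact ⟨hs.1, hs.2.trans (by norm_num)⟩
  · exact smear_congr fun s hs => congrArg _ (h s hs)

theorem stepOp_congr {f f' : splitSpace Δ ∅ Finset.univ →
      splitSpace Δ ∅ Finset.univ [⋀^Fin (k + 1)]→ₗ[ℝ] E} (K : Finset ι) (i : ι)
    (h : f =ᶠ[germFilter Δ ∅ Finset.univ] f') :
    stepOp Δ K i f =ᶠ[germFilter Δ ∅ Finset.univ] stepOp Δ K i f' := by
  obtain ⟨T, hT⟩ := eventually_region_iff.1 h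
  exact eventually_region_iff.2 ⟨T + rootShift Δ, fun H hH => homotopyOp_congr fun s hs =>
    hT _ (add_smul_mem_region Δ rfl hH (abs_le_four_of_mem hs))⟩

variable (Δ E) in
/-- The homotopy operator on germs. -/
noncomputable def stepGerm (K : Finset ι) (i : ι) (k : ℕ)
    (g : smoothGerm Δ ∅ Finset.univ E (k + 1)) : smoothGerm Δ ∅ Finset.univ E k :=
  ⟨Germ.map' (stepOp Δ K i) (fun _ _ h => stepOp_congr K i h) g.1, by
    obtain ⟨f, hf, hs⟩ := exists_germ_rep g
    rw [hf]
    exact mem_smoothGerm (hs.stepOp K i)⟩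

theorem stepGerm_rep {g : smoothGerm Δ ∅ Finset.univ E (k + 1)} {f : splitSpace Δ ∅ Finset.univ →
      splitSpace Δ ∅ Finset.univ [⋀^Fin (k + 1)]→ₗ[ℝ] E} (h : g.1 = Germ.ofFun f) (i : ι) :
    (stepGerm Δ E K i k g).1 = Germ.ofFun (stepOp Δ K i f) := by
  obtain ⟨g, hg⟩ := g
  subst h
  rfl

theorem stepGerm_zero (K : Finset ι) (i : ι) (k : ℕ) : stepGerm Δ E K i k 0 = 0 := by
  have h0 : ((0 : smoothGerm Δ ∅ Finset.univ E (k + 1)).1) = Germ.ofFun (fun _ => 0) := rfl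
  refine Subtype.ext ((stepGerm_rep h0 i).trans (Germ.coe_eq.2 (.of_forall fun H => ?_)))
  have h1 : ∀ (κ : ℝ × ℝ → ℝ) (a b : ℝ), smear (rootVec Δ i) (rootCoord Δ K i) κ a b
      (fun _ => contract E k (rootVec Δ i) 0) H = 0 := fun κ a b => weakElt_eq fun φ => by simp
  rw [stepOp, homotopyOp, smearDiff, h1, h1]
  simp

theorem chainMap_stepGerm {g : smoothGerm Δ ∅ Finset.univ E k} {f : splitSpace Δ ∅ Finset.univ →
      splitSpace Δ ∅ Finset.univ [⋀^Fin k]→ₗ[ℝ] E} (h : g.1 = Germ.ofFun f) (i : ι) :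
    (Subcomplex.chainMap (germD Δ ∅ Finset.univ E) (stepGerm Δ E K i) k g).1 =
      Germ.ofFun (stepChain Δ K i f) := by
  obtain ⟨T, hT⟩ := smoothNear_of_germ h
  obtain ⟨T', hT'⟩ := (smoothNear_of_germ h).dForm
  have h2 := stepGerm_rep (K := K) (germD_rep h) i
  cases k with
  | zero =>
    change g.1 - (0 : smoothGerm Δ ∅ Finset.univ E 0).1 -
      (stepGerm Δ E K i 0 (germD Δ ∅ Finset.univ E 0 g)).1 = _
    rw [h, h2]
    refine Germ.coe_eq.2 (eventually_region_iff.2 ⟨T + rootShift Δ, fun H hH => ?_⟩)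
    have h3 := homotopy_zero (N := stair) (u := rootCoord Δ K i) (χ := fun H => cutoff Δ K (H : V))
      (segSmooth_of_region Δ hT i hH)
    change f H - 0 - stepOp Δ K i (dForm f) H = _
    rw [stepOp, h3, sub_zero, sub_sub_cancel]
    rfl
  | succ k =>
    have h1 := germD_rep (stepGerm_rep (K := K) h i)
    change g.1 - (germD Δ ∅ Finset.univ E k (stepGerm Δ E K i k g)).1 -
      (stepGerm Δ E K i (k + 1) (germD Δ ∅ Finset.univ E (k + 1) g)).1 = _
    rw [h, h2, h1]
    refine Germ.coe_eq.2 (eventually_region_iff.2 ⟨max T T' + rootShift Δ, fun H hH => ?_⟩)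
    have h3 := homotopy_succ (N := stair) (u := rootCoord Δ K i)
      (χ := fun H => cutoff Δ K (H : V))
      (segSmooth_of_region Δ hT i (region_anti Δ (add_le_add_left (le_max_left T T') _) hH))
      (segSmooth_of_region Δ hT' i (region_anti Δ (add_le_add_left (le_max_right T T') _) hH))
      (contDiff_cutoff_coe Δ K)
    change f H - dForm (stepOp Δ K i f) H - stepOp Δ K i (dForm f) H = stepChain Δ K i f H
    rw [sub_sub, stepOp, stepOp, h3, sub_sub_cancel]
    rfl

/-- Germs that are decomposable near the `L`-stratum. -/
def DecGerm (L : Finset ι) (g : smoothGerm Δ ∅ Finset.univ E k) : Prop :=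
  ∃ f : splitSpace Δ ∅ Finset.univ → splitSpace Δ ∅ Finset.univ [⋀^Fin k]→ₗ[ℝ] E,
    g.1 = Germ.ofFun f ∧ DecNear Δ L f

/-- Germs that separate the variables in `I` near the `K`-stratum. -/
def SepGerm (K I : Finset ι) (g : smoothGerm Δ ∅ Finset.univ E k) : Prop :=
  ∃ f : splitSpace Δ ∅ Finset.univ → splitSpace Δ ∅ Finset.univ [⋀^Fin k]→ₗ[ℝ] E,
    g.1 = Germ.ofFun f ∧ ∃ T, ∀ z ∈ region Δ K T, SepAt I z f

/-- The subcomplex of elements of `T` decomposable near the strata in `𝓕`. -/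
def decSubcomplex (T : Subcomplex (germD Δ ∅ Finset.univ E)) (𝓕 : Finset (Finset ι)) :
    Subcomplex (germD Δ ∅ Finset.univ E) where
  carrier k :=
    { carrier := {g | g ∈ T.carrier k ∧ ∀ L ∈ 𝓕, DecGerm L g}
      zero_mem' := ⟨Submodule.zero_mem _, fun _ _ => ⟨fun _ => 0, rfl, DecNear.zero⟩⟩
      add_mem' := by
        rintro g g' ⟨h1, h2⟩ ⟨h1', h2'⟩
        refine ⟨Submodule.add_mem _ h1 h1', fun L hL => ?_⟩
        obtain ⟨f, hf, hd⟩ := h2 L hL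
        obtain ⟨f', hf', hd'⟩ := h2' L hL
        exact ⟨fun H => f H + f' H, by
          change g.1 + g'.1 = _
          rw [hf, hf']; rfl, hd.add hd'⟩
      smul_mem' := by
        rintro c g ⟨h1, h2⟩
        refine ⟨Submodule.smul_mem _ c h1, fun L hL => ?_⟩
        obtain ⟨f, hf, hd⟩ := h2 L hL
        exact ⟨fun H => c • f H, by
          change c • g.1 = _
          rw [hf]; rfl, hd.map (c • LinearMap.id)⟩ }
  d_mem k g hg := ⟨T.d_mem k g hg.1, fun L hL => by
    obtain ⟨f, hf, hd⟩ := hg.2 L hL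
    exact ⟨dForm f, germD_rep hf, hd.dForm (smoothNear_of_germ hf)⟩⟩

theorem mem_decSubcomplex {T : Subcomplex (germD Δ ∅ Finset.univ E)} {𝓕 : Finset (Finset ι)}
    {g : smoothGerm Δ ∅ Finset.univ E k} :
    g ∈ (decSubcomplex T 𝓕).carrier k ↔ g ∈ T.carrier k ∧ ∀ L ∈ 𝓕, DecGerm L g := Iff.rfl

theorem DecGerm.stepGerm {g : smoothGerm Δ ∅ Finset.univ E (k + 1)} (h : DecGerm L g) {i : ι}
    (hi : i ∈ K) (hcard : K.card ≤ L.card) : DecGerm L (stepGerm Δ E K i k g) := by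
  obtain ⟨f, hf, hd⟩ := h
  exact ⟨stepOp Δ K i f, stepGerm_rep hf i, hd.stepOp (smoothNear_of_germ hf) hi hcard⟩

theorem SepGerm.empty (K : Finset ι) (g : smoothGerm Δ ∅ Finset.univ E k) : SepGerm K ∅ g := by
  obtain ⟨f, hf, T, hT⟩ := exists_germ_rep g
  exact ⟨f, hf, T + rootShift Δ, fun z hz => sepAt_empty hT hz⟩

theorem SepGerm.decGerm {g : smoothGerm Δ ∅ Finset.univ E k} (h : SepGerm K K g) :
    DecGerm K g := by
  obtain ⟨f, hf, T, hT⟩ := h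
  exact ⟨f, hf, T, fun z hz => (hT z hz).decAt⟩

variable {T : Subcomplex (germD Δ ∅ Finset.univ E)}

theorem stepGerm_mem_decSubcomplex {𝓕 : Finset (Finset ι)} {i : ι} (hi : i ∈ K)
    (hT : ∀ k, ∀ g ∈ T.carrier (k + 1), stepGerm Δ E K i k g ∈ T.carrier k)
    (hcard : ∀ L ∈ 𝓕, K.card ≤ L.card) :
    ∀ k, ∀ g ∈ (decSubcomplex T 𝓕).carrier (k + 1),
      stepGerm Δ E K i k g ∈ (decSubcomplex T 𝓕).carrier k :=
  fun k g hg => ⟨hT k g hg.1, fun L hL => (hg.2 L hL).stepGerm hi (hcard L hL)⟩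

open Classical in
-- Composes the chain maps of the single directions in `K`, each of which separates one more
-- variable. Two complexes are carried along because the comparison needs one homotopy preserving
-- both the source and the target of an inclusion.
theorem exists_homotopy {S S' : Subcomplex (germD Δ ∅ Finset.univ E)}
    (hS : ∀ i ∈ K, ∀ k, ∀ g ∈ S.carrier (k + 1), stepGerm Δ E K i k g ∈ S.carrier k)
    (hS' : ∀ i ∈ K, ∀ k, ∀ g ∈ S'.carrier (k + 1), stepGerm Δ E K i k g ∈ S'.carrier k)
    (I : Finset ι) (hI : I ⊆ K) :
    ∃ H : ∀ k, smoothGerm Δ ∅ Finset.univ E (k + 1) → smoothGerm Δ ∅ Finset.univ E k,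
      (∀ k, H k 0 = 0) ∧ (∀ k, ∀ g ∈ S.carrier (k + 1), H k g ∈ S.carrier k) ∧
      (∀ k, ∀ g ∈ S'.carrier (k + 1), H k g ∈ S'.carrier k) ∧
      ∀ k g, SepGerm K I (Subcomplex.chainMap (germD Δ ∅ Finset.univ E) H k g) := by
  have hdd := fun k => germD_germD Δ ∅ Finset.univ E k
  induction I using Finset.induction_on with
  | empty =>
    exact ⟨fun _ _ => 0, fun _ => rfl, fun _ _ _ => Submodule.zero_mem _,
      fun _ _ _ => Submodule.zero_mem _, fun _ _ => SepGerm.empty K _⟩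
  | insert i I hi ih =>
    obtain ⟨H, h0, h1, h2, h3⟩ := ih fun j hj => hI (Finset.mem_insert_of_mem hj)
    have hiK : i ∈ K := hI (Finset.mem_insert_self i I)
    refine ⟨Subcomplex.compHomotopy (germD Δ ∅ Finset.univ E) H (stepGerm Δ E K i), fun k => ?_, fun k g hg => ?_,
      fun k g hg => ?_, fun k g => ?_⟩
    · have h4 : Subcomplex.chainMap (germD Δ ∅ Finset.univ E) H (k + 1) 0 = 0 := by
        change 0 - germD Δ ∅ Finset.univ E k (H k 0) - H (k + 1) (germD Δ ∅ Finset.univ E (k + 1) 0)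
          = 0
        rw [h0, map_zero, map_zero, h0]
        simp
      rw [Subcomplex.compHomotopy, h0, h4, stepGerm_zero, add_zero]
    · exact Submodule.add_mem _ (h1 k g hg) (hS i hiK k _ (Subcomplex.chainMap_mem h1 hg))
    · exact Submodule.add_mem _ (h2 k g hg) (hS' i hiK k _ (Subcomplex.chainMap_mem h2 hg))
    · rw [Subcomplex.chainMap_compHomotopy hdd h0]
      obtain ⟨f, hf, T, hT⟩ := h3 k g
      exact ⟨stepChain Δ K i f, chainMap_stepGerm hf i, T, fun z hz =>
        (hT z hz).stepChain (fun j hj => hI (Finset.mem_insert_of_mem hj)) hiK hi⟩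

/-- Every complex of germs stable under the homotopy operators is quasi-isomorphic to the subcomplex
of decomposable germs. -/
theorem decSubcomplex_quasiIso
    (hT : ∀ K, ∀ i ∈ K, ∀ k, ∀ g ∈ T.carrier (k + 1), stepGerm Δ E K i k g ∈ T.carrier k)
    (𝓕 : Finset (Finset ι)) : (decSubcomplex T 𝓕).InclusionIsQuasiIso T := by
  classical
  -- Each newly inserted `K` has minimal cardinality, so the homotopies for `K` do not destroy
  -- decomposability near the strata already treated.
  refine Finset.induction_on_min_value Finset.card 𝓕 ?_ fun K 𝓕 hK hmin ih => ?_
  · refine Subcomplex.inclusionIsQuasiIso_iff.2 ⟨fun k g hg => hg.1, fun k g hg hgT => ?_,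
      fun k g hg => ⟨g, ⟨⟨hg.1, by simp⟩, hg.2⟩, by
        rw [sub_self]; exact Submodule.zero_mem _⟩⟩
    refine Subcomplex.coboundaries_mono (fun k g hg => ?_) k hgT
    exact ⟨hg, by simp⟩
  · have hS := fun i (hi : i ∈ K) => stepGerm_mem_decSubcomplex (𝓕 := 𝓕) hi (hT K i hi) hmin
    have hS' := fun i (hi : i ∈ K) => stepGerm_mem_decSubcomplex (𝓕 := insert K 𝓕) hi (hT K i hi)
      (by simpa using hmin)
    obtain ⟨H, h0, h1, h2, h3⟩ := exists_homotopy hS hS' K subset_rfl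
    refine Subcomplex.InclusionIsQuasiIso.trans (Subcomplex.inclusionIsQuasiIso_of_homotopy
      (fun k => germD_germD Δ ∅ Finset.univ E k) h0 ?_ h2 h1 ?_) ih
    · exact fun k g hg => ⟨hg.1, fun L hL => hg.2 L (Finset.mem_insert_of_mem hL)⟩
    · intro k g hg
      have h4 := Subcomplex.chainMap_mem h1 hg
      refine ⟨h4.1, fun L hL => ?_⟩
      rcases Finset.mem_insert.1 hL with rfl | hL
      · exact (h3 k g).decGerm
      · exact h4.2 L hL

end Chain
end SplitForms

namespace SplitForms

/-! ### Alternating forms on a direct sum, tested on tuples of vectors from the summands -/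

section SplitForm
variable {W X Y E : Type*} [AddCommGroup W] [Module ℝ W] [AddCommGroup X] [Module ℝ X]
  [AddCommGroup Y] [Module ℝ Y] [AddCommGroup E] [Module ℂ E] (e : W ≃ₗ[ℝ] Y × X) {p q m : ℕ}

/-- A tuple of vectors, each in one of the summands of `W`. -/
def splitTuple (u : Fin p → X) (v : Fin q → Y) : Fin p ⊕ Fin q → W :=
  Sum.elim (fun i => e.symm (0, u i)) fun j => e.symm (v j, 0)

/-- The value of a form on a tuple of vectors, each in one of the summands of `W`. -/
def splitEval (a : W [⋀^Fin (p + q)]→ₗ[ℝ] E) (u : Fin p → X) (v : Fin q → Y) : E :=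
  a (splitTuple e u v ∘ finSumFinEquiv.symm)

theorem splitEval_update_left [DecidableEq (Fin p)] (a : W [⋀^Fin (p + q)]→ₗ[ℝ] E) (u : Fin p → X)
    (v : Fin q → Y) (i : Fin p) (x : X) :
    splitEval e a (Function.update u i x) v = a (Function.update
      (splitTuple e u v ∘ finSumFinEquiv.symm) (finSumFinEquiv (Sum.inl i)) (e.symm (0, x))) := by
  rw [splitEval]
  congr 1
  ext j
  obtain ⟨j, rfl⟩ := finSumFinEquiv.surjective j
  rcases j with j | j
  · by_cases h : j = i
    · subst h; simp [splitTuple]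
    · have h' : (finSumFinEquiv (Sum.inl j) : Fin (p + q)) ≠ finSumFinEquiv (Sum.inl i) :=
        fun h2 => h (Sum.inl_injective (finSumFinEquiv.injective h2))
      rw [Function.update_of_ne h']
      simp [splitTuple, Function.update_of_ne h]
  · have h' : (finSumFinEquiv (Sum.inr j) : Fin (p + q)) ≠ finSumFinEquiv (Sum.inl i) :=
      fun h2 => by simpa using finSumFinEquiv.injective h2
    rw [Function.update_of_ne h']
    simp [splitTuple]

theorem splitEval_update_right [DecidableEq (Fin q)] (a : W [⋀^Fin (p + q)]→ₗ[ℝ] E) (u : Fin p → X)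
    (v : Fin q → Y) (i : Fin q) (y : Y) :
    splitEval e a u (Function.update v i y) = a (Function.update
      (splitTuple e u v ∘ finSumFinEquiv.symm) (finSumFinEquiv (Sum.inr i)) (e.symm (y, 0))) := by
  rw [splitEval]
  congr 1
  ext j
  obtain ⟨j, rfl⟩ := finSumFinEquiv.surjective j
  rcases j with j | j
  · have h' : (finSumFinEquiv (Sum.inl j) : Fin (p + q)) ≠ finSumFinEquiv (Sum.inr i) :=
      fun h2 => by simpa using finSumFinEquiv.injective h2
    rw [Function.update_of_ne h']
    simp [splitTuple]
  · by_cases h : j = i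
    · subst h; simp [splitTuple]
    · have h' : (finSumFinEquiv (Sum.inr j) : Fin (p + q)) ≠ finSumFinEquiv (Sum.inr i) :=
        fun h2 => h (Sum.inr_injective (finSumFinEquiv.injective h2))
      rw [Function.update_of_ne h']
      simp [splitTuple, Function.update_of_ne h]

theorem symm_add_left (y y' : Y) : e.symm (y + y', (0 : X)) = e.symm (y, 0) + e.symm (y', 0) := by
  rw [← map_add]; simp

theorem symm_add_right (x x' : X) : e.symm ((0 : Y), x + x') = e.symm (0, x) + e.symm (0, x') := by
  rw [← map_add]; simp

theorem symm_smul_left (c : ℝ) (y : Y) : e.symm (c • y, (0 : X)) = c • e.symm (y, 0) := by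
  rw [← map_smul]; simp

theorem symm_smul_right (c : ℝ) (x : X) : e.symm ((0 : Y), c • x) = c • e.symm (0, x) := by
  rw [← map_smul]; simp

/-- The component of a form in the first `p` arguments, the other ones being fixed. -/
def leftForm (v : Fin q → Y) : (W [⋀^Fin (p + q)]→ₗ[ℝ] E) →ₗ[ℂ] X [⋀^Fin p]→ₗ[ℝ] E where
  toFun a :=
    { toFun := fun u => splitEval e a u v
      map_update_add' := fun u i x y => by
        simp only [splitEval_update_left, symm_add_right, AlternatingMap.map_update_add]
      map_update_smul' := fun u i c x => by
        simp only [splitEval_update_left, symm_smul_right, AlternatingMap.map_update_smul]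
      map_eq_zero_of_eq' := fun u i j h hij => a.map_eq_zero_of_eq _
        (i := finSumFinEquiv (Sum.inl i)) (j := finSumFinEquiv (Sum.inl j))
        (by simp [splitTuple, h]) fun h2 => hij (Sum.inl_injective (finSumFinEquiv.injective h2)) }
  map_add' _ _ := rfl
  map_smul' _ _ := rfl

/-- The component of a form in the last `q` arguments, the other ones being fixed. -/
def rightForm (u : Fin p → X) (a : W [⋀^Fin (p + q)]→ₗ[ℝ] E) : Y [⋀^Fin q]→ₗ[ℝ] E where
  toFun v := splitEval e a u v
  map_update_add' v i x y := by
    simp only [splitEval_update_right, symm_add_left, AlternatingMap.map_update_add]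
  map_update_smul' v i c x := by
    simp only [splitEval_update_right, symm_smul_left, AlternatingMap.map_update_smul]
  map_eq_zero_of_eq' v i j h hij := a.map_eq_zero_of_eq _
    (i := finSumFinEquiv (Sum.inr i)) (j := finSumFinEquiv (Sum.inr j))
    (by simp [splitTuple, h]) fun h2 => hij (Sum.inr_injective (finSumFinEquiv.injective h2))

/-- A form is determined by its values on tuples of vectors in the summands. -/
theorem ext_splitEval {η η' : ∀ m, W [⋀^Fin m]→ₗ[ℝ] E}
    (h : ∀ p q (u : Fin p → X) (v : Fin q → Y),
      splitEval e (η (p + q)) u v = splitEval e (η' (p + q)) u v) : η = η' := by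
  classical
  funext m
  ext w
  let x : Fin m → W := fun i => e.symm (0, (e (w i)).2)
  let y : Fin m → W := fun i => e.symm ((e (w i)).1, 0)
  have hw : w = x + y := by
    ext i
    simp only [x, y, Pi.add_apply]
    rw [← map_add, ← e.symm_apply_apply (w i)]
    simp
  -- After writing every vector as a sum of its two components, multilinearity leaves one term for
  -- each subset; up to a permutation, hence up to sign, it is a split tuple.
  have key : ∀ s : Finset (Fin m), η m (s.piecewise x y) = η' m (s.piecewise x y) := by
    intro s
    have hm : s.card + sᶜ.card = m := by
      rw [Finset.card_add_card_compl, Fintype.card_fin]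
    let ρ : Fin s.card ⊕ Fin sᶜ.card ≃ Fin m := finSumEquivOfFinset rfl rfl
    let σ : Equiv.Perm (Fin m) := ((finCongr hm.symm).trans finSumFinEquiv.symm).trans ρ
    let u : Fin s.card → X := fun i => (e (w (ρ (Sum.inl i)))).2
    let v : Fin sᶜ.card → Y := fun i => (e (w (ρ (Sum.inr i)))).1
    have h1 : s.piecewise x y ∘ ρ = splitTuple e u v := by
      funext i
      rcases i with i | i
      · have h2 : ρ (Sum.inl i) ∈ s := by
          rw [finSumEquivOfFinset_inl]; exact Finset.orderEmbOfFin_mem _ _ _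
        simp [splitTuple, h2, x, u]
      · have h2 : ρ (Sum.inr i) ∈ sᶜ := by
          rw [finSumEquivOfFinset_inr]; exact Finset.orderEmbOfFin_mem _ _ _
        rw [Finset.mem_compl] at h2
        simp [splitTuple, h2, y, v]
    have h3 : s.piecewise x y ∘ σ = splitTuple e u v ∘ finSumFinEquiv.symm ∘ finCongr hm.symm := by
      rw [← h1]; rfl
    have h4 : ∀ η : ∀ m, W [⋀^Fin m]→ₗ[ℝ] E, ∀ (n : ℕ) (hn : n = m) (t : Fin n → W),
        η m (t ∘ finCongr hn.symm) = η n t := by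
      intro η n hn t
      subst hn
      rfl
    have h5 : η m (s.piecewise x y ∘ σ) = η' m (s.piecewise x y ∘ σ) := by
      rw [h3, ← Function.comp_assoc, h4 η _ hm, h4 η' _ hm]
      exact h _ _ u v
    rw [AlternatingMap.map_perm, AlternatingMap.map_perm] at h5
    rcases Int.units_eq_one_or (Equiv.Perm.sign σ) with h6 | h6 <;> simpa [h6] using h5
  rw [hw]
  have h1 := (η m).toMultilinearMap.map_add_univ x y
  have h2 := (η' m).toMultilinearMap.map_add_univ x y
  refine h1.trans (Eq.trans ?_ h2.symm)
  exact Finset.sum_congr rfl fun s _ => key s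

/-- The projections to the two summands. -/
def sndMap : W →ₗ[ℝ] X := (LinearMap.snd ℝ Y X).comp (e : W →ₗ[ℝ] Y × X)

def fstMap : W →ₗ[ℝ] Y := (LinearMap.fst ℝ Y X).comp (e : W →ₗ[ℝ] Y × X)

theorem wedge_apply (a : W [⋀^Fin p]→ₗ[ℝ] E) (c : W [⋀^Fin q]→ₗ[ℝ] ℂ) (t : Fin (p + q) → W) :
    wedge a c t = ∑ σ : Equiv.Perm.ModSumCongr (Fin p) (Fin q), TensorProduct.lift (coeffMul E)
      (AlternatingMap.domCoprod.summand a c σ (t ∘ finSumFinEquiv)) := by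
  have h1 : wedge a c t = TensorProduct.lift (coeffMul E)
      ((∑ σ : Equiv.Perm.ModSumCongr (Fin p) (Fin q), AlternatingMap.domCoprod.summand a c σ)
        (t ∘ finSumFinEquiv)) := rfl
  rw [h1, sum_apply, map_sum]

theorem lift_summand_mk (a : W [⋀^Fin p]→ₗ[ℝ] E) (c : W [⋀^Fin q]→ₗ[ℝ] ℂ)
    (t : Fin p ⊕ Fin q → W) (σ : Equiv.Perm (Fin p ⊕ Fin q)) :
    TensorProduct.lift (coeffMul E)
      (AlternatingMap.domCoprod.summand a c (Quotient.mk'' σ) t) =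
      Equiv.Perm.sign σ • (c fun j => t (σ (Sum.inr j))) • a fun i => t (σ (Sum.inl i)) := by
  rw [AlternatingMap.domCoprod.summand_mk'']
  rcases Int.units_eq_one_or (Equiv.Perm.sign σ) with h | h
  · rw [h, one_smul, one_smul]; rfl
  · rw [h, Units.neg_smul, Units.neg_smul, one_smul, one_smul]
    rw [neg_apply, map_neg]
    rfl

theorem sndMap_splitTuple_inr (u : Fin p → X) (v : Fin q → Y) (j : Fin q) :
    sndMap e (splitTuple e u v (Sum.inr j)) = 0 := by simp [sndMap, splitTuple]

theorem fstMap_splitTuple_inl (u : Fin p → X) (v : Fin q → Y) (i : Fin p) :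
    fstMap e (splitTuple e u v (Sum.inl i)) = 0 := by simp [fstMap, splitTuple]

theorem sndMap_splitTuple_inl (u : Fin p → X) (v : Fin q → Y) (i : Fin p) :
    sndMap e (splitTuple e u v (Sum.inl i)) = u i := by simp [sndMap, splitTuple]

theorem fstMap_splitTuple_inr (u : Fin p → X) (v : Fin q → Y) (j : Fin q) :
    fstMap e (splitTuple e u v (Sum.inr j)) = v j := by simp [fstMap, splitTuple]

/-- A shuffle that mixes the blocks feeds a vector of one summand to a factor pulled back from the
other, and that factor vanishes. -/
theorem term_eq_zero {p' q' : ℕ} (a : X [⋀^Fin p]→ₗ[ℝ] E) (c : Y [⋀^Fin q]→ₗ[ℝ] ℂ)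
    (u : Fin p' → X) (v : Fin q' → Y) (ρ : Fin p ⊕ Fin q ≃ Fin p' ⊕ Fin q')
    (h : ¬ ((∀ i, ∃ i', ρ (Sum.inl i) = Sum.inl i') ∧ ∀ j, ∃ j', ρ (Sum.inr j) = Sum.inr j')) :
    (c.compLinearMap (fstMap e) fun j => splitTuple e u v (ρ (Sum.inr j))) •
      (a.compLinearMap (sndMap e) fun i => splitTuple e u v (ρ (Sum.inl i))) = 0 := by
  rw [not_and_or] at h
  rcases h with h | h
  · push Not at h
    obtain ⟨i, hi⟩ := h
    obtain ⟨j, hj⟩ : ∃ j, ρ (Sum.inl i) = Sum.inr j := by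
      rcases h1 : ρ (Sum.inl i) with x | x
      · exact absurd h1 (hi x)
      · exact ⟨x, rfl⟩
    rw [AlternatingMap.compLinearMap_apply a, a.map_coord_zero i, smul_zero]
    rw [hj, sndMap_splitTuple_inr]
  · push Not at h
    obtain ⟨i, hi⟩ := h
    obtain ⟨j, hj⟩ : ∃ j, ρ (Sum.inr i) = Sum.inl j := by
      rcases h1 : ρ (Sum.inr i) with x | x
      · exact ⟨x, rfl⟩
      · exact absurd h1 (hi x)
    rw [AlternatingMap.compLinearMap_apply c, c.map_coord_zero i, zero_smul]
    rw [hj, fstMap_splitTuple_inl]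

theorem wedge_splitEval (a : X [⋀^Fin p]→ₗ[ℝ] E) (c : Y [⋀^Fin q]→ₗ[ℝ] ℂ)
    (u : Fin p → X) (v : Fin q → Y) :
    splitEval e (wedge (a.compLinearMap (sndMap e)) (c.compLinearMap (fstMap e))) u v =
      c v • a u := by
  classical
  rw [splitEval, wedge_apply]
  have h0 : (splitTuple e u v ∘ finSumFinEquiv.symm) ∘ finSumFinEquiv = splitTuple e u v := by
    ext i; simp
  rw [h0]
  refine (Finset.sum_eq_single
    (Quotient.mk'' 1 : Equiv.Perm.ModSumCongr (Fin p) (Fin q)) ?_ ?_).trans ?_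
  rotate_left 2
  · rw [lift_summand_mk]
    simp [sndMap_splitTuple_inl, fstMap_splitTuple_inr]
  · intro σ _ hσ
    induction σ using Quotient.inductionOn' with | _ σ
    rw [lift_summand_mk, term_eq_zero, smul_zero]
    rintro ⟨h1, -⟩
    refine hσ (Quotient.sound' ?_)
    rw [QuotientGroup.leftRel_apply, mul_one]
    refine inv_mem (Equiv.Perm.mem_sumCongrHom_range_of_perm_mapsTo_inl ?_)
    rintro _ ⟨i, rfl⟩
    obtain ⟨i', hi'⟩ := h1 i
    exact ⟨i', hi'.symm⟩
  · simp

/-- If the degrees of the factors do not match those of the tuple, counting shows that every shuffle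
mixes the blocks. -/
theorem wedge_splitEval_of_ne {p' q' : ℕ} (a : X [⋀^Fin p]→ₗ[ℝ] E) (c : Y [⋀^Fin q]→ₗ[ℝ] ℂ)
    (h : p + q = p' + q') (hp : p ≠ p') (u : Fin p' → X) (v : Fin q' → Y) :
    splitEval e ((wedge (a.compLinearMap (sndMap e)) (c.compLinearMap (fstMap e))).domDomCongr
      (finCongr h)) u v = 0 := by
  classical
  have h1 : splitEval e ((wedge (a.compLinearMap (sndMap e))
      (c.compLinearMap (fstMap e))).domDomCongr (finCongr h)) u v =
      wedge (a.compLinearMap (sndMap e)) (c.compLinearMap (fstMap e))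
        ((splitTuple e u v ∘ finSumFinEquiv.symm) ∘ finCongr h) := rfl
  rw [h1, wedge_apply]
  refine Finset.sum_eq_zero fun σ _ => ?_
  induction σ using Quotient.inductionOn' with | _ σ
  let ρ : Fin p ⊕ Fin q ≃ Fin p' ⊕ Fin q' :=
    ((σ.trans finSumFinEquiv).trans (finCongr h)).trans finSumFinEquiv.symm
  rw [lift_summand_mk]
  have h2 := term_eq_zero e a c u v ρ ?_
  · exact (congrArg _ h2).trans (smul_zero _)
  · rintro ⟨h3, h4⟩
    choose f hf using h3
    choose g hg using h4
    have h5 : p ≤ p' := by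
      simpa using Fintype.card_le_of_injective f fun i j hij => Sum.inl_injective
        (ρ.injective (by rw [hf, hf, hij]))
    have h6 : q ≤ q' := by
      simpa using Fintype.card_le_of_injective g fun i j hij => Sum.inr_injective
        (ρ.injective (by rw [hg, hg, hij]))
    omega

theorem altForm_sum_apply {σ : Type*} (s : Finset σ) (T : σ → W [⋀^Fin m]→ₗ[ℝ] E)
    (t : Fin m → W) : (∑ j ∈ s, T j) t = ∑ j ∈ s, T j t := by
  classical
  induction s using Finset.induction_on with
  | empty => simp
  | insert a s ha ih => simp [Finset.sum_insert ha, ih]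

/-- Together with `ext_splitEval` this allows identities between sums of exterior products to be
checked on values of the factors. -/
theorem wedgeTot_splitEval (a : ∀ p : ℕ, X [⋀^Fin p]→ₗ[ℝ] E) (c : ∀ q : ℕ, Y [⋀^Fin q]→ₗ[ℝ] ℂ)
    (u : Fin p → X) (v : Fin q → Y) :
    splitEval e (wedgeTot (fun p => (a p).compLinearMap (sndMap e))
      (fun q => (c q).compLinearMap (fstMap e)) (p + q)) u v = c q v • a p u := by
  have h1 : ∀ r : Fin (p + q + 1), ∀ h : (r : ℕ) + (p + q - r) = p + q,
      splitEval e ((wedge ((a r).compLinearMap (sndMap e))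
        ((c (p + q - r)).compLinearMap (fstMap e))).domDomCongr (finCongr h)) u v =
      if (r : ℕ) = p then c q v • a p u else 0 := by
    intro r h
    split_ifs with hr
    · obtain ⟨r, hr'⟩ := r
      simp only at hr h ⊢
      subst hr
      generalize h2 : r + q - r = s at h
      obtain rfl : s = q := by omega
      exact wedge_splitEval e (a r) (c s) u v
    · exact wedge_splitEval_of_ne e _ _ h hr u v
  rw [splitEval, wedgeTot, altForm_sum_apply, Finset.sum_congr rfl fun r _ => h1 r (by omega)]
  rw [Finset.sum_eq_single ⟨p, by omega⟩]
  · simp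
  · intro r _ hr
    rw [if_neg fun h => hr (Fin.ext h)]
  · simp

end SplitForm
end SplitForms

namespace SplitForms

/-! ### Restriction to a stratum as a linear image of the transverse slices -/

section SliceForm
variable {W X Y E E' : Type*} [AddCommGroup W] [Module ℝ W] [AddCommGroup X] [Module ℝ X]
  [AddCommGroup Y] [Module ℝ Y] [AddCommGroup E] [Module ℂ E] [AddCommGroup E'] [Module ℂ E']
  (e : W ≃ₗ[ℝ] Y × X) {p q m : ℕ}

theorem leftForm_update_add [DecidableEq (Fin q)] (v : Fin q → Y) (i : Fin q) (y y' : Y)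
    (a : W [⋀^Fin (p + q)]→ₗ[ℝ] E) :
    leftForm e (Function.update v i (y + y')) a =
      leftForm e (Function.update v i y) a + leftForm e (Function.update v i y') a := by
  ext u
  exact (rightForm e u a).map_update_add v i y y'

theorem leftForm_update_smul [DecidableEq (Fin q)] (v : Fin q → Y) (i : Fin q) (c : ℝ) (y : Y)
    (a : W [⋀^Fin (p + q)]→ₗ[ℝ] E) :
    leftForm e (Function.update v i (c • y)) a = c • leftForm e (Function.update v i y) a := by
  ext u
  exact (rightForm e u a).map_update_smul v i c y

theorem leftForm_eq_zero {v : Fin q → Y} {i j : Fin q} (h : v i = v j) (hij : i ≠ j)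
    (a : W [⋀^Fin (p + q)]→ₗ[ℝ] E) : leftForm e v a = 0 := by
  ext u
  exact (rightForm e u a).map_eq_zero_of_eq v h hij

/-- The forms on `Y` with values in `E'` obtained from a family of forms on `W`, indexed by `X`, by
applying the linear map `Λ` to its components in the direction of `X`. -/
noncomputable def sliceForm (Λ : (∀ p : ℕ, X → X [⋀^Fin p]→ₗ[ℝ] E) →ₗ[ℂ] E') :
    (X → ∀ m : ℕ, W [⋀^Fin m]→ₗ[ℝ] E) →ₗ[ℂ] ∀ q : ℕ, Y [⋀^Fin q]→ₗ[ℝ] E' where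
  toFun F q :=
    { toFun := fun v => Λ fun p x => leftForm e v (F x (p + q))
      map_update_add' := fun v i y y' => by
        simp only [leftForm_update_add]
        exact map_add Λ (fun p x => leftForm e (Function.update v i y) (F x (p + q))) _
      map_update_smul' := fun v i c y => by
        simp only [leftForm_update_smul]
        exact (Λ.restrictScalars ℝ).map_smul c
          (fun p x => leftForm e (Function.update v i y) (F x (p + q)))
      map_eq_zero_of_eq' := fun v i j h hij => by
        simp only [leftForm_eq_zero e h hij]
        exact map_zero Λ }
  map_add' F F' := by
    ext q v
    have : (fun p x => leftForm e v ((F + F') x (p + q))) =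
        (fun p x => leftForm e v (F x (p + q))) + fun p x => leftForm e v (F' x (p + q)) := by
      ext p x : 2
      exact map_add (leftForm e v) _ _
    change Λ _ = Λ _ + Λ _
    rw [this, map_add]
  map_smul' c F := by
    ext q v
    have : (fun p x => leftForm e v ((c • F) x (p + q))) =
        c • fun p x => leftForm e v (F x (p + q)) := by
      ext p x : 2
      exact map_smul (leftForm e v) _ _
    change Λ _ = c • Λ _
    rw [this, map_smul]

theorem sliceForm_congr {D : Filter X} {Λ : (∀ p : ℕ, X → X [⋀^Fin p]→ₗ[ℝ] E) →ₗ[ℂ] E'}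
    (hΛ : ∀ f f', (∀ p, f p =ᶠ[D] f' p) → Λ f = Λ f') {F F' : X → ∀ m : ℕ, W [⋀^Fin m]→ₗ[ℝ] E}
    (h : F =ᶠ[D] F') : sliceForm e Λ F = sliceForm e Λ F' := by
  ext q v
  exact hΛ _ _ fun p => h.mono fun x hx => by simp only [hx]

end SliceForm

section Evaluations
variable (Y : Type*) [NormedAddCommGroup Y] [NormedSpace ℝ Y] [FiniteDimensional ℝ Y]

theorem altForm_eq_zero_of_finrank_lt {Y : Type*} [NormedAddCommGroup Y] [NormedSpace ℝ Y]
    [FiniteDimensional ℝ Y] {E : Type*} [AddCommGroup E] [Module ℂ E] {q : ℕ}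
    (hq : finrank ℝ Y < q) (b : Y [⋀^Fin q]→ₗ[ℝ] E) : b = 0 := by
  ext v
  refine b.map_linearDependent v fun h => ?_
  have := h.fintype_card_le_finrank
  rw [Fintype.card_fin] at this
  omega

open Classical in
/-- Forms of mixed degree are determined by finitely many values. -/
theorem exists_graded_evaluations : ∃ (σ : Type) (_ : Fintype σ) (d : σ → ℕ)
    (v : ∀ s, Fin (d s) → Y) (ε : ∀ s, Y [⋀^Fin (d s)]→ₗ[ℝ] ℂ),
    ∀ (E : Type u) [AddCommGroup E] [Module ℂ E] (b : ∀ q, Y [⋀^Fin q]→ₗ[ℝ] E) (q : ℕ),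
      b q = ∑ s, coeffTensor (b (d s) (v s))
        ((Pi.single (d s) (ε s) : ∀ q, Y [⋀^Fin q]→ₗ[ℝ] ℂ) q) := by
  choose N v ε h using fun q => exists_form_evaluations Y q
  refine ⟨Σ q : Fin (finrank ℝ Y + 1), Fin (N q), inferInstance, fun s => s.1, fun s => v s.1 s.2,
    fun s => ε s.1 s.2, fun E _ _ b q => ?_⟩
  have h0 : ∀ s : Σ q : Fin (finrank ℝ Y + 1), Fin (N q), (s.1 : ℕ) ≠ q →
      coeffTensor (b s.1 (v s.1 s.2))
        ((Pi.single (s.1 : ℕ) (ε s.1 s.2) : ∀ q, Y [⋀^Fin q]→ₗ[ℝ] ℂ) q) = 0 := by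
    intro s hs
    rw [Pi.single_eq_of_ne hs.symm]
    ext w
    simp [coeffTensor_apply]
  rw [Fintype.sum_sigma]
  by_cases hq : q < finrank ℝ Y + 1
  · rw [Finset.sum_eq_single (⟨q, hq⟩ : Fin (finrank ℝ Y + 1))]
    · simp only [Pi.single_eq_same]
      exact eq_sum_coeffTensor (h q) (b q)
    · intro r _ hr
      exact Finset.sum_eq_zero fun j _ => h0 ⟨r, j⟩ fun h => hr (Fin.ext h)
    · simp
  · rw [Finset.sum_eq_zero]
    · exact altForm_eq_zero_of_finrank_lt (by omega) (b q)
    · intro r _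
      exact Finset.sum_eq_zero fun j _ => h0 ⟨r, j⟩ fun h => hq (h ▸ r.2)

end Evaluations

section Germs
variable {V : Type u} [NormedAddCommGroup V] [InnerProductSpace ℝ V] [FiniteDimensional ℝ V]
  {ι : Type*} [Fintype ι] (Δ : Basis ι ℝ V) {K J K' : Finset ι}
  (E : Type u) [AddCommGroup E] [Module ℂ E]

variable (K J) in
/-- A linear map from all forms to the germs of smooth forms, equal to the passage to germs on smooth
forms. -/
theorem exists_germ_section : ∃ Λ : (∀ p : ℕ, splitSpace Δ K J →
      splitSpace Δ K J [⋀^Fin p]→ₗ[ℝ] E) →ₗ[ℂ] ∀ p, smoothGerm Δ K J E p,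
    (∀ f f', (∀ p, f p =ᶠ[germFilter Δ K J] f' p) → Λ f = Λ f') ∧
    ∀ f (g : ∀ p, smoothGerm Δ K J E p), (∀ p, (g p).1 = Germ.ofFun (f p)) → Λ f = g := by
  -- A linear retraction of all germs onto the smooth ones. It is arbitrary off the smooth germs,
  -- but being defined everywhere and linear it carries finite-dimensional spaces of slices to
  -- finite-dimensional spaces.
  choose r hr using fun p => (smoothGerm Δ K J E p).subtype.exists_leftInverse_of_injective
    (Submodule.ker_subtype _)
  let c : ∀ p, (splitSpace Δ K J → splitSpace Δ K J [⋀^Fin p]→ₗ[ℝ] E) →ₗ[ℂ]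
      (germFilter Δ K J).Germ (splitSpace Δ K J [⋀^Fin p]→ₗ[ℝ] E) := fun p =>
    { toFun := fun f => (f : (germFilter Δ K J).Germ _)
      map_add' := fun _ _ => rfl
      map_smul' := fun _ _ => rfl }
  refine ⟨LinearMap.pi fun p => ((r p).comp (c p)).comp (LinearMap.proj p), fun f f' h => ?_,
    fun f g h => ?_⟩
  · funext p
    exact congrArg (r p) (Germ.coe_eq.2 (h p))
  · funext p
    have h1 : c p (f p) = (smoothGerm Δ K J E p).subtype (g p) := (h p).symm
    change r p (c p (f p)) = g p
    rw [h1]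
    exact LinearMap.congr_fun (hr p) (g p)

variable {Δ E}

theorem add_mem_splitSpace (h : K' ⊆ K) (hKJ : K ⊆ J) (x' : splitSpace Δ K' K)
    (x : splitSpace Δ K J) : (x' + x : V) ∈ splitSpace Δ K' J := by
  have h1 := (splitSpace_eq Δ K' K).le x'.2
  have h2 := (splitSpace_eq Δ K J).le x.2
  exact (splitSpace_eq Δ K' J).ge ⟨Submodule.add_mem _ (splitSpace_empty_mono Δ hKJ h1.1) h2.1,
    Submodule.add_mem _ h1.2 (Submodule.orthogonal_le (splitSpace_empty_mono Δ h) h2.2)⟩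

/-- The roots in `K` vanish on `x` and keep their values at `x'`; those in `J` outside `K` become
large as `x` tends to infinity with `x'` fixed. -/
theorem eventually_add_mem_far (h : K' ⊆ K) (hKJ : K ⊆ J) {B : ℝ} {x' : splitSpace Δ K' K}
    (hx' : x' ∈ far Δ K' K B) : ∀ᶠ x : splitSpace Δ K J in germFilter Δ K J,
      (⟨x' + x, add_mem_splitSpace h hKJ x' x⟩ : splitSpace Δ K' J) ∈ far Δ K' J B := by
  obtain ⟨M, hM⟩ := (Set.finite_range fun i => B - ⟪Δ i, (x' : V)⟫_ℝ).bddAbove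
  filter_upwards [far_mem Δ hKJ M] with x hx i hi hiK'
  simp only [inner_add_right]
  by_cases hiK : i ∈ K
  · rw [inner_root_eq_zero Δ hiK x, add_zero]
    exact hx' i hiK hiK'
  · have h1 := hx i hi hiK
    have h2 := hM ⟨i, rfl⟩
    simp only at h2
    linarith

variable {E' : Type*} [AddCommGroup E'] [Module ℂ E']

/-- A slice of the restriction over `x'` arises from a slice of the original form over `x' + x`, by
translating and applying the fixed map `Λ` in `x`. This is linear in the slice, so the image of the
original space of slices works; hence the recursive condition is automatic. -/
theorem decAt_sliceForm (h : K' ⊆ K) (hKJ : K ⊆ J)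
    {Λ : (∀ p : ℕ, splitSpace Δ K J → splitSpace Δ K J [⋀^Fin p]→ₗ[ℝ] E) →ₗ[ℂ] E'}
    (hΛ : ∀ f f', (∀ p, f p =ᶠ[germFilter Δ K J] f' p) → Λ f = Λ f')
    {Ψ : splitSpace Δ ∅ J → ∀ m : ℕ, splitSpace Δ ∅ J [⋀^Fin m]→ₗ[ℝ] E} {z : splitSpace Δ ∅ K'}
    (hd : DecAt (splitEquiv Δ (h.trans hKJ)) (germFilter Δ K' J) Ψ z) :
    DecAt (splitEquiv Δ h) (germFilter Δ K' K)
      (fun y => sliceForm (splitEquiv Δ hKJ) Λ fun x => Ψ ((splitEquiv Δ hKJ).symm (y, x))) z := by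
  obtain ⟨G, hG, S, hS, hev⟩ := hd
  obtain ⟨B, hB⟩ := (mem_germFilter_iff Δ (h.trans hKJ)).1 hS
  let s : splitSpace Δ K' K → splitSpace Δ K J → splitSpace Δ K' J := fun x' x =>
    ⟨x' + x, add_mem_splitSpace h hKJ x' x⟩
  let A : (splitSpace Δ K' J → ∀ m : ℕ, splitSpace Δ ∅ J [⋀^Fin m]→ₗ[ℝ] E) →ₗ[ℂ]
      (splitSpace Δ K' K → ∀ q : ℕ, splitSpace Δ ∅ K [⋀^Fin q]→ₗ[ℝ] E') :=
    LinearMap.pi fun x' => (sliceForm (splitEquiv Δ hKJ) Λ).comp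
      (LinearMap.funLeft ℂ (∀ m : ℕ, splitSpace Δ ∅ J [⋀^Fin m]→ₗ[ℝ] E) (s x'))
  refine ⟨G.map A, inferInstance, far Δ K' K B, far_mem Δ h B, hev.mono fun y hy => ?_⟩
  obtain ⟨g, hg, hgy⟩ := hy
  refine ⟨A g, Submodule.mem_map_of_mem hg, fun x' hx' => ?_⟩
  refine sliceForm_congr _ hΛ ?_
  filter_upwards [eventually_add_mem_far h hKJ hx'] with x hx
  change _ = g (s x' x)
  rw [← show Ψ ((splitEquiv Δ (h.trans hKJ)).symm (y, s x' x)) = g (s x' x) from hgy _ (hB hx)]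
  congr 1
  exact Subtype.ext (by simp only [splitEquiv_symm_coe, s, add_assoc])

/-- Local description of a smooth decomposable form of mixed degree. -/
theorem exists_localRep (h : K ⊆ J) {T : ℝ}
    {Ψ : splitSpace Δ ∅ J → ∀ m : ℕ, splitSpace Δ ∅ J [⋀^Fin m]→ₗ[ℝ] E}
    (hs : ∀ H ∈ region Δ J T, SmoothFn Ψ H) {z : splitSpace Δ ∅ K} (hz : z ∈ region Δ K T)
    (hd : DecAt (splitEquiv Δ h) (germFilter Δ K J) Ψ z) :
    ∃ (b : splitSpace Δ K J) (O : Set (splitSpace Δ ∅ K)),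
      IsOpen O ∧ z ∈ O ∧ IsCompact (closure O) ∧
      (∀ y ∈ O, ∀ x ∈ cone Δ K J b, (splitEquiv Δ h).symm (y, x) ∈ region Δ J T) ∧
      ∃ (n : ℕ) (β : Fin n → splitSpace Δ ∅ K → ℂ)
        (c : Fin n → splitSpace Δ K J → ∀ m : ℕ, splitSpace Δ ∅ J [⋀^Fin m]→ₗ[ℝ] E),
        (∀ l, ∀ y ∈ O, ContDiffAt ℝ ∞ (β l) y) ∧ (∀ l, ∀ x ∈ cone Δ K J b, SmoothFn (c l) x) ∧
        ∀ y ∈ O, ∀ x ∈ cone Δ K J b,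
          Ψ ((splitEquiv Δ h).symm (y, x)) = ∑ l, β l y • c l x := by
  have h1 := (eventually_prod_iff_exists (p := fun p => (splitEquiv Δ h).symm p ∈ region Δ J T)).1
    (eventually_mem_region Δ h hz)
  obtain ⟨S₁, hS₁, hO₁⟩ := h1
  obtain ⟨S₂, hS₂, O₂, -, hO₂o, hzO₂, n, β, c, hβ, hc, hrep⟩ :=
    hd.exists_rep (hasOpenBasis_germFilter Δ h) ⟨S₁, hS₁, hO₁.mono fun y hy x hx => hs _ (hy x hx)⟩
  obtain ⟨O₁, hO₁', hO₁o, hzO₁⟩ := eventually_nhds_iff.1 hO₁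
  obtain ⟨b, hb⟩ := exists_cone_subset Δ h (inter_mem hS₁ hS₂)
  refine ⟨b, O₁ ∩ O₂ ∩ Metric.ball z 1, (hO₁o.inter hO₂o).inter Metric.isOpen_ball,
    ⟨⟨hzO₁, hzO₂⟩, Metric.mem_ball_self one_pos⟩, ?_, fun y hy x hx => hO₁' y hy.1.1 x (hb hx).1,
    n, β, c, fun l y hy => hβ l y hy.1.2, fun l x hx => hc l x (hb hx).2,
    fun y hy x hx => hrep y hy.1.2 x (hb hx).2⟩
  exact (isCompact_closedBall z 1).of_isClosed_subset isClosed_closure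
    (closure_minimal (Set.inter_subset_right.trans Metric.ball_subset_closedBall)
      Metric.isClosed_closedBall)

theorem sliceForm_rep (h : K ⊆ J)
    {Λ : (∀ p : ℕ, splitSpace Δ K J → splitSpace Δ K J [⋀^Fin p]→ₗ[ℝ] E) →ₗ[ℂ] E'}
    (hΛ : ∀ f f', (∀ p, f p =ᶠ[germFilter Δ K J] f' p) → Λ f = Λ f')
    {Ψ : splitSpace Δ ∅ J → ∀ m : ℕ, splitSpace Δ ∅ J [⋀^Fin m]→ₗ[ℝ] E} {b : splitSpace Δ K J}
    {n : ℕ} {r : Fin n → ℂ}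
    {c : Fin n → splitSpace Δ K J → ∀ m : ℕ, splitSpace Δ ∅ J [⋀^Fin m]→ₗ[ℝ] E}
    {y : splitSpace Δ ∅ K}
    (hrep : ∀ x ∈ cone Δ K J b, Ψ ((splitEquiv Δ h).symm (y, x)) = ∑ l, r l • c l x) :
    (sliceForm (splitEquiv Δ h) Λ fun x => Ψ ((splitEquiv Δ h).symm (y, x))) =
      ∑ l, r l • sliceForm (splitEquiv Δ h) Λ (c l) := by
  have h1 : (fun x => Ψ ((splitEquiv Δ h).symm (y, x))) =ᶠ[germFilter Δ K J]
      ∑ l, r l • c l := by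
    filter_upwards [cone_mem Δ h b] with x hx
    rw [hrep x hx]
    simp only [Finset.sum_apply, Pi.smul_apply]
  rw [sliceForm_congr _ hΛ h1, map_sum]
  simp only [map_smul]

/-- A local product representation gives finitely many fixed forms with coefficients smooth in `y`.
-/
theorem smoothFn_sliceForm (h : K ⊆ J) {T : ℝ}
    {Λ : (∀ p : ℕ, splitSpace Δ K J → splitSpace Δ K J [⋀^Fin p]→ₗ[ℝ] E) →ₗ[ℂ] E'}
    (hΛ : ∀ f f', (∀ p, f p =ᶠ[germFilter Δ K J] f' p) → Λ f = Λ f')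
    {Ψ : splitSpace Δ ∅ J → ∀ m : ℕ, splitSpace Δ ∅ J [⋀^Fin m]→ₗ[ℝ] E}
    (hs : ∀ H ∈ region Δ J T, SmoothFn Ψ H) {z : splitSpace Δ ∅ K} (hz : z ∈ region Δ K T)
    (hd : DecAt (splitEquiv Δ h) (germFilter Δ K J) Ψ z) :
    SmoothFn (fun y => sliceForm (splitEquiv Δ h) Λ fun x => Ψ ((splitEquiv Δ h).symm (y, x))) z := by
  obtain ⟨b, O, hO, hzO, -, -, n, β, c, hβ, hc, hrep⟩ := exists_localRep h hs hz hd
  refine SmoothFn.congr (F := fun y => ∑ l, β l y • sliceForm (splitEquiv Δ h) Λ (c l))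
    (SmoothFn.sum fun l _ => (SmoothFn.const _ _).smul (hβ l z hzO)) ?_
  filter_upwards [hO.mem_nhds hzO] with y hy
  exact (sliceForm_rep h hΛ (hrep y hy)).symm

open Classical in
-- In a local representation the coefficients depend on `y`, but the functions of `x` still take
-- values in forms on the whole space. Evaluating their stratum arguments at a finite dual system of
-- tuples splits them further: the values are the transverse factors, and the dual forms times the
-- coefficients are the factors on the stratum.
theorem isRestriction_sliceForm (h : K ⊆ J) {T : ℝ}
    {Λ : (∀ p : ℕ, splitSpace Δ K J → splitSpace Δ K J [⋀^Fin p]→ₗ[ℝ] E) →ₗ[ℂ]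
      ∀ p, smoothGerm Δ K J E p}
    (hΛ : ∀ f f', (∀ p, f p =ᶠ[germFilter Δ K J] f' p) → Λ f = Λ f')
    (hΛ' : ∀ f (g : ∀ p, smoothGerm Δ K J E p), (∀ p, (g p).1 = Germ.ofFun (f p)) → Λ f = g)
    {Ψ : splitSpace Δ ∅ J → ∀ m : ℕ, splitSpace Δ ∅ J [⋀^Fin m]→ₗ[ℝ] E}
    (hs : ∀ H ∈ region Δ J T, SmoothFn Ψ H)
    (hd : ∀ z ∈ region Δ K T, DecAt (splitEquiv Δ h) (germFilter Δ K J) Ψ z) :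
    IsRestriction Δ K J E (corner ι T) (fun m H => Ψ H m)
      (fun q y => sliceForm (splitEquiv Δ h) Λ (fun x => Ψ ((splitEquiv Δ h).symm (y, x))) q) := by
  intro z hz
  replace hz : z ∈ region Δ K T := (orbitPt_mem_corner Δ).1 hz
  obtain ⟨b, O, hO, hzO, hOc, hreg, n, β, c, hβ, hc, hrep⟩ := exists_localRep h hs hz (hd z hz)
  obtain ⟨σ, _, d, v, ε, hev⟩ := exists_graded_evaluations (splitSpace Δ ∅ K)
  let e := splitEquiv Δ h
  let α : Fin n × σ → Form (splitSpace Δ K J) E := fun i p x => leftForm e (v i.2) (c i.1 x (p + d i.2))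
  let β' : Fin n × σ → Form (splitSpace Δ ∅ K) ℂ := fun i q y => β i.1 y •
    (Pi.single (d i.2) (ε i.2) : ∀ q, splitSpace Δ ∅ K [⋀^Fin q]→ₗ[ℝ] ℂ) q
  have hα : ∀ i p, ∀ x ∈ cone Δ K J b, SmoothFormAt (α i p) x := fun i p x hx =>
    smoothFormAt_iff.2 ((hc i.1 x hx).map
      ((leftForm e (v i.2)).comp (LinearMap.proj (p + d i.2))))
  let g : Fin n × σ → ∀ p, smoothGerm Δ K J E p := fun i p => ⟨Germ.ofFun (α i p), α i p, rfl, by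
    filter_upwards [cone_mem Δ h b] with x hx using hα i p x hx⟩
  have hg : ∀ i, Λ (α i) = g i := fun i => hΛ' _ _ fun p => rfl
  let τ := (Fintype.equivFin (Fin n × σ)).symm
  have hsnd : proj (splitSpace Δ ∅ J) (splitSpace Δ K J) = sndMap e := LinearMap.ext fun _ => rfl
  have hfst : proj (splitSpace Δ ∅ J) (splitSpace Δ ∅ K) = fstMap e := LinearMap.ext fun _ => rfl
  refine ⟨b, O, hO, hzO, hOc, _, fun i => α (τ i), fun i => β' (τ i), fun i => g (τ i),
    fun i p x hx => hα _ p x hx, fun i q y hy => ?_, fun i p => rfl, fun H hH1 hH2 => ?_,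
    fun q y hy => ?_⟩
  · exact smoothFormAt_iff.2 ((SmoothFn.const _ _).smul (hβ _ y hy))
  · have hH : H = e.symm (proj _ _ H, proj _ _ H) := (e.symm_apply_apply H).symm
    refine ⟨(orbitPt_mem_corner Δ).2 (by rw [hH]; exact hreg _ hH2 _ hH1), fun m => ?_⟩
    have hΨ : Ψ H = ∑ l, β l (proj _ _ H) • c l (proj _ _ H) := by
      conv_lhs => rw [hH]
      exact hrep _ hH2 _ hH1
    rw [τ.sum_comp fun i => wedgeTot (fun p => (α i p (proj _ _ H)).compLinearMap
      (proj _ (splitSpace Δ K J))) (fun q => (β' i q (proj _ _ H)).compLinearMap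
        (proj _ (splitSpace Δ ∅ K))) m]
    refine congrFun (ext_splitEval e (η := Ψ H) (η' := fun m => ∑ i, wedgeTot
      (fun p => (α i p (proj _ _ H)).compLinearMap (proj _ (splitSpace Δ K J)))
      (fun q => (β' i q (proj _ _ H)).compLinearMap (proj _ (splitSpace Δ ∅ K))) m) ?_) m
    intro p q u w
    have h1 : ∀ i, splitEval e (wedgeTot (fun p => (α i p (proj _ _ H)).compLinearMap
        (proj _ (splitSpace Δ K J))) (fun q => (β' i q (proj _ _ H)).compLinearMap
        (proj _ (splitSpace Δ ∅ K))) (p + q)) u w = β' i q (proj _ _ H) w • α i p (proj _ _ H) u := by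
      intro i
      simp only [hsnd, hfst]
      exact wedgeTot_splitEval e _ _ u w
    refine Eq.trans ?_ ((altForm_sum_apply _ _ _).trans (Finset.sum_congr rfl fun i _ => h1 i)).symm
    rw [splitEval, hΨ, Fintype.sum_prod_type]
    simp only [Finset.sum_apply, altForm_sum_apply]
    refine Finset.sum_congr rfl fun l _ => ?_
    have h2 := congrArg (fun a => a w) (hev E (fun q => rightForm e u (c l (proj _ _ H) (p + q))) q)
    simp only [altForm_sum_apply, coeffTensor_apply] at h2
    change β l (proj _ _ H) • rightForm e u (c l (proj _ _ H) (p + q)) w = _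
    rw [h2, Finset.smul_sum]
    refine Finset.sum_congr rfl fun s _ => ?_
    rw [smul_smul]
    rfl
  · change sliceForm (splitEquiv Δ h) Λ (fun x => Ψ ((splitEquiv Δ h).symm (y, x))) q = _
    rw [τ.sum_comp fun i => coeffTensor (g i) (β' i q y), sliceForm_rep h hΛ (hrep y hy),
      Fintype.sum_prod_type, Finset.sum_apply]
    refine Finset.sum_congr rfl fun l _ => ?_
    rw [Pi.smul_apply, hev _ (sliceForm (splitEquiv Δ h) Λ (c l)) q, Finset.smul_sum]
    refine Finset.sum_congr rfl fun s _ => ?_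
    rw [← hg, ← coeffTensor_smul]
    rfl

end Germs
end SplitForms

namespace SplitForms

/-! ### Quasi-special germs are the germs decomposable near all strata -/

section Criterion
variable {V : Type u} [NormedAddCommGroup V] [InnerProductSpace ℝ V] [FiniteDimensional ℝ V]
  {ι : Type*} [Fintype ι] {Δ : Basis ι ℝ V} {K J : Finset ι}

/-- Smooth forms that are decomposable near all smaller strata are quasi-special. -/
theorem isQuasiSpecial_of_decAt {T : ℝ} (J : Finset ι) : ∀ (E : Type u) [AddCommGroup E] [Module ℂ E]
    (Ψ : splitSpace Δ ∅ J → ∀ m : ℕ, splitSpace Δ ∅ J [⋀^Fin m]→ₗ[ℝ] E),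
    (∀ H ∈ region Δ J T, SmoothFn Ψ H) →
    (∀ K (h : K ⊂ J), ∀ z ∈ region Δ K T,
      DecAt (splitEquiv Δ h.subset) (germFilter Δ K J) Ψ z) →
    IsQuasiSpecial Δ J E (corner ι T) (fun m H => Ψ H m) := by
  induction J using Finset.strongInduction with
  | H J ih =>
    intro E _ _ Ψ hs hd
    rw [IsQuasiSpecial]
    refine ⟨fun k H hH => smoothFormAt_iff.2
      ((hs H ((orbitPt_mem_corner Δ).1 hH)).map (LinearMap.proj k)), fun K hK => ?_⟩
    obtain ⟨Λ, h1, h2⟩ := exists_germ_section Δ K J E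
    refine ⟨_, isRestriction_sliceForm hK.subset h1 h2 hs (hd K hK), ?_⟩
    exact ih K hK _ (fun y => sliceForm (splitEquiv Δ hK.subset) Λ
        fun x => Ψ ((splitEquiv Δ hK.subset).symm (y, x)))
      (fun z hz => smoothFn_sliceForm hK.subset h1 hs hz (hd K hK z hz))
      fun K' hK' z hz => decAt_sliceForm hK'.subset hK.subset h1 (hd K' (hK'.trans hK) z hz)

variable {E : Type u} [AddCommGroup E] [Module ℂ E] {k : ℕ}

/-- Expanding the forms on the stratum in a finite dual system moves their dependence on `y` into
scalars; the slices are then combinations of the fixed products of the transverse forms with the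
dual forms. -/
theorem decAt_of_isRestriction (h : K ⊆ J) {U : Set (Corner ι)} {ψ : Form (splitSpace Δ ∅ J) E}
    {Θ : Form (splitSpace Δ ∅ K) (∀ p, smoothGerm Δ K J E p)} (hr : IsRestriction Δ K J E U ψ Θ)
    {z : splitSpace Δ ∅ K} (hz : orbitPt Δ K (z : V) ∈ U) :
    DecAt (splitEquiv Δ h) (germFilter Δ K J) (fun H m => ψ m H) z := by
  obtain ⟨b, O, hO, hzO, -, n, α, β, g, -, -, -, hrep, -⟩ := hr z hz
  obtain ⟨σ, _, d, v, ε, hev⟩ := exists_graded_evaluations (splitSpace Δ ∅ K)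
  let e := splitEquiv Δ h
  let τ := (Fintype.equivFin (Fin n × σ)).symm
  let c : Fin n × σ → splitSpace Δ K J → ∀ m : ℕ, splitSpace Δ ∅ J [⋀^Fin m]→ₗ[ℝ] E :=
    fun i x m => wedgeTot (fun p => (α i.1 p x).compLinearMap (sndMap e))
      (fun q => ((Pi.single (d i.2) (ε i.2) : ∀ q, splitSpace Δ ∅ K [⋀^Fin q]→ₗ[ℝ] ℂ) q).compLinearMap
        (fstMap e)) m
  refine DecAt.of_rep (β := fun l y => β (τ l).1 (d (τ l).2) y (v (τ l).2)) (c := fun l => c (τ l))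
    ⟨cone Δ K J b, cone_mem Δ h b, ?_⟩
  filter_upwards [hO.mem_nhds hzO] with y hy x hx
  rw [τ.sum_comp fun i => β i.1 (d i.2) y (v i.2) • c i x, Fintype.sum_prod_type]
  have hp := e.apply_symm_apply (y, x)
  have h1 : proj (splitSpace Δ ∅ J) (splitSpace Δ ∅ K) (e.symm (y, x)) = y := congrArg Prod.fst hp
  have h2 : proj (splitSpace Δ ∅ J) (splitSpace Δ K J) (e.symm (y, x)) = x := congrArg Prod.snd hp
  have hr := (hrep (e.symm (y, x)) (by rw [h2]; exact hx) (by rw [h1]; exact hy)).2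
  rw [h1, h2] at hr
  refine ext_splitEval e fun p q u w => ?_
  change splitEval e (ψ (p + q) (e.symm (y, x))) u w = _
  rw [hr]
  refine (altForm_sum_apply _ _ _).trans ?_
  have h5 : ∀ i, wedgeTot
      (fun p => (α i p x).compLinearMap (proj (splitSpace Δ ∅ J) (splitSpace Δ K J)))
      (fun q => (β i q y).compLinearMap (proj (splitSpace Δ ∅ J) (splitSpace Δ ∅ K))) (p + q)
        (splitTuple e u w ∘ finSumFinEquiv.symm) = β i q y w • α i p x u := fun i =>
    wedgeTot_splitEval e (fun p => α i p x) (fun q => β i q y) u w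
  refine Eq.trans (Finset.sum_congr rfl fun i _ => h5 i) ?_
  simp only [splitEval, Finset.sum_apply, altForm_sum_apply]
  refine Finset.sum_congr rfl fun i _ => ?_
  have h3 : β i q y w = ∑ s, (Pi.single (d s) (ε s) : ∀ q, splitSpace Δ ∅ K [⋀^Fin q]→ₗ[ℝ] ℂ) q w •
      β i (d s) y (v s) := by
    conv_lhs => rw [hev ℂ (fun q => β i q y) q]
    exact altForm_sum_apply _ _ _
  rw [h3, Finset.sum_smul]
  refine Finset.sum_congr rfl fun s _ => ?_
  have h4 : splitEval e (c (i, s) x (p + q)) u w =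
      (Pi.single (d s) (ε s) : ∀ q, splitSpace Δ ∅ K [⋀^Fin q]→ₗ[ℝ] ℂ) q w • α i p x u :=
    wedgeTot_splitEval e _ _ u w
  change _ = β i (d s) y (v s) • splitEval e (c (i, s) x (p + q)) u w
  rw [h4, smul_smul, smul_eq_mul, mul_comm]

theorem decAt_of_subsingleton {W Y Z X : Type*} [NormedAddCommGroup W] [NormedSpace ℝ W]
    [FiniteDimensional ℝ W] [NormedAddCommGroup Y] [NormedSpace ℝ Y] [FiniteDimensional ℝ Y]
    [NormedAddCommGroup Z] [NormedSpace ℝ Z] [FiniteDimensional ℝ Z] [Subsingleton Z]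
    [AddCommGroup X] [Module ℂ X] {e : W ≃ₗ[ℝ] Y × Z} {D : Filter Z} {F : W → X} {y : Y}
    (h : SmoothFn F (e.symm (y, 0))) : DecAt e D F y := by
  obtain ⟨⟨G, hG, hF⟩, -⟩ := h
  have hc : Continuous fun y => e.symm (y, (0 : Z)) :=
    (LinearMap.continuous_of_finiteDimensional (e.symm : Y × Z →ₗ[ℝ] W)).comp (by fun_prop)
  refine ⟨G.map (LinearMap.pi fun _ : Z => LinearMap.id), inferInstance, Set.univ, univ_mem, ?_⟩
  filter_upwards [hc.continuousAt.eventually hF] with y hy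
  exact ⟨_, Submodule.mem_map_of_mem hy, fun x _ => by rw [Subsingleton.elim x 0]; rfl⟩

/-- For the open stratum the transverse space is zero, so the slices are single values, which
locally span a finite-dimensional space by smoothness. -/
theorem DecNear.univ_of_smoothNear {X : Type*} [AddCommGroup X] [Module ℂ X]
    {F : splitSpace Δ ∅ Finset.univ → X} (h : SmoothNear Δ F) : DecNear Δ Finset.univ F := by
  obtain ⟨T, hT⟩ := h
  have : Subsingleton (splitSpace Δ Finset.univ Finset.univ) := by
    refine ⟨fun x x' => ?_⟩
    have h0 : ∀ x : splitSpace Δ Finset.univ Finset.univ, (x : V) = 0 := fun x =>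
      (Submodule.mem_bot ℝ).1 ((Submodule.inf_orthogonal_eq_bot _).le x.2)
    exact Subtype.ext ((h0 x).trans (h0 x').symm)
  refine ⟨T, fun z hz => decAt_of_subsingleton (hT _ fun i hi => ?_)⟩
  rw [inner_root_symm_of_mem Δ _ hi]
  exact hz i hi

open Classical in
/-- A germ is quasi-special if and only if it is decomposable near all strata. -/
theorem isQuasiSpecialGerm_iff {g : smoothGerm Δ ∅ Finset.univ E k} :
    IsQuasiSpecialGerm Δ E k g ↔ ∀ L, DecGerm L g := by
  constructor
  · rintro ⟨U, hU, hUo, f, hf, hq⟩ L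
    refine ⟨f, hf, ?_⟩
    by_cases hL : L = Finset.univ
    · subst hL
      exact DecNear.univ_of_smoothNear (smoothNear_of_germ hf)
    rw [IsQuasiSpecial] at hq
    obtain ⟨Θ, hΘ, -⟩ := hq.2 L (Finset.ssubset_univ_iff.2 hL)
    obtain ⟨T, hT⟩ := exists_corner_subset Δ hU hUo
    refine ⟨T, fun z hz => ?_⟩
    have h1 := (decAt_of_isRestriction (Finset.subset_univ L) hΘ
      (hT ((orbitPt_mem_corner Δ).2 hz))).map (LinearMap.proj k)
    simpa using h1
  · intro h
    obtain ⟨f, hf, T, hT⟩ := exists_germ_rep g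
    -- The representatives may differ from stratum to stratum but have the same germ at the corner,
    -- so one smooth representative serves all of them, with a common bound since there are finitely
    -- many strata.
    have h1 : ∀ L, DecNear Δ L f := fun L => by
      obtain ⟨f', hf', hd⟩ := h L
      exact hd.congr (Germ.coe_eq.1 (hf'.symm.trans hf))
    choose T' hT' using h1
    obtain ⟨M, hM⟩ := (Set.finite_range T').bddAbove
    refine ⟨corner ι (max T M), isOpen_corner _, orbitPt_empty_mem_corner Δ _, f, hf, ?_⟩
    let S := LinearMap.single ℂ (fun m => splitSpace Δ ∅ Finset.univ [⋀^Fin m]→ₗ[ℝ] E) k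
    have h2 : (Pi.single k f : Form (splitSpace Δ ∅ Finset.univ) E) = fun m H => S (f H) m := by
      funext m H
      by_cases hm : m = k
      · subst hm; simp [S]
      · simp [S, hm]
    rw [h2]
    exact isQuasiSpecial_of_decAt Finset.univ E (fun H => S (f H))
      (fun H hH => (hT H (region_anti Δ (le_max_left _ _) hH)).map S)
      fun K _ z hz => (hT' K z (region_anti Δ ((hM ⟨K, rfl⟩).trans (le_max_right _ _)) hz)).map S

end Criterion
end SplitForms

namespace SplitForms

/-! ### Square-mean bounds for averages of translates -/

section Continuity
variable {W : Type*} [NormedAddCommGroup W] [NormedSpace ℝ W] {E : Type*} [NormedAddCommGroup E]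
  [NormedSpace ℂ E] [FiniteDimensional ℂ E] {F : W → E} {H : W}

theorem SmoothFn.continuousAt (h : SmoothFn F H) : ContinuousAt F H := by
  let b := Module.finBasis ℂ E
  have h1 : F = fun y => ∑ i, b.coord i (F y) • b i := funext fun y => (b.sum_repr (F y)).symm
  rw [h1]
  exact tendsto_finsetSum _ fun i _ => ((h.2 (b.coord i)).continuousAt.tendsto.smul_const (b i))

theorem SegSmooth.continuousOn_segment {w : W} {a b : ℝ} (h : SegSmooth w a b F H) :
    ContinuousOn (fun s : ℝ => F (H + s • w)) (Set.uIcc a b) := fun s hs =>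
  ((h.self_of_nhds s hs).continuousAt.comp (f := fun s : ℝ => H + s • w) (by fun_prop)).continuousWithinAt

/-- For finite-dimensional coefficients functionals are continuous, so the weak integral is a
genuine one and norms can be taken inside. -/
theorem smear_eq_integral {w : W} {u : W →L[ℝ] ℝ} {a b : ℝ} {κ : ℝ × ℝ → ℝ}
    (h : SegSmooth w a b F H) (hκ : Continuous κ) :
    smear w u κ a b F H = ∫ s in a..b, (κ (u H, s) : ℂ) • F (H + s • w) := by
  have : CompleteSpace E := FiniteDimensional.complete ℂ E
  have hi : IntervalIntegrable (fun s => (κ (u H, s) : ℂ) • F (H + s • w)) volume a b :=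
    ContinuousOn.intervalIntegrable (ContinuousOn.smul (by fun_prop) h.continuousOn_segment)
  refine weakElt_eq fun φ => ?_
  have h1 := (LinearMap.toContinuousLinearMap φ).intervalIntegral_comp_comm hi
  refine h1.symm.trans (intervalIntegral.integral_congr fun s _ => ?_)
  simp

end Continuity

section SmearBound
variable {W : Type*} [NormedAddCommGroup W] [NormedSpace ℝ W] [FiniteDimensional ℝ W]
  [MeasurableSpace W] [BorelSpace W] {μ : Measure W} [μ.IsAddHaarMeasure]

/-- The Cauchy-Schwarz inequality against the constant function `1`. -/
theorem sq_lintegral_le {a b : ℝ} {g : ℝ → ℝ≥0∞} (hg : Measurable g) :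
    (∫⁻ s in Set.Ioc a b, g s) ^ 2 ≤ ENNReal.ofReal (b - a) * ∫⁻ s in Set.Ioc a b, g s ^ 2 := by
  have h1 := ENNReal.lintegral_mul_le_Lp_mul_Lq (volume.restrict (Set.Ioc a b))
    (Real.HolderConjugate.two_two) hg.aemeasurable (aemeasurable_const (b := (1 : ℝ≥0∞)))
  simp only [Pi.mul_apply, mul_one, ENNReal.one_rpow, lintegral_const, Measure.restrict_apply_univ,
    Real.volume_Ioc, one_mul] at h1
  have h2 := pow_le_pow_left' h1 2
  refine h2.trans (le_of_eq ?_)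
  rw [mul_pow, ← ENNReal.rpow_natCast, ← ENNReal.rpow_natCast, ← ENNReal.rpow_mul,
    ← ENNReal.rpow_mul]
  simp [mul_comm]

/-- Averages of translates are bounded in square mean. -/
theorem lintegral_sq_average_le {g : W → ℝ≥0∞} (hg : Measurable g) (w : W) (a b : ℝ) :
    ∫⁻ H, (∫⁻ s in Set.Ioc a b, g (H + s • w)) ^ 2 ∂μ ≤
      ENNReal.ofReal (b - a) ^ 2 * ∫⁻ H, g H ^ 2 ∂μ := by
  have hm : Measurable fun p : W × ℝ => g (p.1 + p.2 • w) := hg.comp (by fun_prop)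
  have hm' : ∀ H, Measurable fun s : ℝ => g (H + s • w) := fun H => hg.comp (by fun_prop)
  -- Cauchy-Schwarz in `s`, then Tonelli, then translation invariance of the measure.
  calc ∫⁻ H, (∫⁻ s in Set.Ioc a b, g (H + s • w)) ^ 2 ∂μ
      ≤ ∫⁻ H, ENNReal.ofReal (b - a) * (∫⁻ s in Set.Ioc a b, g (H + s • w) ^ 2) ∂μ :=
        lintegral_mono fun H => sq_lintegral_le (hm' H)
    _ = ENNReal.ofReal (b - a) * ∫⁻ H, (∫⁻ s in Set.Ioc a b, g (H + s • w) ^ 2) ∂μ :=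
        lintegral_const_mul' _ _ ENNReal.ofReal_ne_top
    _ = ENNReal.ofReal (b - a) * ∫⁻ s in Set.Ioc a b, (∫⁻ H, g (H + s • w) ^ 2 ∂μ) := by
        rw [lintegral_lintegral_swap]
        exact (hm.pow_const 2).aemeasurable
    _ = ENNReal.ofReal (b - a) * ∫⁻ s in Set.Ioc a b, (∫⁻ H, g H ^ 2 ∂μ) := by
        congr 1
        refine lintegral_congr fun s => ?_
        exact lintegral_add_right_eq_self (fun H => g H ^ 2) (s • w)
    _ = _ := by
        rw [lintegral_const, Measure.restrict_apply_univ, Real.volume_Ioc]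
        ring

variable {E : Type*} [NormedAddCommGroup E] [NormedSpace ℂ E] [FiniteDimensional ℂ E]

theorem memLp_two_iff {α : Type*} [MeasurableSpace α] {ν : Measure α} {f : α → E}
    (hf : AEStronglyMeasurable f ν) : MemLp f 2 ν ↔ ∫⁻ x, ‖f x‖ₑ ^ 2 ∂ν < ⊤ := by
  rw [MemLp, and_iff_right hf, eLpNorm_lt_top_iff_lintegral_rpow_enorm_lt_top (by simp) (by simp)]
  simp

theorem continuousOn_twist {τ : W → E →L[ℂ] E} (hτ : Continuous τ) {O : Set W} {F : W → E}
    (hF : ∀ H ∈ O, SmoothFn F H) : ContinuousOn (fun H => τ H (F H)) O :=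
  hτ.continuousOn.clm_apply fun H hH => (hF H hH).continuousAt.continuousWithinAt

open Classical in
-- The hypothesis on `τ` says that a translation within the window changes the norm by a bounded
-- factor. With the bound on the kernel, the pointwise norm of the smear is dominated by an average
-- of translated norms.
theorem memLp_smear {τ : W → E →L[ℂ] E} (hτ : Continuous τ) {w : W} {u : W →L[ℝ] ℝ} {a b : ℝ}
    (hab : a ≤ b) {C B : ℝ} (hC : ∀ H, ∀ s ∈ Set.uIcc a b, ∀ e, ‖τ H e‖ ≤ C * ‖τ (H + s • w) e‖)
    {κ : ℝ × ℝ → ℝ} (hκ : ContDiff ℝ ∞ κ) (hB : ∀ t, ∀ s ∈ Set.uIcc a b, ‖κ (t, s)‖ ≤ B)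
    {O O' : Set W} (hO : IsOpen O) (hO' : IsOpen O')
    (hsub : ∀ H ∈ O', ∀ s ∈ Set.uIcc a b, H + s • w ∈ O) {F : W → E} (hF : ∀ H ∈ O, SmoothFn F H)
    (h : MemLp (fun H => τ H (F H)) 2 (μ.restrict O)) :
    MemLp (fun H => τ H (smear w u κ a b F H)) 2 (μ.restrict O') := by
  have hseg : ∀ H ∈ O', SegSmooth w a b F H := fun H hH => by
    filter_upwards [hO'.mem_nhds hH] with H' hH' s hs using hF _ (hsub H' hH' s hs)
  have hm : AEStronglyMeasurable (fun H => τ H (smear w u κ a b F H)) (μ.restrict O') :=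
    (continuousOn_twist hτ fun H hH => smoothFn_smear (hseg H hH) hκ).aestronglyMeasurable
      hO'.measurableSet
  have hcont := continuousOn_twist hτ hF
  rw [memLp_two_iff h.1] at h
  rw [memLp_two_iff hm]
  -- Extension by zero, so that the estimate over all of `W`, with its translation invariance,
  -- applies although `F` is controlled only on `O`.
  let g : W → ℝ≥0∞ := O.piecewise (fun H => ‖τ H (F H)‖ₑ) 0
  have hg : Measurable g := hcont.enorm.measurable_piecewise continuousOn_const hO.measurableSet
  have hgO : ∀ H ∈ O, g H = ‖τ H (F H)‖ₑ := fun H hH => Set.piecewise_eq_of_mem _ _ _ hH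
  have hg2 : ∫⁻ H, g H ^ 2 ∂μ = ∫⁻ H in O, ‖τ H (F H)‖ₑ ^ 2 ∂μ := by
    rw [← lintegral_indicator hO.measurableSet]
    refine lintegral_congr fun H => ?_
    by_cases hH : H ∈ O
    · rw [hgO H hH, Set.indicator_of_mem hH]
    · rw [Set.indicator_of_notMem hH]
      simp [g, hH]
  have : CompleteSpace E := FiniteDimensional.complete ℂ E
  have hbound : ∀ H ∈ O', ‖τ H (smear w u κ a b F H)‖ₑ ≤
      ENNReal.ofReal (B * C) * ∫⁻ s in Set.Ioc a b, g (H + s • w) := by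
    intro H hH
    have hi : IntervalIntegrable (fun s => (κ (u H, s) : ℂ) • F (H + s • w)) volume a b :=
      ContinuousOn.intervalIntegrable
        (ContinuousOn.smul (by have := hκ.continuous; fun_prop) (hseg H hH).continuousOn_segment)
    rw [smear_eq_integral (hseg H hH) hκ.continuous, intervalIntegral.integral_of_le hab,
      ← (τ H).integral_comp_comm hi.1, ← lintegral_const_mul' _ _ ENNReal.ofReal_ne_top]
    refine (enorm_integral_le_lintegral_enorm _).trans ?_
    refine setLIntegral_mono' measurableSet_Ioc fun s hs => ?_
    have hs' : s ∈ Set.uIcc a b := by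
      rw [Set.uIcc_of_le hab]; exact Set.Ioc_subset_Icc_self hs
    rw [hgO _ (hsub H hH s hs'), ← ofReal_norm, ← ofReal_norm,
      ← ENNReal.ofReal_mul' (norm_nonneg _)]
    refine ENNReal.ofReal_le_ofReal ?_
    rw [map_smul, norm_smul, Complex.norm_real, mul_assoc]
    exact mul_le_mul (hB _ s hs') (hC H s hs' _) (norm_nonneg _)
      ((norm_nonneg _).trans (hB 0 s hs'))
  calc ∫⁻ H in O', ‖τ H (smear w u κ a b F H)‖ₑ ^ 2 ∂μ
      ≤ ∫⁻ H in O', ENNReal.ofReal (B * C) ^ 2 *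
          (∫⁻ s in Set.Ioc a b, g (H + s • w)) ^ 2 ∂μ :=
        setLIntegral_mono' hO'.measurableSet fun H hH => by
          rw [← mul_pow]; exact pow_le_pow_left' (hbound H hH) 2
    _ ≤ ∫⁻ H, ENNReal.ofReal (B * C) ^ 2 * (∫⁻ s in Set.Ioc a b, g (H + s • w)) ^ 2 ∂μ :=
        setLIntegral_le_lintegral _ _
    _ = ENNReal.ofReal (B * C) ^ 2 * ∫⁻ H, (∫⁻ s in Set.Ioc a b, g (H + s • w)) ^ 2 ∂μ :=
        lintegral_const_mul' _ _ (by simp)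
    _ ≤ ENNReal.ofReal (B * C) ^ 2 * (ENNReal.ofReal (b - a) ^ 2 * ∫⁻ H, g H ^ 2 ∂μ) := by
        gcongr
        exact lintegral_sq_average_le hg w a b
    _ < ⊤ := by
        rw [hg2]
        exact ENNReal.mul_lt_top (by simp) (ENNReal.mul_lt_top (by simp) h)

end SmearBound
end SplitForms

namespace SplitForms

/-! ### Square-integrable functions near the corner -/

section SquareIntegrable
variable {V : Type u} [NormedAddCommGroup V] [InnerProductSpace ℝ V] [FiniteDimensional ℝ V]
  [MeasurableSpace V] [BorelSpace V] {ι : Type*} [Fintype ι] (Δ : Basis ι ℝ V)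
  {E : Type u} [NormedAddCommGroup E] [InnerProductSpace ℂ E] [FiniteDimensional ℂ E]
  (σ : Multiplicative V →* (E →L[ℂ] E)) (ρ : V →ₗ[ℝ] ℝ)

/-- The operator carrying the fiber metric at `exp H`, multiplied by the weight, to the norm of
`E`. -/
noncomputable def twist (H : V) : E →L[ℂ] E :=
  (Real.exp (-ρ H) : ℂ) • σ (Multiplicative.ofAdd (-H))

theorem twist_apply (H : V) (e : E) :
    twist σ ρ H e = (Real.exp (-ρ H) : ℂ) • σ (Multiplicative.ofAdd (-H)) e := rfl

theorem twist_add (H H' : V) (e : E) : twist σ ρ (H + H') e = twist σ ρ H (twist σ ρ H' e) := by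
  simp only [twist_apply, map_add, map_smul, neg_add, ofAdd_add, map_mul, Real.exp_add,
    Complex.ofReal_mul, smul_smul, mul_comm]
  rfl

variable {σ} in
theorem continuous_twist (hσ : Continuous σ) : Continuous (twist σ ρ) := by
  have h1 : Continuous ρ := ρ.continuous_of_finiteDimensional
  have h2 : Continuous fun H : V => σ (Multiplicative.ofAdd (-H)) :=
    hσ.comp (continuous_ofAdd.comp continuous_neg)
  exact (Complex.continuous_ofReal.comp (Real.continuous_exp.comp h1.neg)).smul h2

variable {σ} in
-- The twist is multiplicative, so the values at `H` and at `H + s • w` differ by the twist at `-(s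
-- • w)`, which is bounded on the compact interval independently of `H`.
theorem exists_twist_bound (hσ : Continuous σ) (w : V) (a b : ℝ) :
    ∃ C, ∀ H, ∀ s ∈ Set.uIcc a b, ∀ e, ‖twist σ ρ H e‖ ≤ C * ‖twist σ ρ (H + s • w) e‖ := by
  have h1 : Continuous fun s : ℝ => twist σ ρ (-(s • w)) :=
    (continuous_twist ρ hσ).comp (by fun_prop)
  obtain ⟨C, hC⟩ := (isCompact_uIcc (a := a) (b := b)).exists_bound_of_continuousOn h1.continuousOn
  refine ⟨C, fun H s hs e => ?_⟩
  have h2 : twist σ ρ H e = twist σ ρ (-(s • w)) (twist σ ρ (H + s • w) e) := by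
    rw [← twist_add]
    congr 2
    abel
  rw [h2]
  exact (ContinuousLinearMap.le_opNorm _ _).trans
    (mul_le_mul_of_nonneg_right (hC s hs) (norm_nonneg _))

/-- Smooth functions that are square-integrable close to the corner, for the fiber metric and the
weight. -/
def L2Near (F : splitSpace Δ ∅ Finset.univ → E) : Prop :=
  SmoothNear Δ F ∧ ∃ T, MemLp (fun H : splitSpace Δ ∅ Finset.univ => twist σ ρ H (F H)) 2
    (volume.restrict (region Δ Finset.univ T))

variable {Δ σ ρ} {F F' : splitSpace Δ ∅ Finset.univ → E}

theorem MemLp.region_anti {T T' : ℝ} (h : T ≤ T') {G : splitSpace Δ ∅ Finset.univ → E}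
    (hG : MemLp G 2 (volume.restrict (region Δ Finset.univ T))) :
    MemLp G 2 (volume.restrict (region Δ Finset.univ T')) :=
  hG.mono_measure (Measure.restrict_mono_set _ (SplitForms.region_anti Δ h))

theorem L2Near.exists_common (h : L2Near Δ σ ρ F) : ∃ T, (∀ H ∈ region Δ Finset.univ T, SmoothFn F H) ∧
    MemLp (fun H : splitSpace Δ ∅ Finset.univ => twist σ ρ H (F H)) 2
      (volume.restrict (region Δ Finset.univ T)) := by
  obtain ⟨⟨T, hT⟩, T', hT'⟩ := h
  exact ⟨max T T', fun H hH => hT H (SplitForms.region_anti Δ (le_max_left _ _) hH),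
    MemLp.region_anti (le_max_right _ _) hT'⟩

theorem L2Near.congr (h : L2Near Δ σ ρ F) (hF : F =ᶠ[germFilter Δ ∅ Finset.univ] F') :
    L2Near Δ σ ρ F' := by
  refine ⟨h.1.congr hF, ?_⟩
  obtain ⟨T, hT⟩ := h.2
  obtain ⟨T', hT'⟩ := eventually_region_iff.1 hF
  refine ⟨max T T', (memLp_congr_ae ?_).1 (MemLp.region_anti (le_max_left _ _) hT)⟩
  filter_upwards [ae_restrict_mem (isOpen_region Δ _).measurableSet] with H hH
  rw [hT' H (SplitForms.region_anti Δ (le_max_right _ _) hH)]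

theorem L2Near.add (h : L2Near Δ σ ρ F) (h' : L2Near Δ σ ρ F') :
    L2Near Δ σ ρ (fun H => F H + F' H) := by
  obtain ⟨T, h1, h2⟩ := h.exists_common
  obtain ⟨T', h1', h2'⟩ := h'.exists_common
  refine ⟨⟨max T T', fun H hH => (h1 H (SplitForms.region_anti Δ (le_max_left _ _) hH)).add
    (h1' H (SplitForms.region_anti Δ (le_max_right _ _) hH))⟩, max T T', ?_⟩
  simp only [map_add]
  exact (MemLp.region_anti (le_max_left T T') h2).add (MemLp.region_anti (le_max_right T T') h2')

theorem L2Near.zero : L2Near Δ σ ρ (fun _ => 0) :=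
  ⟨⟨0, fun H _ => SmoothFn.zero H⟩, 0, by simp only [map_zero]; exact MemLp.zero⟩

theorem L2Near.sum {α : Type*} {t : Finset α} {f : α → splitSpace Δ ∅ Finset.univ → E}
    (h : ∀ i ∈ t, L2Near Δ σ ρ (f i)) : L2Near Δ σ ρ (fun H => ∑ i ∈ t, f i H) := by
  classical
  induction t using Finset.induction_on with
  | empty => simpa using L2Near.zero
  | insert a s ha ih =>
    simp only [Finset.sum_insert ha]
    exact (h a (by simp)).add (ih fun i hi => h i (by simp [hi]))

theorem L2Near.mul (hσ : Continuous σ) (h : L2Near Δ σ ρ F) {c : splitSpace Δ ∅ Finset.univ → ℂ}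
    (hc : ContDiff ℝ ∞ c) {C : ℝ} (hC : ∀ H, ‖c H‖ ≤ C) : L2Near Δ σ ρ (fun H => c H • F H) := by
  obtain ⟨T, h1, h2⟩ := h.exists_common
  have h3 : ∀ H ∈ region Δ Finset.univ T, SmoothFn (fun H => c H • F H) H := fun H hH =>
    (h1 H hH).smul hc.contDiffAt
  refine ⟨⟨T, h3⟩, T, h2.of_le_mul (c := C) ?_ (.of_forall fun H => ?_)⟩
  · exact (continuousOn_twist ((continuous_twist ρ hσ).comp continuous_subtype_val)
      h3).aestronglyMeasurable (isOpen_region Δ T).measurableSet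
  · rw [map_smul, norm_smul]
    exact mul_le_mul_of_nonneg_right (hC H) (norm_nonneg _)

theorem L2Near.const_smul (hσ : Continuous σ) (h : L2Near Δ σ ρ F) (c : ℂ) :
    L2Near Δ σ ρ (fun H => c • F H) :=
  h.mul hσ contDiff_const fun _ => le_rfl

theorem L2Near.sub (hσ : Continuous σ) (h : L2Near Δ σ ρ F) (h' : L2Near Δ σ ρ F') :
    L2Near Δ σ ρ (fun H => F H - F' H) := by
  simpa [sub_eq_add_neg] using h.add (h'.const_smul hσ (-1))

theorem L2Near.smear (hσ : Continuous σ) (h : L2Near Δ σ ρ F) (i : ι)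
    {u : splitSpace Δ ∅ Finset.univ →L[ℝ] ℝ} {κ : ℝ × ℝ → ℝ} (hκ : ContDiff ℝ ∞ κ) {a b : ℝ}
    (hab : a ≤ b) (ha : -3 ≤ a) (hb : b ≤ 3) {B : ℝ}
    (hB : ∀ t, ∀ s ∈ Set.uIcc a b, ‖κ (t, s)‖ ≤ B) :
    L2Near Δ σ ρ (smear (rootVec Δ i) u κ a b F) := by
  obtain ⟨T, h1, h2⟩ := h.exists_common
  obtain ⟨C, hC⟩ := exists_twist_bound ρ hσ (Δ i) a b
  have hsub : Set.uIcc a b ⊆ Set.uIcc (-3) 3 := by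
    rw [Set.uIcc_of_le hab, Set.uIcc_of_le (by norm_num)]
    exact Set.Icc_subset_Icc ha hb
  refine ⟨⟨T + rootShift Δ, fun H hH => smoothFn_smear
    ((segSmooth_of_region Δ h1 i hH).mono hsub) hκ⟩, T + rootShift Δ, ?_⟩
  let τ : splitSpace Δ ∅ Finset.univ → E →L[ℂ] E := fun H => twist σ ρ (H : V)
  have hτ : Continuous τ := (continuous_twist ρ hσ).comp continuous_subtype_val
  have hC' : ∀ H, ∀ s ∈ Set.uIcc a b, ∀ e, ‖τ H e‖ ≤ C * ‖τ (H + s • rootVec Δ i) e‖ := by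
    intro H s hs e
    have h3 : ((H + s • rootVec Δ i : splitSpace Δ ∅ Finset.univ) : V) = H + s • Δ i := by
      simp [rootVec]
    simp only [τ, h3]
    exact hC H s hs e
  have hreg : ∀ H ∈ region Δ Finset.univ (T + rootShift Δ), ∀ s ∈ Set.uIcc a b,
      H + s • rootVec Δ i ∈ region Δ Finset.univ T := fun H hH s hs =>
    add_smul_mem_region Δ rfl hH (abs_le_four_of_mem (hsub hs))
  exact memLp_smear (μ := volume) hτ hab hC' hκ hB (isOpen_region Δ T) (isOpen_region Δ _) hreg h1 h2

theorem L2Near.smearDiff (hσ : Continuous σ) (h : L2Near Δ σ ρ F) (i : ι)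
    {u : splitSpace Δ ∅ Finset.univ →L[ℝ] ℝ} :
    L2Near Δ σ ρ (smearDiff stair (rootVec Δ i) u F) := by
  obtain ⟨C, hC⟩ := stair_bounded
  refine (h.smear hσ i contDiff_const (by norm_num) le_rfl (by norm_num) (B := 1) (by simp)).sub hσ
    (h.smear hσ i stair.contDiff (by norm_num) le_rfl le_rfl (B := C) fun t s hs => (hC t s ?_).1)
  rwa [Set.uIcc_of_le (by norm_num)] at hs

end SquareIntegrable
end SplitForms

namespace SplitForms

/-! ### Square-integrable forms and stability of their complex under the homotopies -/

section ComponentCalculus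
variable {W : Type*} [NormedAddCommGroup W] [NormedSpace ℝ W] [FiniteDimensional ℝ W]
  {E : Type*} [AddCommGroup E] [Module ℂ E] {k : ℕ}

theorem exists_smoothFn_of_eval (W : Type*) [NormedAddCommGroup W] [NormedSpace ℝ W]
    [FiniteDimensional ℝ W] (k : ℕ) : ∃ (n : ℕ) (v : Fin n → Fin k → W),
    ∀ {E : Type*} [AddCommGroup E] [Module ℂ E] (f : W → W [⋀^Fin k]→ₗ[ℝ] E) (H : W),
      (∀ j, SmoothFn (fun y => f y (v j)) H) → SmoothFn f H := by
  obtain ⟨n, v, ε, h⟩ := exists_form_evaluations W k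
  refine ⟨n, v, fun {E} _ _ f H hf => ?_⟩
  rw [show f = fun y => ∑ j, coeffTensor (f y (v j)) (ε j) from
    funext fun y => eq_sum_coeffTensor h (f y)]
  refine SmoothFn.sum fun j _ => (hf j).map
    { toFun := fun e => coeffTensor e (ε j)
      map_add' := fun e e' => by ext w; exact smul_add _ _ _
      map_smul' := fun c e => by ext w; exact smul_comm _ _ _ }

end ComponentCalculus

section SquareIntegrableForms
variable {V : Type u} [NormedAddCommGroup V] [InnerProductSpace ℝ V] [FiniteDimensional ℝ V]
  [MeasurableSpace V] [BorelSpace V] {ι : Type*} [Fintype ι] (Δ : Basis ι ℝ V)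
  {E : Type u} [NormedAddCommGroup E] [InnerProductSpace ℂ E] [FiniteDimensional ℂ E]
  (σ : Multiplicative V →* (E →L[ℂ] E)) (ρ : V →ₗ[ℝ] ℝ) {k : ℕ}

/-- Forms all of whose components are smooth and square-integrable close to the corner. -/
def L2Form (f : splitSpace Δ ∅ Finset.univ → splitSpace Δ ∅ Finset.univ [⋀^Fin k]→ₗ[ℝ] E) : Prop :=
  ∀ v, L2Near Δ σ ρ fun H => f H v

variable {Δ σ ρ}
variable {f f' : splitSpace Δ ∅ Finset.univ → splitSpace Δ ∅ Finset.univ [⋀^Fin k]→ₗ[ℝ] E}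

theorem L2Form.smoothNear (h : L2Form Δ σ ρ f) : SmoothNear Δ f := by
  obtain ⟨n, v, hv⟩ := exists_smoothFn_of_eval (splitSpace Δ ∅ Finset.univ) k
  rw [smoothNear_iff]
  filter_upwards [eventually_all.2 fun j => smoothNear_iff.1 (h (v j)).1] with H hH
  exact hv f H hH

theorem L2Form.congr (h : L2Form Δ σ ρ f) (hf : f =ᶠ[germFilter Δ ∅ Finset.univ] f') :
    L2Form Δ σ ρ f' := fun v => (h v).congr (hf.mono fun H hH => by simp only [hH])

theorem L2Form.sub (hσ : Continuous σ) (h : L2Form Δ σ ρ f) (h' : L2Form Δ σ ρ f') :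
    L2Form Δ σ ρ (fun H => f H - f' H) := fun v => (h v).sub hσ (h' v)

theorem L2Form.mul (hσ : Continuous σ) (h : L2Form Δ σ ρ f) {c : splitSpace Δ ∅ Finset.univ → ℂ}
    (hc : ContDiff ℝ ∞ c) {C : ℝ} (hC : ∀ H, ‖c H‖ ≤ C) : L2Form Δ σ ρ (fun H => c H • f H) :=
  fun v => (h v).mul hσ hc hC

theorem L2Form.contract {f : splitSpace Δ ∅ Finset.univ →
      splitSpace Δ ∅ Finset.univ [⋀^Fin (k + 1)]→ₗ[ℝ] E} (h : L2Form Δ σ ρ f)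
    (w : splitSpace Δ ∅ Finset.univ) : L2Form Δ σ ρ (fun H => contract E k w (f H)) :=
  fun v => h (Matrix.vecCons w v)

theorem L2Form.extContract (hσ : Continuous σ) (h : L2Form Δ σ ρ f)
    (w : splitSpace Δ ∅ Finset.univ)
    {l : splitSpace Δ ∅ Finset.univ → splitSpace Δ ∅ Finset.univ →L[ℝ] ℝ} (hl : ContDiff ℝ ∞ l)
    {C : ℝ} (hC : ∀ H, ‖l H‖ ≤ C) : L2Form Δ σ ρ (fun H => extContract E w k (l H) (f H)) := by
  cases k with
  | zero => exact fun v => L2Near.zero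
  | succ k =>
    intro v
    have h1 : (fun H => extContract E w (k + 1) (l H) (f H) v) = fun H =>
        ∑ i : Fin (k + 1), (-1 : ℂ) ^ (i : ℕ) • (l H (v i) : ℂ) •
          f H (Matrix.vecCons w (i.removeNth v)) := funext fun H => extMul_apply _ _ v
    rw [h1]
    refine L2Near.sum fun i _ => L2Near.const_smul hσ (L2Near.mul hσ (h _)
      (c := fun H => (l H (v i) : ℂ)) (C := C * ‖v i‖) ?_ fun H => ?_) _
    · exact Complex.ofRealCLM.contDiff.comp (hl.clm_apply contDiff_const)
    · rw [Complex.norm_real]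
      exact ((l H).le_opNorm _).trans (mul_le_mul_of_nonneg_right (hC H) (norm_nonneg _))

theorem SmoothNear.eventually_segSmooth {X : Type*} [AddCommGroup X] [Module ℂ X]
    {F : splitSpace Δ ∅ Finset.univ → X} (h : SmoothNear Δ F) (i : ι) :
    ∀ᶠ H in germFilter Δ ∅ Finset.univ, SegSmooth (rootVec Δ i) (-3) 3 F H := by
  obtain ⟨T, hT⟩ := h
  exact eventually_region_iff.2 ⟨T + rootShift Δ, fun H hH => segSmooth_of_region Δ hT i hH⟩

theorem L2Form.smear (hσ : Continuous σ) (h : L2Form Δ σ ρ f) (i : ι)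
    {u : splitSpace Δ ∅ Finset.univ →L[ℝ] ℝ} {κ : ℝ × ℝ → ℝ} (hκ : ContDiff ℝ ∞ κ) {B : ℝ}
    (hB : ∀ t, ∀ s ∈ Set.uIcc (-3) 3, ‖κ (t, s)‖ ≤ B) :
    L2Form Δ σ ρ (smear (rootVec Δ i) u κ (-3) 3 f) := by
  intro v
  refine ((h v).smear hσ i (u := u) hκ (by norm_num) le_rfl le_rfl hB).congr ?_
  filter_upwards [h.smoothNear.eventually_segSmooth i] with H hH
  exact smear_map hH hκ.continuous (evalAt E v)

theorem L2Form.smearDiff (hσ : Continuous σ) (h : L2Form Δ σ ρ f) (i : ι)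
    {u : splitSpace Δ ∅ Finset.univ →L[ℝ] ℝ} :
    L2Form Δ σ ρ (smearDiff stair (rootVec Δ i) u f) := by
  intro v
  refine ((h v).smearDiff hσ i (u := u)).congr ?_
  filter_upwards [h.smoothNear.eventually_segSmooth i] with H hH
  exact smearDiff_map hH (evalAt E v)

variable (Δ) in
theorem exists_cutoff_bound (K : Finset ι) :
    ∃ C, ∀ H : splitSpace Δ ∅ Finset.univ, ‖(cutoff Δ K (H : V) : ℂ)‖ ≤ C ∧
      ‖fderiv ℝ (fun H : splitSpace Δ ∅ Finset.univ => cutoff Δ K (H : V)) H‖ ≤ C := by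
  obtain ⟨C, hC⟩ := cutoff_bounded Δ K
  refine ⟨C, fun H => ⟨by rw [Complex.norm_real]; exact (hC H).1, ?_⟩⟩
  have h1 : fderiv ℝ (fun H : splitSpace Δ ∅ Finset.univ => cutoff Δ K (H : V)) H =
      (fderiv ℝ (cutoff Δ K) (H : V)).comp (splitSpace Δ ∅ Finset.univ).subtypeL :=
    ((((contDiff_cutoff Δ K).differentiable (by simp)) (H : V)).hasFDerivAt.comp H
      (splitSpace Δ ∅ Finset.univ).subtypeL.hasFDerivAt).fderiv
  rw [h1]
  have h2 := ContinuousLinearMap.opNorm_comp_le (fderiv ℝ (cutoff Δ K) (H : V))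
    (splitSpace Δ ∅ Finset.univ).subtypeL
  have h3 := (splitSpace Δ ∅ Finset.univ).norm_subtypeL_le
  exact h2.trans ((mul_le_of_le_one_right (norm_nonneg _) h3).trans (hC H).2)

theorem L2Form.stepOp (hσ : Continuous σ) {f : splitSpace Δ ∅ Finset.univ →
      splitSpace Δ ∅ Finset.univ [⋀^Fin (k + 1)]→ₗ[ℝ] E} (h : L2Form Δ σ ρ f) (K : Finset ι)
    (i : ι) : L2Form Δ σ ρ (stepOp Δ K i f) := by
  obtain ⟨C, hC⟩ := exists_cutoff_bound Δ K
  exact ((h.contract (rootVec Δ i)).smearDiff hσ i).mul hσ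
    (Complex.ofRealCLM.contDiff.comp (contDiff_cutoff_coe Δ K)) fun H => (hC H).1

/-- Every term is a bounded smooth multiple of the form or of one of its smears; the bounds needed
are those for the kernel with its first derivatives and for the cutoff with its gradient. -/
theorem L2Form.stepChain (hσ : Continuous σ) (h : L2Form Δ σ ρ f) (K : Finset ι) (i : ι) :
    L2Form Δ σ ρ (stepChain Δ K i f) := by
  obtain ⟨C, hC⟩ := exists_cutoff_bound Δ K
  obtain ⟨B, hB⟩ := stair_bounded
  have hI : Set.uIcc (-3 : ℝ) 3 = Set.Icc (-3) 3 := Set.uIcc_of_le (by norm_num)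
  have h1 : L2Form Δ σ ρ (smoothingOp stair (rootVec Δ i) (rootCoord Δ K i) f) :=
    ((h.smear hσ i stair.contDiff₁ fun t s hs => (hB t s (hI ▸ hs)).2.1).extContract hσ
      (rootVec Δ i) (l := fun _ => rootCoord Δ K i) contDiff_const fun _ => le_rfl).sub hσ
    (h.smear hσ i stair.contDiff₂ fun t s hs => (hB t s (hI ▸ hs)).2.2)
  refine (h.sub hσ ((h.sub hσ h1).mul hσ (Complex.ofRealCLM.contDiff.comp
    (contDiff_cutoff_coe Δ K)) fun H => (hC H).1)).sub hσ ?_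
  exact (h.smearDiff hσ i).extContract hσ (rootVec Δ i)
    ((contDiff_cutoff_coe Δ K).fderiv_right (m := ∞) le_rfl) fun H => (hC H).2

variable (Δ σ ρ) in
/-- Germs with square-integrable representatives. -/
noncomputable def l2Germ (hσ : Continuous σ) (k : ℕ) :
    Submodule ℂ (smoothGerm Δ ∅ Finset.univ E k) where
  carrier := {g | ∃ f, g.1 = Germ.ofFun f ∧ L2Form Δ σ ρ f}
  zero_mem' := ⟨fun _ => 0, rfl, fun _ => L2Near.zero⟩
  add_mem' := by
    rintro g g' ⟨f, hf, h⟩ ⟨f', hf', h'⟩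
    exact ⟨fun H => f H + f' H, by change g.1 + g'.1 = _; rw [hf, hf']; rfl,
      fun v => (h v).add (h' v)⟩
  smul_mem' := by
    rintro c g ⟨f, hf, h⟩
    exact ⟨fun H => c • f H, by change c • g.1 = _; rw [hf]; rfl, fun v => (h v).const_smul hσ c⟩

variable (Δ σ ρ) in
/-- The complex of square-integrable germs with square-integrable derivative. -/
noncomputable def l2Subcomplex (hσ : Continuous σ) : Subcomplex (germD Δ ∅ Finset.univ E) where
  carrier k := l2Germ Δ σ ρ hσ k ⊓ (l2Germ Δ σ ρ hσ (k + 1)).comap (germD Δ ∅ Finset.univ E k)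
  d_mem k g hg := ⟨hg.2, by
    change germD Δ ∅ Finset.univ E (k + 1) (germD Δ ∅ Finset.univ E k g) ∈
      l2Germ Δ σ ρ hσ (k + 1 + 1)
    rw [germD_germD]
    exact Submodule.zero_mem _⟩

theorem stepGerm_mem_l2Germ {hσ : Continuous σ} {g : smoothGerm Δ ∅ Finset.univ E (k + 1)}
    (hg : g ∈ l2Germ Δ σ ρ hσ (k + 1)) (K : Finset ι) (i : ι) :
    stepGerm Δ E K i k g ∈ l2Germ Δ σ ρ hσ k := by
  obtain ⟨f, hf, h⟩ := hg
  exact ⟨_, stepGerm_rep hf i, h.stepOp hσ K i⟩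

/-- The differential of the homotopy is recovered from `dh = 1 - (1 - dh - hd) - hd`. All three
terms are square-integrable, so no derivative of the smeared form has to be estimated. -/
theorem stepGerm_mem_l2Subcomplex {hσ : Continuous σ} {g : smoothGerm Δ ∅ Finset.univ E (k + 1)}
    (hg : g ∈ (l2Subcomplex Δ σ ρ hσ).carrier (k + 1)) (K : Finset ι) (i : ι) :
    stepGerm Δ E K i k g ∈ (l2Subcomplex Δ σ ρ hσ).carrier k := by
  refine ⟨stepGerm_mem_l2Germ hg.1 K i, ?_⟩
  have h1 : Subcomplex.chainMap (germD Δ ∅ Finset.univ E) (stepGerm Δ E K i) (k + 1) g ∈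
      l2Germ Δ σ ρ hσ (k + 1) := by
    obtain ⟨f, hf, h⟩ := hg.1
    exact ⟨_, chainMap_stepGerm hf i, h.stepChain hσ K i⟩
  have h2 : germD Δ ∅ Finset.univ E k (stepGerm Δ E K i k g) = g -
      Subcomplex.chainMap (germD Δ ∅ Finset.univ E) (stepGerm Δ E K i) (k + 1) g -
      stepGerm Δ E K i (k + 1) (germD Δ ∅ Finset.univ E (k + 1) g) := by
    change _ = g - (g - germD Δ ∅ Finset.univ E k (stepGerm Δ E K i k g) - _) - _
    abel
  change germD Δ ∅ Finset.univ E k (stepGerm Δ E K i k g) ∈ l2Germ Δ σ ρ hσ (k + 1)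
  rw [h2]
  exact Submodule.sub_mem _ (Submodule.sub_mem _ hg.1 h1) (stepGerm_mem_l2Germ hg.2 K i)

/-- Up to the factor `1 / k!` the weighted pointwise norm is the sum of the squared norms of the
twisted components in an orthonormal basis, so its integral is finite exactly if all components are
square-integrable. -/
theorem isL2On_iff (hσ : Continuous σ) {O : Set (splitSpace Δ ∅ Finset.univ)} (hO : IsOpen O)
    (hf : ∀ H ∈ O, SmoothFn f H) : IsL2On σ ρ (splitSpace Δ ∅ Finset.univ) f O ↔
      ∀ s : Fin k → Fin (finrank ℝ (splitSpace Δ ∅ Finset.univ)),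
        MemLp (fun H : splitSpace Δ ∅ Finset.univ => twist σ ρ H
          (f H fun j => stdOrthonormalBasis ℝ _ (s j))) 2 (volume.restrict O) := by
  let b := stdOrthonormalBasis ℝ (splitSpace Δ ∅ Finset.univ)
  have hm : ∀ s : Fin k → Fin (finrank ℝ (splitSpace Δ ∅ Finset.univ)),
      AEStronglyMeasurable (fun H : splitSpace Δ ∅ Finset.univ => twist σ ρ H
        (f H fun j => b (s j))) (volume.restrict O) := fun s =>
    (continuousOn_twist ((continuous_twist ρ hσ).comp continuous_subtype_val) fun H hH =>
      (hf H hH).map (evalAt E fun j => b (s j))).aestronglyMeasurable hO.measurableSet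
  have h1 : ∀ H : splitSpace Δ ∅ Finset.univ,
      ENNReal.ofReal (fiberNormSq σ _ H (f H) * Real.exp (-ρ H) ^ 2) =
        ENNReal.ofReal ((k.factorial : ℝ)⁻¹) *
          ∑ s : Fin k → Fin (finrank ℝ (splitSpace Δ ∅ Finset.univ)),
            ‖twist σ ρ H (f H fun j => b (s j))‖ₑ ^ 2 := by
    intro H
    have h2 : ∀ s : Fin k → Fin (finrank ℝ (splitSpace Δ ∅ Finset.univ)),
        ‖twist σ ρ H (f H fun j => b (s j))‖ₑ ^ 2 = ENNReal.ofReal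
          (‖σ (Multiplicative.ofAdd (-(H : V))) (f H fun j => b (s j))‖ ^ 2 *
            Real.exp (-ρ H) ^ 2) := by
      intro s
      rw [← ofReal_norm, ← ENNReal.ofReal_pow (norm_nonneg _), twist_apply, norm_smul,
        Complex.norm_real, Real.norm_eq_abs, Real.abs_exp, mul_pow, mul_comm]
    simp only [h2]
    rw [← ENNReal.ofReal_sum_of_nonneg fun s _ => by positivity,
      ← ENNReal.ofReal_mul (by positivity), ← Finset.sum_mul, ← mul_assoc]
    rfl
  have hk : ENNReal.ofReal ((k.factorial : ℝ)⁻¹) ≠ 0 := by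
    rw [ne_eq, ENNReal.ofReal_eq_zero, not_le]
    positivity
  rw [IsL2On]
  simp only [h1]
  rw [lintegral_const_mul' _ _ ENNReal.ofReal_ne_top,
    lintegral_finsetSum' _ fun s _ => (hm s).enorm.pow_const 2,
    ENNReal.mul_lt_top_iff]
  simp only [ENNReal.ofReal_lt_top, true_and, hk, false_or, ENNReal.sum_lt_top, Finset.mem_univ,
    forall_true_left, Finset.sum_eq_zero_iff]
  constructor
  · rintro (h | h) s
    · exact (memLp_two_iff (hm s)).2 (h s)
    · exact (memLp_two_iff (hm s)).2 ((h s).trans_lt ENNReal.zero_lt_top)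
  · exact fun h => Or.inl fun s => (memLp_two_iff (hm s)).1 (h s)

/-- By multilinearity each component is a combination, with constant coefficients, of those on
tuples of basis vectors. -/
theorem L2Form.of_basis (hσ : Continuous σ) {α : Type*} [Fintype α]
    (b : Basis α ℝ (splitSpace Δ ∅ Finset.univ))
    (h : ∀ s : Fin k → α, L2Near Δ σ ρ fun H => f H fun j => b (s j)) : L2Form Δ σ ρ f := by
  classical
  intro v
  have h1 : (fun H => f H v) = fun H => ∑ s : Fin k → α,
      ((∏ j, b.repr (v j) (s j) : ℝ) : ℂ) • f H fun j => b (s j) := by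
    funext H
    have h2 : v = fun j => ∑ i, b.repr (v j) i • b i := funext fun j => (b.sum_repr (v j)).symm
    conv_lhs => rw [h2]
    refine ((f H).toMultilinearMap.map_sum _).trans (Finset.sum_congr rfl fun s _ => ?_)
    refine ((f H).toMultilinearMap.map_smul_univ _ _).trans ?_
    exact (Complex.coe_smul _ _).symm
  rw [h1]
  exact L2Near.sum fun s _ => (h s).const_smul hσ _

theorem L2Form.exists_isL2On (hσ : Continuous σ) (h : L2Form Δ σ ρ f) :
    ∃ T, ∀ T' ≥ T, IsL2On σ ρ (splitSpace Δ ∅ Finset.univ) f (region Δ Finset.univ T') := by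
  let b := stdOrthonormalBasis ℝ (splitSpace Δ ∅ Finset.univ)
  obtain ⟨T, hT⟩ := h.smoothNear
  choose T₁ h₁ using fun s : Fin k → Fin (finrank ℝ (splitSpace Δ ∅ Finset.univ)) =>
    (h fun j => b (s j)).2
  obtain ⟨M, hM⟩ := (Set.finite_range T₁).bddAbove
  refine ⟨max T M, fun T' hT' => (isL2On_iff hσ (isOpen_region Δ _) fun H hH =>
    hT H (SplitForms.region_anti Δ ((le_max_left _ _).trans hT') hH)).2 fun s => ?_⟩
  exact MemLp.region_anti ((hM ⟨s, rfl⟩).trans ((le_max_right _ _).trans hT')) (h₁ s)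

theorem preimage_corner (T : ℝ) : {H : splitSpace Δ ∅ Finset.univ |
    orbitPt Δ Finset.univ (H : V) ∈ corner ι T} = region Δ Finset.univ T :=
  Set.ext fun _ => orbitPt_mem_corner Δ

theorem L2Form.of_isL2On (hσ : Continuous σ) {T : ℝ} (hs : ∀ H ∈ region Δ Finset.univ T, SmoothFn f H)
    (h : IsL2On σ ρ (splitSpace Δ ∅ Finset.univ) f (region Δ Finset.univ T)) :
    L2Form Δ σ ρ f := by
  refine L2Form.of_basis hσ (stdOrthonormalBasis ℝ (splitSpace Δ ∅ Finset.univ)).toBasis fun s => ?_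
  simp only [OrthonormalBasis.coe_toBasis]
  exact ⟨⟨T, fun H hH => (hs H hH).map (evalAt E _)⟩, T,
    (isL2On_iff hσ (isOpen_region Δ T) hs).1 h s⟩

/-- Neighbourhoods of `o_P` may be shrunk to corners, whose traces are the regions where all roots
exceed a constant; there, on a smooth representative, the two integrability conditions become
conditions on components. -/
theorem isL2Germ_iff (hσ : Continuous σ) {g : smoothGerm Δ ∅ Finset.univ E k} :
    IsL2Germ Δ E σ ρ k g ↔ g ∈ (l2Subcomplex Δ σ ρ hσ).carrier k := by
  constructor
  · rintro ⟨U, hU, hUo, f, hf, hs, h1, h2⟩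
    obtain ⟨T, hT⟩ := exists_corner_subset Δ hU hUo
    obtain ⟨T', hT'⟩ := (smoothNear_of_germ (germD_rep hf))
    have hsub : region Δ Finset.univ (max T T') ⊆
        {H : splitSpace Δ ∅ Finset.univ | orbitPt Δ Finset.univ (H : V) ∈ U} := fun H hH =>
      hT ((orbitPt_mem_corner Δ).2 (SplitForms.region_anti Δ (le_max_left _ _) hH))
    refine ⟨⟨f, hf, L2Form.of_isL2On hσ (fun H hH => smoothFormAt_iff.1 (hs H (hsub hH))) ?_⟩,
      ⟨dForm f, germD_rep hf, L2Form.of_isL2On hσ (T := max T T')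
        (fun H hH => hT' H (SplitForms.region_anti Δ (le_max_right _ _) hH)) ?_⟩⟩
    · exact (lintegral_mono_set hsub).trans_lt h1
    · exact (lintegral_mono_set hsub).trans_lt h2
  · rintro ⟨⟨f, hf, h⟩, f', hf', h'⟩
    have h2 : L2Form Δ σ ρ (dForm f) := h'.congr (Germ.coe_eq.1 (hf'.symm.trans (germD_rep hf)))
    obtain ⟨T, hT⟩ := h.smoothNear
    obtain ⟨T₁, hT₁⟩ := h.exists_isL2On hσ
    obtain ⟨T₂, hT₂⟩ := h2.exists_isL2On hσ
    refine ⟨corner ι (max T (max T₁ T₂)), isOpen_corner _, orbitPt_empty_mem_corner Δ _, f, hf,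
      fun H hH => smoothFormAt_iff.2 (hT H (SplitForms.region_anti Δ (le_max_left _ _)
        ((orbitPt_mem_corner Δ).1 hH))), ?_, ?_⟩
    · rw [preimage_corner]
      exact hT₁ _ ((le_max_left _ _).trans (le_max_right _ _))
    · rw [preimage_corner]
      exact hT₂ _ ((le_max_right _ _).trans (le_max_right _ _))

end SquareIntegrableForms
end SplitForms

/-! ### The proposition: both complexes are stable under all the homotopies -/

theorem mainTheorem8 {V : Type u} [NormedAddCommGroup V] [InnerProductSpace ℝ V]
    [FiniteDimensional ℝ V] [MeasurableSpace V] [BorelSpace V] {ι : Type*} [Fintype ι]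
    (Δ : Basis ι ℝ V) (hΔ : ∀ i j, i ≠ j → ⟪Δ i, Δ j⟫_ℝ ≤ 0) :
    (∀ (E : Type u) [AddCommGroup E] [Module ℂ E],
      ∃ S : Subcomplex (germD Δ ∅ Finset.univ E),
        (∀ k g, g ∈ S.carrier k ↔ IsQuasiSpecialGerm Δ E k g) ∧
        S.InclusionIsQuasiIso (Subcomplex.whole _)) ∧
    (∀ (E : Type u) [NormedAddCommGroup E] [InnerProductSpace ℂ E] [FiniteDimensional ℂ E]
      (σ : Multiplicative V →* (E →L[ℂ] E)) (ρ : V →ₗ[ℝ] ℝ), Continuous σ →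
      (∀ a, (σ a : E →ₗ[ℂ] E).IsSymmetric) →
      ∃ S T : Subcomplex (germD Δ ∅ Finset.univ E),
        (∀ k g, g ∈ S.carrier k ↔ IsQuasiSpecialGerm Δ E k g ∧ IsL2Germ Δ E σ ρ k g) ∧
        (∀ k g, g ∈ T.carrier k ↔ IsL2Germ Δ E σ ρ k g) ∧
        S.InclusionIsQuasiIso T) := by
  refine ⟨fun E _ _ => ⟨decSubcomplex (Subcomplex.whole _) Finset.univ, fun k g => ?_, ?_⟩,
    fun E _ _ _ σ ρ hσ _ => ⟨decSubcomplex (l2Subcomplex Δ σ ρ hσ) Finset.univ,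
      l2Subcomplex Δ σ ρ hσ, fun k g => ?_, fun k g => (isL2Germ_iff hσ).symm, ?_⟩⟩
  · rw [mem_decSubcomplex, isQuasiSpecialGerm_iff]
    simp [Subcomplex.whole]
  · exact decSubcomplex_quasiIso (fun _ _ _ _ _ _ => Submodule.mem_top) _
  · rw [mem_decSubcomplex, isQuasiSpecialGerm_iff, isL2Germ_iff hσ, and_comm]
    simp
  · exact decSubcomplex_quasiIso (fun K i _ _ _ hg => stepGerm_mem_l2Subcomplex hg K i) _
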